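/- \textbf{Setting.} $P$ is a one-to-one two-sided market with a set $W$ of $m$ workers and a set $F$ of $n$ firms (positions). Each participant has a strict preference list over some participants of the other side, and $w$ is on the list of $f$ if and only if $f$ is on the list of $w$; then $(w,f)$ is called acceptable. A matching is a set $M$ of acceptable pairs in which every participant occurs at most once. An acceptable pair $(w,f)\notin M$ blocks $M$ if $w$ is unmatched or prefers $f$ to its partner in $M$, and $f$ is unmatched or prefers $w$ to its partner in $M$; $M$ is stable if no pair blocks it. Let $V$ be the set of acceptable pairs and $D\subseteq V$. For $v=(w,f)\in D$ let $d_W^+(v)$ be the number of pairs $(w,f')\in D$ such that $w$ prefers $f'$ to $f$, and let $d_F^+(v)$ be the number of pairs $(w',f)\in D$ such that $f$ prefers $w'$ to $w$. Let $M_W(D)=\{v\in D: d_W^+(v)=0\}$ and $M_F(D)=\{v\in D: d_F^+(v)=0\}$. The \emph{row} of $w$ is the set of pairs with worker $w$, the \emph{column} of $f$ the set of pairs with firm $f$. \textbf{IDUA.} One round deletes from $D$, simultaneously: for every $(w,f)\in M_F(D)$, all pairs $(w,f')\in D$ such that $w$ prefers $f$ to $f'$; and for every $(w,f)\in M_W(D)$,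 all pairs $(w',f)\in D$ such that $f$ prefers $w$ to $w'$. IDUA repeats such rounds until nothing changes. \textbf{Algorithm 1.} Input: $P$ and two disjoint sets $V^{in},V^{out}\subseteq W\times F$. Run IDUA on $V$; let $D^*$ be the result and $r$ the number of its non-empty rows. Start with an empty collection of solutions, call Algorithm 2 on $(D^*,V^{in},V^{out})$, and return the collection. \textbf{Algorithm 2} on $(D,V^{in},V^{out})$. (1) If $V^{in}\not\subseteq D$, return. Add to $V^{out}$ every pair that lies in the row or the column of a different pair of $V^{in}$. (2) While there is a $v\in D\cap V^{out}$ with $d_W^+(v)=0$ or $d_F^+(v)=0$, pick such a $v$ and replace $D$ by the result of IDUA on $D\setminus\{v\}$. (3) Compute $M_W=M_W(D)$ and $M_F=M_F(D)$. (4) If $|M_W|<r$ or $V^{in}\not\subseteq D$, return. (5) If $M_W=M_F$, output $M_W$ (add it to the collection) and return. (6) Otherwise pick $v\in M_W\setminus M_F$, call Algorithm 2 on $(D,V^{in}\cup\{v\},V^{out})$, then on $(D,V^{in},V^{out}\cup\{v\})$, and return. \textbf{Theorem.} For every $P$ and all disjoint $V^{in},V^{out}$, whatever choices are made in (2) and (6),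 Algorithm 1 terminates, and it outputs exactly the stable matchings of $P$ that contain every pair of $V^{in}$ and no pair of $V^{out}$, each of them once. Moreover, let $N=\max\{m,n\}\ge 1$ and let $s$ be the number of matchings that are output. On a unit-cost random access machine (with arrays of natural numbers, where every command, operation, memory access and printed number costs one unit of time), Algorithm 1 has an implementation, by a fixed program, that runs in time $O(N^3+N^3s)$ and in which the time between two consecutive outputs is $O(N^3)$. The constants are absolute. The implementation keeps the best and the worst remaining partner of every participant, and keeps $D$, $V^{in}$, $V^{out}$ as $0$-$1$ flags of the pairs, which it copies before branching in (6). -/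

import Mathlib

namespace StableMatch

/-! ## One-to-one matching markets and stability -/

/-- A one-to-one two-sided market with `m` workers and `n` firms (positions): one strict preference
list per participant, best first; `w` is on the list of `f` if and only if `f` is on that of `w`. -/
structure Market (m n : ℕ) where
  workerPref : Fin m → List (Fin n)
  firmPref : Fin n → List (Fin m)
  workerPref_nodup : ∀ w, (workerPref w).Nodup
  firmPref_nodup : ∀ f, (firmPref f).Nodup
  acceptable_iff : ∀ w f, f ∈ workerPref w ↔ w ∈ firmPref f

/-- `Precedes l a b`: both `a` and `b` are on the list `l`, and `a` is listed before `b`. -/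
def Precedes {α : Type} [DecidableEq α] (l : List α) (a b : α) : Prop :=
  a ∈ l ∧ b ∈ l ∧ l.idxOf a < l.idxOf b

instance {α : Type} [DecidableEq α] (l : List α) (a b : α) : Decidable (Precedes l a b) :=
  inferInstanceAs (Decidable (_ ∧ _ ∧ _))

variable {m n : ℕ}

/-- The acceptable pairs, i.e. the vertex set of the matching digraph `D(P)`. -/
def Market.vertices (P : Market m n) : Finset (Fin m × Fin n) :=
  Finset.univ.filter fun v => v.2 ∈ P.workerPref v.1

/-- A matching: a set of acceptable pairs in which every participant appears at most once. -/
def IsMatching (P : Market m n) (M : Finset (Fin m × Fin n)) : Prop :=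
  M ⊆ P.vertices ∧ (∀ u ∈ M, ∀ v ∈ M, u.1 = v.1 → u = v) ∧ (∀ u ∈ M, ∀ v ∈ M, u.2 = v.2 → u = v)

/-- `(w, f)` blocks `M`: it is an acceptable pair outside `M`, `w` is unmatched or prefers `f` to
the current partner, and `f` is unmatched or prefers `w` to the current partner. -/
def Blocks (P : Market m n) (M : Finset (Fin m × Fin n)) (w : Fin m) (f : Fin n) : Prop :=
  (w, f) ∈ P.vertices ∧ (w, f) ∉ M ∧
    (∀ f', (w, f') ∈ M → Precedes (P.workerPref w) f f') ∧
    (∀ w', (w', f) ∈ M → Precedes (P.firmPref f) w w')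

/-- A stable matching. -/
def IsStable (P : Market m n) (M : Finset (Fin m × Fin n)) : Prop :=
  IsMatching P M ∧ ∀ w f, ¬ Blocks P M w f

/-! ## The matching digraph and the iterated deletion of unattractive alternatives

All digraphs that occur are induced subdigraphs of `D(P)`, so each is given by its vertex set. -/

/-- There is an arc of `A_W` from `u` to `v`. -/
def ArcW (P : Market m n) (u v : Fin m × Fin n) : Prop :=
  u.1 = v.1 ∧ Precedes (P.workerPref u.1) v.2 u.2

/-- There is an arc of `A_F` from `u` to `v`. -/
def ArcF (P : Market m n) (u v : Fin m × Fin n) : Prop :=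
  u.2 = v.2 ∧ Precedes (P.firmPref u.2) v.1 u.1

instance (P : Market m n) (u v : Fin m × Fin n) : Decidable (ArcW P u v) :=
  inferInstanceAs (Decidable (_ ∧ _))

instance (P : Market m n) (u v : Fin m × Fin n) : Decidable (ArcF P u v) :=
  inferInstanceAs (Decidable (_ ∧ _))

/-- The number of arcs of `A_W` that leave `v` in the subdigraph induced by `D`. -/
def degW (P : Market m n) (D : Finset (Fin m × Fin n)) (v : Fin m × Fin n) : ℕ :=
  (D.filter fun u => ArcW P v u).card

/-- The number of arcs of `A_F` that leave `v` in the subdigraph induced by `D`. -/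
def degF (P : Market m n) (D : Finset (Fin m × Fin n)) (v : Fin m × Fin n) : ℕ :=
  (D.filter fun u => ArcF P v u).card

/-- The operator `R`: one round of deletions. -/
def reduce (P : Market m n) (D : Finset (Fin m × Fin n)) : Finset (Fin m × Fin n) :=
  D.filter fun u => ¬ ∃ v ∈ D, (degF P D v = 0 ∧ ArcW P u v) ∨ (degW P D v = 0 ∧ ArcF P u v)

/-- IDUA: apply `R` until nothing changes. -/
def idua (P : Market m n) (D : Finset (Fin m × Fin n)) : Finset (Fin m × Fin n) :=
  if _h : reduce P D = D then D else idua P (reduce P D)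
termination_by D.card
decreasing_by
  exact Finset.card_lt_card ((Finset.filter_subset _ _).ssubset_of_ne (by assumption))

/-- The set `M_W` of the vertices of `D` that no arc of `A_W` leaves. -/
def topW (P : Market m n) (D : Finset (Fin m × Fin n)) : Finset (Fin m × Fin n) :=
  D.filter fun v => degW P D v = 0

/-- The set `M_F` of the vertices of `D` that no arc of `A_F` leaves. -/
def topF (P : Market m n) (D : Finset (Fin m × Fin n)) : Finset (Fin m × Fin n) :=
  D.filter fun v => degF P D v = 0

/-! ## The two algorithms, with all their free choices -/

/-- Step 2.1: add to `Vout` every pair that shares its row or column with another pair of `Vin`. -/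
def forbid (Vin Vout : Finset (Fin m × Fin n)) : Finset (Fin m × Fin n) :=
  Vout ∪ Finset.univ.filter fun u => ∃ v ∈ Vin, u ≠ v ∧ (u.1 = v.1 ∨ u.2 = v.2)

/-- The test of the loop in Step 2.2. -/
def Removable (P : Market m n) (Vout D : Finset (Fin m × Fin n)) (v : Fin m × Fin n) : Prop :=
  v ∈ D ∧ v ∈ Vout ∧ (degW P D v = 0 ∨ degF P D v = 0)

/-- Step 2.2: `Purge P Vout D D'` holds if the loop, started on `D`, may end with `D'`. -/
inductive Purge (P : Market m n) (Vout : Finset (Fin m × Fin n)) :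
    Finset (Fin m × Fin n) → Finset (Fin m × Fin n) → Prop
  | done (D : Finset (Fin m × Fin n)) (h : ∀ v, ¬ Removable P Vout D v) : Purge P Vout D D
  | again (D D' : Finset (Fin m × Fin n)) (v : Fin m × Fin n) (h : Removable P Vout D v)
      (h' : Purge P Vout (idua P (D.erase v)) D') : Purge P Vout D D'

/-- `Reaches5 P r D Vin Vout D'`: the call of Algorithm 2 on `(D, Vin, Vout)` may arrive at Step 2.5
with the digraph `D'`, i.e. it returns neither in Step 2.1 nor in Step 2.4. -/
def Reaches5 (P : Market m n) (r : ℕ) (D Vin Vout D' : Finset (Fin m × Fin n)) : Prop :=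
  Vin ⊆ D ∧ Purge P (forbid Vin Vout) D D' ∧ r ≤ (topW P D').card ∧ Vin ⊆ D'

/-- Algorithm 2: `Algorithm2 P r D Vin Vout L` holds if the call on `(D, Vin, Vout)` may finish
after having added, in this order, the members of the list `L` to `AllSolutions`. -/
inductive Algorithm2 (P : Market m n) (r : ℕ) :
    Finset (Fin m × Fin n) → Finset (Fin m × Fin n) → Finset (Fin m × Fin n) →
      List (Finset (Fin m × Fin n)) → Prop
  | return1 (D Vin Vout : Finset (Fin m × Fin n)) (h : ¬ Vin ⊆ D) : Algorithm2 P r D Vin Vout []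
  | return4 (D Vin Vout D' : Finset (Fin m × Fin n)) (h₁ : Vin ⊆ D)
      (h₂ : Purge P (forbid Vin Vout) D D') (h₄ : (topW P D').card < r ∨ ¬ Vin ⊆ D') :
      Algorithm2 P r D Vin Vout []
  | return5 (D Vin Vout D' : Finset (Fin m × Fin n)) (h : Reaches5 P r D Vin Vout D')
      (h₅ : topW P D' = topF P D') : Algorithm2 P r D Vin Vout [topW P D']
  | branch6 (D Vin Vout D' : Finset (Fin m × Fin n)) (v : Fin m × Fin n)
      (La Lb : List (Finset (Fin m × Fin n))) (h : Reaches5 P r D Vin Vout D')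
      (h₆ : v ∈ topW P D' \ topF P D')
      (ha : Algorithm2 P r D' (insert v Vin) (forbid Vin Vout) La)
      (hb : Algorithm2 P r D' Vin (insert v (forbid Vin Vout)) Lb) :
      Algorithm2 P r D Vin Vout (La ++ Lb)

/-- The recursion of Algorithm 2 on `(D, Vin, Vout)` is finite, whatever choices are made. -/
inductive Algorithm2Halts (P : Market m n) (r : ℕ) :
    Finset (Fin m × Fin n) → Finset (Fin m × Fin n) → Finset (Fin m × Fin n) → Prop
  | intro (D Vin Vout : Finset (Fin m × Fin n))
      (ha : ∀ D' v, Reaches5 P r D Vin Vout D' → v ∈ topW P D' \ topF P D' →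
        Algorithm2Halts P r D' (insert v Vin) (forbid Vin Vout))
      (hb : ∀ D' v, Reaches5 P r D Vin Vout D' → v ∈ topW P D' \ topF P D' →
        Algorithm2Halts P r D' Vin (insert v (forbid Vin Vout))) :
      Algorithm2Halts P r D Vin Vout

/-- The number of non-empty rows. -/
def rows (D : Finset (Fin m × Fin n)) : ℕ := (D.image Prod.fst).card

/-- Algorithm 1: `Algorithm1 P Vin Vout L` holds if the algorithm may return the solutions in `L`,
found in this order. -/
def Algorithm1 (P : Market m n) (Vin Vout : Finset (Fin m × Fin n))
    (L : List (Finset (Fin m × Fin n))) : Prop :=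
  Algorithm2 P (rows (idua P P.vertices)) (idua P P.vertices) Vin Vout L

/-- Algorithm 1 halts, whatever choices are made. -/
def Algorithm1Halts (P : Market m n) (Vin Vout : Finset (Fin m × Fin n)) : Prop :=
  Algorithm2Halts P (rows (idua P P.vertices)) (idua P P.vertices) Vin Vout

/-! ## A machine with a step count

A random access machine with a fixed number of registers and of arrays of natural numbers, run by a
structured program that may call itself. Every executed command, every operation, every memory
access and every printed number costs one unit of time. -/

/-- The registers. -/
inductive Reg
  | m | n | r | lvl | w | f | i | g | dw | df | pw | pf | go | ok | found | cnt
  deriving DecidableEq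

/-- The arrays: the preference lists and their lengths, the digraph and the two flags of every
vertex, the best and the worst remaining partner of every participant, and the saved copies. -/
inductive Arr
  | prefW | lenW | prefF | lenF | D | vin | vout | bestW | worstW | bestF | worstF
  | saveD | saveIn | saveOut | saveW | saveF
  deriving DecidableEq

/-- Expressions; a test has the value `1` if it succeeds and `0` if it fails. -/
inductive Exp
  | lit (k : ℕ)
  | reg (x : Reg)
  | get (a : Arr) (e : Exp)
  | add (d e : Exp)
  | sub (d e : Exp)
  | mul (d e : Exp)
  | eq (d e : Exp)
  | lt (d e : Exp)

/-- Commands; `call` is a recursive call of the (only) procedure, `print a e` prints the record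
`a[0], …, a[e-1]`. -/
inductive Cmd
  | skip
  | set (x : Reg) (e : Exp)
  | put (a : Arr) (d e : Exp)
  | seq (c d : Cmd)
  | ite (e : Exp) (c d : Cmd)
  | loop (e : Exp) (c : Cmd)
  | print (a : Arr) (e : Exp)
  | call

/-- The memory. -/
structure Store where
  reg : Reg → ℕ
  arr : Arr → ℕ → ℕ

/-- Write `v` into register `x`. -/
def Store.setReg (s : Store) (x : Reg) (v : ℕ) : Store :=
  ⟨Function.update s.reg x v, s.arr⟩

/-- Write `v` into `a[i]`. -/
def Store.setArr (s : Store) (a : Arr) (i v : ℕ) : Store :=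
  ⟨s.reg, Function.update s.arr a (Function.update (s.arr a) i v)⟩

/-- The value of an expression. -/
def Exp.eval (s : Store) : Exp → ℕ
  | .lit k => k
  | .reg x => s.reg x
  | .get a e => s.arr a (e.eval s)
  | .add d e => d.eval s + e.eval s
  | .sub d e => d.eval s - e.eval s
  | .mul d e => d.eval s * e.eval s
  | .eq d e => if d.eval s = e.eval s then 1 else 0
  | .lt d e => if d.eval s < e.eval s then 1 else 0

/-- The time needed to evaluate an expression. -/
def Exp.cost : Exp → ℕ
  | .lit _ => 1
  | .reg _ => 1
  | .get _ e => 1 + e.cost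
  | .add d e => 1 + d.cost + e.cost
  | .sub d e => 1 + d.cost + e.cost
  | .mul d e => 1 + d.cost + e.cost
  | .eq d e => 1 + d.cost + e.cost
  | .lt d e => 1 + d.cost + e.cost

/-- A configuration: the commands still to be executed, the memory, the time that has passed, and
the records printed so far, in order, each with the time at which it was complete. -/
structure Config where
  code : List Cmd
  store : Store
  clock : ℕ
  tape : List (ℕ × List ℕ)

/-- One step of the machine whose procedure is `body`. -/
def step (body : Cmd) : Config → Config
  | ⟨[], s, t, o⟩ => ⟨[], s, t, o⟩
  | ⟨.skip :: K, s, t, o⟩ => ⟨K, s, t + 1, o⟩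
  | ⟨.set x e :: K, s, t, o⟩ =>
      ⟨K, s.setReg x (e.eval s), t + (1 + e.cost), o⟩
  | ⟨.put a d e :: K, s, t, o⟩ =>
      ⟨K, s.setArr a (d.eval s) (e.eval s), t + (1 + d.cost + e.cost), o⟩
  | ⟨.seq c d :: K, s, t, o⟩ => ⟨c :: d :: K, s, t + 1, o⟩
  | ⟨.ite e c d :: K, s, t, o⟩ =>
      ⟨(if e.eval s = 0 then d else c) :: K, s, t + (1 + e.cost), o⟩
  | ⟨.loop e c :: K, s, t, o⟩ =>
      ⟨if e.eval s = 0 then K else c :: .loop e c :: K, s, t + (1 + e.cost), o⟩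
  | ⟨.print a e :: K, s, t, o⟩ =>
      ⟨K, s, t + (1 + e.cost + e.eval s),
        o ++ [(t + (1 + e.cost + e.eval s), (List.range (e.eval s)).map (s.arr a))]⟩
  | ⟨.call :: K, s, t, o⟩ => ⟨body :: K, s, t + 1, o⟩

/-- The run of `main`, with procedure `body`, on the initial memory `s` halts in configuration
`c`. -/
def HaltsIn (main body : Cmd) (s : Store) (c : Config) : Prop :=
  c.code = [] ∧ ∃ k : ℕ, (step body)^[k] ⟨[main], s, 0, []⟩ = c

/-! ## The implementation of the two algorithms on the machine -/

infixr:60 " ;; " => Cmd.seq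
infix:70 " ≔ " => Cmd.set

/-- `if e then c`. -/
def when (e : Exp) (c : Cmd) : Cmd := .ite e c .skip

/-- `if not e then c`. -/
def unless' (e : Exp) (c : Cmd) : Cmd := .ite e .skip c

/-- `for x = 0, …, e - 1 do c`. -/
def forUpTo (x : Reg) (e : Exp) (c : Cmd) : Cmd :=
  x ≔ .lit 0 ;; .loop (.lt (.reg x) e) (c ;; x ≔ .add (.reg x) (.lit 1))

/-- The address of the pair `(d, e)` in an array that is indexed by worker-firm pairs. -/
def cell (d e : Exp) : Exp := .add (.mul d (.reg .n)) e

/-- Find the best and the worst remaining firm of worker `x` (the value `n` stands for none). -/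
def refreshRow (x : Reg) : Cmd :=
  .put .bestW (.reg x) (.reg .n) ;;
  .put .worstW (.reg x) (.reg .n) ;;
  forUpTo .i (.get .lenW (.reg x))
    (.g ≔ .get .prefW (cell (.reg x) (.reg .i)) ;;
     when (.get .D (cell (.reg x) (.reg .g)))
       (.put .worstW (.reg x) (.reg .g) ;;
        when (.eq (.get .bestW (.reg x)) (.reg .n)) (.put .bestW (.reg x) (.reg .g))))

/-- Find the best and the worst remaining worker of firm `x` (the value `m` stands for none). -/
def refreshCol (x : Reg) : Cmd :=
  .put .bestF (.reg x) (.reg .m) ;;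
  .put .worstF (.reg x) (.reg .m) ;;
  forUpTo .i (.get .lenF (.reg x))
    (.g ≔ .get .prefF (.add (.mul (.reg x) (.reg .m)) (.reg .i)) ;;
     when (.get .D (cell (.reg .g) (.reg x)))
       (.put .worstF (.reg x) (.reg .g) ;;
        when (.eq (.get .bestF (.reg x)) (.reg .m)) (.put .bestF (.reg x) (.reg .g))))

/-- Find the best and the worst remaining partner of every participant. -/
def refreshAll : Cmd :=
  forUpTo .w (.reg .m) (refreshRow .w) ;; forUpTo .f (.reg .n) (refreshCol .f)

/-- Delete the vertex `(dw, df)` from the digraph. -/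
def deleteVertex : Cmd :=
  .put .D (cell (.reg .dw) (.reg .df)) (.lit 0) ;; refreshRow .dw ;; refreshCol .df

/-- IDUA: while some best firm of a worker `w` still has a worker worse than `w`, or some best
worker of a firm `f` still has a firm worse than `f`, delete such a vertex. -/
def runIdua : Cmd :=
  .go ≔ .lit 1 ;;
  .loop (.reg .go)
    (.go ≔ .lit 0 ;;
     forUpTo .w (.reg .m)
       (.f ≔ .get .bestW (.reg .w) ;;
        unless' (.eq (.reg .f) (.reg .n))
          (unless' (.eq (.get .worstF (.reg .f)) (.reg .w))
            (.dw ≔ .get .worstF (.reg .f) ;; .df ≔ .reg .f ;; .go ≔ .lit 1))) ;;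
     forUpTo .f (.reg .n)
       (.w ≔ .get .bestF (.reg .f) ;;
        unless' (.eq (.reg .w) (.reg .m))
          (unless' (.eq (.get .worstW (.reg .w)) (.reg .f))
            (.dw ≔ .reg .w ;; .df ≔ .get .worstW (.reg .w) ;; .go ≔ .lit 1))) ;;
     when (.reg .go) deleteVertex)

/-- Put the number of non-empty rows, which is the number of vertices of `M_W`, into `x`. -/
def countRows (x : Reg) : Cmd :=
  x ≔ .lit 0 ;;
  forUpTo .w (.reg .m)
    (unless' (.eq (.get .bestW (.reg .w)) (.reg .n)) (x ≔ .add (.reg x) (.lit 1)))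

/-- `ok := (V^in ⊆ V(D))`. -/
def checkIn : Cmd :=
  .ok ≔ .lit 1 ;;
  forUpTo .w (.reg .m) (forUpTo .f (.reg .n)
    (when (.get .vin (cell (.reg .w) (.reg .f)))
      (unless' (.get .D (cell (.reg .w) (.reg .f))) (.ok ≔ .lit 0))))

/-- The second part of Step 2.1. -/
def forbidCmd : Cmd :=
  forUpTo .w (.reg .m) (forUpTo .f (.reg .n)
    (when (.get .vin (cell (.reg .w) (.reg .f)))
      (forUpTo .i (.reg .n)
         (unless' (.eq (.reg .i) (.reg .f)) (.put .vout (cell (.reg .w) (.reg .i)) (.lit 1))) ;;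
       forUpTo .i (.reg .m)
         (unless' (.eq (.reg .i) (.reg .w)) (.put .vout (cell (.reg .i) (.reg .f)) (.lit 1))))))

/-- Step 2.2. -/
def purgeCmd : Cmd :=
  .found ≔ .lit 1 ;;
  .loop (.reg .found)
    (.found ≔ .lit 0 ;;
     forUpTo .w (.reg .m)
       (.f ≔ .get .bestW (.reg .w) ;;
        unless' (.eq (.reg .f) (.reg .n))
          (when (.get .vout (cell (.reg .w) (.reg .f)))
            (.dw ≔ .reg .w ;; .df ≔ .reg .f ;; .found ≔ .lit 1))) ;;
     forUpTo .f (.reg .n)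
       (.w ≔ .get .bestF (.reg .f) ;;
        unless' (.eq (.reg .w) (.reg .m))
          (when (.get .vout (cell (.reg .w) (.reg .f)))
            (.dw ≔ .reg .w ;; .df ≔ .reg .f ;; .found ≔ .lit 1))) ;;
     when (.reg .found) (deleteVertex ;; runIdua))

/-- `found := (M_W ⊄ M_F)`, and `(pw, pf)` is then a vertex of `M_W` outside `M_F`. -/
def findPivot : Cmd :=
  .found ≔ .lit 0 ;;
  forUpTo .w (.reg .m)
    (.f ≔ .get .bestW (.reg .w) ;;
     unless' (.eq (.reg .f) (.reg .n))
       (unless' (.eq (.get .bestF (.reg .f)) (.reg .w))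
         (.pw ≔ .reg .w ;; .pf ≔ .reg .f ;; .found ≔ .lit 1)))

/-- The address of entry `i` of the copy saved on level `lvl`. -/
def saved : Exp := .add (.mul (.reg .lvl) (.mul (.reg .m) (.reg .n))) (.reg .i)

/-- Save a copy of the digraph, of the two sets and of the vertex `(pw, pf)` on level `lvl`. -/
def saveAll : Cmd :=
  forUpTo .i (.mul (.reg .m) (.reg .n))
    (.put .saveD saved (.get .D (.reg .i)) ;;
     .put .saveIn saved (.get .vin (.reg .i)) ;;
     .put .saveOut saved (.get .vout (.reg .i))) ;;
  .put .saveW (.reg .lvl) (.reg .pw) ;;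
  .put .saveF (.reg .lvl) (.reg .pf)

/-- Restore what has been saved on level `lvl`. -/
def restoreAll : Cmd :=
  forUpTo .i (.mul (.reg .m) (.reg .n))
    (.put .D (.reg .i) (.get .saveD saved) ;;
     .put .vin (.reg .i) (.get .saveIn saved) ;;
     .put .vout (.reg .i) (.get .saveOut saved)) ;;
  .pw ≔ .get .saveW (.reg .lvl) ;;
  .pf ≔ .get .saveF (.reg .lvl) ;;
  refreshAll

/-- Step 2.6. -/
def branchCmd : Cmd :=
  saveAll ;;
  .lvl ≔ .add (.reg .lvl) (.lit 1) ;;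
  .put .vin (cell (.reg .pw) (.reg .pf)) (.lit 1) ;;
  .call ;;
  .lvl ≔ .sub (.reg .lvl) (.lit 1) ;;
  restoreAll ;;
  .put .vout (cell (.reg .pw) (.reg .pf)) (.lit 1) ;;
  .call

/-- Algorithm 2, the recursive procedure. -/
def program2 : Cmd :=
  checkIn ;;
  when (.reg .ok)
    (forbidCmd ;;
     purgeCmd ;;
     countRows .cnt ;;
     checkIn ;;
     unless' (.lt (.reg .cnt) (.reg .r))
       (when (.reg .ok)
         (findPivot ;; .ite (.reg .found) branchCmd (.print .bestW (.reg .m)))))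

/-- Algorithm 1, the main program. -/
def program1 : Cmd :=
  forUpTo .w (.reg .m) (forUpTo .i (.get .lenW (.reg .w))
    (.put .D (cell (.reg .w) (.get .prefW (cell (.reg .w) (.reg .i)))) (.lit 1))) ;;
  refreshAll ;;
  runIdua ;;
  countRows .r ;;
  .lvl ≔ .lit 0 ;;
  .call

/-- The initial memory: `m`, `n`, the preference lists (entry `i` of the list of worker `w` at
address `w * n + i`, entry `i` of the list of firm `f` at address `f * m + i`) and their lengths,
and the `0`-`1` matrices of the sets `Vin` and `Vout`; everything else is `0`. -/
def input (P : Market m n) (Vin Vout : Finset (Fin m × Fin n)) : Store where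
  reg
    | .m => m
    | .n => n
    | _ => 0
  arr
    | .lenW => fun k => if h : k < m then (P.workerPref ⟨k, h⟩).length else 0
    | .lenF => fun k => if h : k < n then (P.firmPref ⟨k, h⟩).length else 0
    | .prefW => fun k =>
        if h : k / n < m then (((P.workerPref ⟨k / n, h⟩)[k % n]?).map Fin.val).getD 0 else 0
    | .prefF => fun k =>
        if h : k / m < n then (((P.firmPref ⟨k / m, h⟩)[k % m]?).map Fin.val).getD 0 else 0
    | .vin => fun k => if ∃ v ∈ Vin, k = v.1.val * n + v.2.val then 1 else 0
    | .vout => fun k => if ∃ v ∈ Vout, k = v.1.val * n + v.2.val then 1 else 0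
    | _ => fun _ => 0

/-- The record that represents the matching `M`: for each worker in turn the number of the firm
matched with that worker, or `n` if there is none. -/
def record (M : Finset (Fin m × Fin n)) : List ℕ :=
  List.ofFn fun w : Fin m =>
    match (List.finRange n).find? fun f => decide ((w, f) ∈ M) with
    | some f => f.val
    | none => n

end StableMatch

namespace StableMatch

/-! ### Preference arcs and the extreme vertices of rows and columns. -/

section
variable {m n : ℕ}

/-! The digraph shrinks without losing a solution. If a round of deletions removed a pair of a
stable matching still contained in the digraph, the vertex responsible for the removal would block
that matching; so stable matchings survive IDUA (`IsStable.subset_idua`). Beyond that, the loop of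
Step 2.2 discards only forbidden pairs (`Purge.solves_iff`).

Where IDUA has nothing left to do, the best vertex of a row is the worst of its column, and
conversely (`Reduced.arcF_of_topW`, `Reduced.arcW_of_topF`). Hence `topW` and `topF` are matchings
that meet every non-empty row and column, and every stable matching inside the digraph has their
size (`IsStable.card_eq`). If the number of non-empty rows is still `r`, both are stable: a blocking
pair inside the digraph contradicts extremality, and one outside is worse than all that remains in
its row or in its column (`Sound`), a line that is still non-empty and hence matched
(`Sound.not_blocks`).

After Step 2.2 no extreme vertex is forbidden, which forces `Vin` into `topW` and into `topF`. A
call that arrives at Step 2.5 therefore knows two solutions. If they coincide, the digraph is that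
matching and there is no other solution. Otherwise the pivot in `topW` but not in `topF` splits the
solutions into two classes, the first containing `topW` and the second `topF`. This gives
`Algorithm2.spec`, and it shows that no branch is barren, which is what the delay bound rests on.

The machine deletes vertices one at a time; this is legitimate because deletion is confluent
(`idua_eq_of_dominated`). A deletion costs O(N), since only one row and one column are rescanned. A
call costs O(N^2), plus O(N) per deleted vertex and per pair of `Vin`. On the way to its first
output a call takes first branches only; each adds a pair to `Vin`, which is contained in a
matching, so there are at most N of them, and since the digraphs are nested at most N^2 vertices are
deleted on the way. The first output thus comes after O(N^3). Between the last output of a first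
branch and the first output of the second there is only a restoration in addition, and nothing is
executed after the last output of the second (`run_program2`). Without solutions the initial call
returns at once. -/

theorem Precedes.trans {α : Type} [DecidableEq α] {l : List α} {a b c : α}
    (h : Precedes l a b) (h' : Precedes l b c) : Precedes l a c :=
  ⟨h.1, h'.2.1, h.2.2.trans h'.2.2⟩

theorem Precedes.asymm {α : Type} [DecidableEq α] {l : List α} {a b : α}
    (h : Precedes l a b) (h' : Precedes l b a) : False :=
  lt_asymm h.2.2 h'.2.2

theorem Precedes.total {α : Type} [DecidableEq α] {l : List α} {a b : α}
    (ha : a ∈ l) (hb : b ∈ l) (h : a ≠ b) : Precedes l a b ∨ Precedes l b a := by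
  rcases lt_trichotomy (l.idxOf a) (l.idxOf b) with h' | h' | h'
  · exact .inl ⟨ha, hb, h'⟩
  · exact absurd ((List.idxOf_inj ha).1 h') h
  · exact .inr ⟨hb, ha, h'⟩

variable {P : Market m n} {D E M Vin Vout D' : Finset (Fin m × Fin n)} {u v x : Fin m × Fin n}

theorem mem_vertices : u ∈ P.vertices ↔ u.2 ∈ P.workerPref u.1 := by simp [Market.vertices]

theorem mem_vertices' : u ∈ P.vertices ↔ u.1 ∈ P.firmPref u.2 := by
  rw [mem_vertices, P.acceptable_iff]

theorem ArcW.trans (h : ArcW P u v) (h' : ArcW P v x) : ArcW P u x := by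
  obtain ⟨e, h⟩ := h
  obtain ⟨e', h'⟩ := h'
  rw [← e] at h'
  exact ⟨e.trans e', h'.trans h⟩

theorem ArcF.trans (h : ArcF P u v) (h' : ArcF P v x) : ArcF P u x := by
  obtain ⟨e, h⟩ := h
  obtain ⟨e', h'⟩ := h'
  rw [← e] at h'
  exact ⟨e.trans e', h'.trans h⟩

theorem ArcW.asymm (h : ArcW P u v) (h' : ArcW P v u) : False := by
  obtain ⟨e, h⟩ := h
  obtain ⟨-, h'⟩ := h'
  rw [← e] at h'
  exact h.asymm h'

theorem ArcF.asymm (h : ArcF P u v) (h' : ArcF P v u) : False := by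
  obtain ⟨e, h⟩ := h
  obtain ⟨-, h'⟩ := h'
  rw [← e] at h'
  exact h.asymm h'

theorem arcW_total (hu : u ∈ P.vertices) (hv : v ∈ P.vertices) (e : u.1 = v.1) (h : u ≠ v) :
    ArcW P u v ∨ ArcW P v u := by
  rw [mem_vertices] at hu hv
  have h2 : v.2 ≠ u.2 := fun e' => h (Prod.ext e e'.symm)
  rcases Precedes.total (e ▸ hv) hu h2 with h' | h'
  · exact .inl ⟨e, h'⟩
  · exact .inr ⟨e.symm, e ▸ h'⟩

theorem arcF_total (hu : u ∈ P.vertices) (hv : v ∈ P.vertices) (e : u.2 = v.2) (h : u ≠ v) :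
    ArcF P u v ∨ ArcF P v u := by
  rw [mem_vertices'] at hu hv
  have h2 : v.1 ≠ u.1 := fun e' => h (Prod.ext e'.symm e)
  rcases Precedes.total (e ▸ hv) hu h2 with h' | h'
  · exact .inl ⟨e, h'⟩
  · exact .inr ⟨e.symm, e ▸ h'⟩

theorem degW_eq_zero : degW P D v = 0 ↔ ∀ u ∈ D, ¬ ArcW P v u := by
  simp [degW, Finset.filter_eq_empty_iff]

theorem degF_eq_zero : degF P D v = 0 ↔ ∀ u ∈ D, ¬ ArcF P v u := by
  simp [degF, Finset.filter_eq_empty_iff]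

theorem mem_topW : v ∈ topW P D ↔ v ∈ D ∧ ∀ u ∈ D, ¬ ArcW P v u := by
  simp [topW, degW_eq_zero]

theorem mem_topF : v ∈ topF P D ↔ v ∈ D ∧ ∀ u ∈ D, ¬ ArcF P v u := by
  simp [topF, degF_eq_zero]

/-- A vertex of least rank on the list of its worker will do. Ranks from different rows get compared
as well, which is harmless because arcs stay within a row. -/
theorem exists_forall_not_arcW (h : D.Nonempty) : ∃ v ∈ D, ∀ u ∈ D, ¬ ArcW P v u := by
  obtain ⟨v, hv, h⟩ := D.exists_min_image (fun v => (P.workerPref v.1).idxOf v.2) h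
  refine ⟨v, hv, fun u hu a => ?_⟩
  have h' := h u hu
  have := a.2.2.2
  rw [← a.1] at h'
  omega

theorem exists_forall_not_arcF (h : D.Nonempty) : ∃ v ∈ D, ∀ u ∈ D, ¬ ArcF P v u := by
  obtain ⟨v, hv, h⟩ := D.exists_min_image (fun v => (P.firmPref v.2).idxOf v.1) h
  refine ⟨v, hv, fun u hu a => ?_⟩
  have h' := h u hu
  have := a.2.2.2
  rw [← a.1] at h'
  omega

theorem exists_mem_topW_row (h : x ∈ D) : ∃ v ∈ topW P D, v.1 = x.1 := by
  obtain ⟨v, hv, h⟩ := exists_forall_not_arcW (P := P) (D := D.filter fun v => v.1 = x.1) ⟨x, by simpa⟩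
  simp only [Finset.mem_filter] at hv h
  exact ⟨v, mem_topW.2 ⟨hv.1, fun u hu a => h u ⟨hu, a.1.symm.trans hv.2⟩ a⟩, hv.2⟩

theorem exists_mem_topF_col (h : x ∈ D) : ∃ v ∈ topF P D, v.2 = x.2 := by
  obtain ⟨v, hv, h⟩ := exists_forall_not_arcF (P := P) (D := D.filter fun v => v.2 = x.2) ⟨x, by simpa⟩
  simp only [Finset.mem_filter] at hv h
  exact ⟨v, mem_topF.2 ⟨hv.1, fun u hu a => h u ⟨hu, a.1.symm.trans hv.2⟩ a⟩, hv.2⟩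

theorem topW_row_injective (hD : D ⊆ P.vertices) (hu : u ∈ topW P D) (hv : v ∈ topW P D)
    (e : u.1 = v.1) : u = v := by
  rw [mem_topW] at hu hv
  by_contra h
  rcases arcW_total (hD hu.1) (hD hv.1) e h with a | a
  · exact hu.2 _ hv.1 a
  · exact hv.2 _ hu.1 a

theorem topF_col_injective (hD : D ⊆ P.vertices) (hu : u ∈ topF P D) (hv : v ∈ topF P D)
    (e : u.2 = v.2) : u = v := by
  rw [mem_topF] at hu hv
  by_contra h
  rcases arcF_total (hD hu.1) (hD hv.1) e h with a | a
  · exact hu.2 _ hv.1 a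
  · exact hv.2 _ hu.1 a

/-! ## Deletion does not depend on the order -/

/-- `u` is unattractive in `D`: a round of deletions on `D` removes `u` if it is present. -/
def Dominated (P : Market m n) (D : Finset (Fin m × Fin n)) (u : Fin m × Fin n) : Prop :=
  ∃ v ∈ D, (degF P D v = 0 ∧ ArcW P u v) ∨ (degW P D v = 0 ∧ ArcF P u v)

theorem mem_reduce : u ∈ reduce P D ↔ u ∈ D ∧ ¬ Dominated P D u := by
  simp only [reduce, Finset.mem_filter, Dominated]

theorem reduce_subset : reduce P D ⊆ D := Finset.filter_subset _ _

/-- Deleting unattractive vertices never rescues another one. Among the dominators of `u` of the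
same kind take the best, `y`. If `y` were deleted, its own dominator would either be a better
dominator of `u` or contradict that `y` is extreme on the other side. -/
theorem Dominated.of_subset (h : Dominated P D u) (hE : E ⊆ D)
    (hX : ∀ x ∈ D, x ∉ E → Dominated P D x) : Dominated P E u := by
  simp only [Dominated, degF_eq_zero, degW_eq_zero] at h hX ⊢
  obtain ⟨v, hv, ⟨hd, ha⟩ | ⟨hd, ha⟩⟩ := h
  · obtain ⟨y, hy, hmax⟩ := exists_forall_not_arcW (P := P)
      (D := D.filter fun v => (∀ x ∈ D, ¬ ArcF P v x) ∧ ArcW P u v)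
      ⟨v, by simp only [Finset.mem_filter]; exact ⟨hv, hd, ha⟩⟩
    simp only [Finset.mem_filter] at hy hmax
    refine ⟨y, ?_, .inl ⟨fun x hx => hy.2.1 x (hE hx), hy.2.2⟩⟩
    by_contra hyE
    obtain ⟨z, hz, ⟨h1, h2⟩ | ⟨h1, h2⟩⟩ := hX y hy.1 hyE
    · exact hmax z ⟨hz, h1, hy.2.2.trans h2⟩ h2
    · exact hy.2.1 z hz h2
  · obtain ⟨y, hy, hmax⟩ := exists_forall_not_arcF (P := P)
      (D := D.filter fun v => (∀ x ∈ D, ¬ ArcW P v x) ∧ ArcF P u v)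
      ⟨v, by simp only [Finset.mem_filter]; exact ⟨hv, hd, ha⟩⟩
    simp only [Finset.mem_filter] at hy hmax
    refine ⟨y, ?_, .inr ⟨fun x hx => hy.2.1 x (hE hx), hy.2.2⟩⟩
    by_contra hyE
    obtain ⟨z, hz, ⟨h1, h2⟩ | ⟨h1, h2⟩⟩ := hX y hy.1 hyE
    · exact hy.2.1 z hz h2
    · exact hmax z ⟨hz, h1, hy.2.2.trans h2⟩ h2

theorem idua_of_reduce_eq (h : reduce P D = D) : idua P D = D := by
  rw [idua, dif_pos h]

theorem idua_reduce : idua P (reduce P D) = idua P D := by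
  by_cases h : reduce P D = D
  · rw [h]
  · conv_rhs => rw [idua, dif_neg h]

/-- Confluence: any partial round leads to the same result as the full simultaneous round, because
the vertices that were skipped remain unattractive. -/
theorem idua_eq_of_dominated (hE : E ⊆ D) (hX : ∀ x ∈ D, x ∉ E → Dominated P D x) :
    idua P E = idua P D := by
  induction hk : D.card using Nat.strong_induction_on generalizing D E with
  | _ k ih =>
    by_cases hED : E = D
    · rw [hED]
    rw [← idua_reduce (D := D)]
    -- The roles shift: `E` becomes the larger set and `reduce P D`, which lies inside `E`, the
    -- smaller one.
    refine (ih E.card (hk ▸ Finset.card_lt_card (hE.ssubset_of_ne hED)) ?_ ?_ rfl).symm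
    · intro x hx
      rw [mem_reduce] at hx
      by_contra h
      exact hx.2 (hX x hx.1 h)
    · intro x hx hx'
      rw [mem_reduce] at hx'
      exact Dominated.of_subset (by_contra fun h => hx' ⟨hE hx, h⟩) hE hX

theorem idua_erase (h : Dominated P D u) : idua P (D.erase u) = idua P D := by
  refine idua_eq_of_dominated (Finset.erase_subset _ _) fun x hx hx' => ?_
  have : x = u := by simpa [hx] using hx'
  exact this ▸ h

theorem idua_induction {motive : Finset (Fin m × Fin n) → Prop} (h : motive D)
    (step : ∀ E, motive E → motive (reduce P E)) : motive (idua P D) := by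
  induction hk : D.card using Nat.strong_induction_on generalizing D with
  | _ k ih =>
    by_cases hr : reduce P D = D
    · rwa [idua_of_reduce_eq hr]
    · rw [← idua_reduce]
      exact ih _ (hk ▸ Finset.card_lt_card (reduce_subset.ssubset_of_ne hr)) (step D h) rfl

theorem idua_subset : idua P D ⊆ D :=
  idua_induction (motive := fun E => E ⊆ D) subset_rfl fun _ h => reduce_subset.trans h

/-- No round of deletions changes `D`. -/
def Reduced (P : Market m n) (D : Finset (Fin m × Fin n)) : Prop := ∀ u ∈ D, ¬ Dominated P D u

theorem Reduced.idua_eq (h : Reduced P D) : idua P D = D :=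
  idua_of_reduce_eq (subset_antisymm reduce_subset fun u hu => mem_reduce.2 ⟨hu, h u hu⟩)

theorem reduced_idua : Reduced P (idua P D) := by
  induction hk : D.card using Nat.strong_induction_on generalizing D with
  | _ k ih =>
    by_cases hr : reduce P D = D
    · rw [idua_of_reduce_eq hr]
      intro u hu
      rw [← hr, mem_reduce] at hu
      exact hu.2
    · rw [← idua_reduce]
      exact ih _ (hk ▸ Finset.card_lt_card (reduce_subset.ssubset_of_ne hr)) rfl

/-- The vertex that caused a deletion may disappear later, but then another dominator takes its
place; so the reason for each deletion can be read off the final digraph. -/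
theorem dominated_idua (hu : u ∈ D) (hu' : u ∉ idua P D) : Dominated P (idua P D) u := by
  have key := idua_induction (P := P) (D := D)
    (motive := fun E => ∀ u ∈ D, u ∉ E → Dominated P E u) (fun u h h' => absurd h h') ?_
  · exact key u hu hu'
  · intro E hE u hu hu'
    have : Dominated P E u := by
      by_cases h : u ∈ E
      · by_contra hd
        exact hu' (mem_reduce.2 ⟨h, hd⟩)
      · exact hE u hu h
    refine this.of_subset reduce_subset fun x hx hx' => ?_
    by_contra hd
    exact hx' (mem_reduce.2 ⟨hx, hd⟩)

/-- If `v` removed a pair `u` of `M`, then `v` would block `M`: one participant of `v` prefers it to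
`u`, and the other has no better option in `E`, where all of `M` still lies. -/
theorem IsStable.subset_idua (hM : IsStable P M) (h : M ⊆ D) : M ⊆ idua P D := by
  refine idua_induction (motive := fun E => M ⊆ E) h fun E hE u hu => ?_
  refine mem_reduce.2 ⟨hE hu, ?_⟩
  obtain ⟨⟨hV, hW, hF⟩, hb⟩ := hM
  simp only [Dominated, degF_eq_zero, degW_eq_zero]
  rintro ⟨v, hv, ⟨hd, ha⟩ | ⟨hd, ha⟩⟩
  · have hvV : v ∈ P.vertices := mem_vertices.2 (ha.1 ▸ ha.2.1)
    have hvM : v ∉ M := fun h' => by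
      have := hW u hu v h' ha.1
      subst this
      exact ha.asymm ha
    refine hb v.1 v.2 ⟨hvV, hvM, fun f' hf' => ?_, fun w' hw' => ?_⟩
    · have := hW _ hf' u hu ha.1.symm
      rw [← this] at ha
      exact ha.2
    · have hne : v ≠ (w', v.2) := fun h' => hvM (h' ▸ hw')
      rcases arcF_total hvV (hV hw') rfl hne with a | a
      · exact absurd a (hd _ (hE hw'))
      · exact a.2
  · have hvV : v ∈ P.vertices := mem_vertices'.2 (ha.1 ▸ ha.2.1)
    have hvM : v ∉ M := fun h' => by
      have := hF u hu v h' ha.1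
      subst this
      exact ha.asymm ha
    refine hb v.1 v.2 ⟨hvV, hvM, fun f' hf' => ?_, fun w' hw' => ?_⟩
    · have hne : v ≠ (v.1, f') := fun h' => hvM (h' ▸ hf')
      rcases arcW_total hvV (hV hf') rfl hne with a | a
      · exact absurd a (hd _ (hE hf'))
      · exact a.2
    · have := hF _ hw' u hu ha.1.symm
      rw [← this] at ha
      exact ha.2

/-! ## Digraphs on which nothing is unattractive -/

/-- A vertex of the column that the firm liked less than `v` would be dominated by `v`; so `v` is
the worst of its column. -/
theorem Reduced.arcF_of_topW (h : Reduced P D) (hD : D ⊆ P.vertices) (hv : v ∈ topW P D)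
    (hu : u ∈ D) (e : u.2 = v.2) (hne : u ≠ v) : ArcF P v u := by
  rw [mem_topW] at hv
  rcases arcF_total (hD hu) (hD hv.1) e hne with a | a
  · exact absurd ⟨v, hv.1, .inr ⟨degW_eq_zero.2 hv.2, a⟩⟩ (h u hu)
  · exact a

theorem Reduced.arcW_of_topF (h : Reduced P D) (hD : D ⊆ P.vertices) (hv : v ∈ topF P D)
    (hu : u ∈ D) (e : u.1 = v.1) (hne : u ≠ v) : ArcW P v u := by
  rw [mem_topF] at hv
  rcases arcW_total (hD hu) (hD hv.1) e hne with a | a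
  · exact absurd ⟨v, hv.1, .inl ⟨degF_eq_zero.2 hv.2, a⟩⟩ (h u hu)
  · exact a

theorem topW_subset : topW P D ⊆ D := Finset.filter_subset _ _

theorem topF_subset : topF P D ⊆ D := Finset.filter_subset _ _

theorem Reduced.topW_col_injective (h : Reduced P D) (hD : D ⊆ P.vertices)
    (hu : u ∈ topW P D) (hv : v ∈ topW P D) (e : u.2 = v.2) : u = v := by
  by_contra hne
  exact (h.arcF_of_topW hD hv (topW_subset hu) e hne).asymm
    (h.arcF_of_topW hD hu (topW_subset hv) e.symm (Ne.symm hne))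

theorem Reduced.topF_row_injective (h : Reduced P D) (hD : D ⊆ P.vertices)
    (hu : u ∈ topF P D) (hv : v ∈ topF P D) (e : u.1 = v.1) : u = v := by
  by_contra hne
  exact (h.arcW_of_topF hD hv (topF_subset hu) e hne).asymm
    (h.arcW_of_topF hD hu (topF_subset hv) e.symm (Ne.symm hne))

theorem Reduced.isMatching_topW (h : Reduced P D) (hD : D ⊆ P.vertices) :
    IsMatching P (topW P D) :=
  ⟨topW_subset.trans hD, fun _ hu _ hv => topW_row_injective hD hu hv,
    fun _ hu _ hv => h.topW_col_injective hD hu hv⟩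

theorem Reduced.isMatching_topF (h : Reduced P D) (hD : D ⊆ P.vertices) :
    IsMatching P (topF P D) :=
  ⟨topF_subset.trans hD, fun _ hu _ hv => h.topF_row_injective hD hu hv,
    fun _ hu _ hv => topF_col_injective hD hu hv⟩

theorem image_fst_topW : (topW P D).image Prod.fst = D.image Prod.fst := by
  refine subset_antisymm (Finset.image_subset_image topW_subset) fun w hw => ?_
  obtain ⟨x, hx, rfl⟩ := Finset.mem_image.1 hw
  obtain ⟨v, hv, e⟩ := exists_mem_topW_row (P := P) hx
  exact Finset.mem_image.2 ⟨v, hv, e⟩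

theorem image_snd_topF : (topF P D).image Prod.snd = D.image Prod.snd := by
  refine subset_antisymm (Finset.image_subset_image topF_subset) fun w hw => ?_
  obtain ⟨x, hx, rfl⟩ := Finset.mem_image.1 hw
  obtain ⟨v, hv, e⟩ := exists_mem_topF_col (P := P) hx
  exact Finset.mem_image.2 ⟨v, hv, e⟩

theorem card_topW (hD : D ⊆ P.vertices) : (topW P D).card = rows D := by
  rw [rows, ← image_fst_topW (P := P)]
  exact (Finset.card_image_of_injOn fun _ hu _ hv => topW_row_injective hD hu hv).symm

theorem card_topF (hD : D ⊆ P.vertices) : (topF P D).card = (D.image Prod.snd).card := by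
  rw [← image_snd_topF (P := P)]
  exact (Finset.card_image_of_injOn fun _ hu _ hv => topF_col_injective hD hu hv).symm

/-- `topW` has one vertex per non-empty row and injects into the non-empty columns; `topF` has one
per column and injects into the rows. So the two injections are bijections, and each set meets every
non-empty line. -/
theorem Reduced.card_topW_eq (h : Reduced P D) (hD : D ⊆ P.vertices) :
    (topW P D).card = (topF P D).card := by
  refine le_antisymm ?_ ?_
  · rw [card_topF hD, ← Finset.card_image_of_injOn (s := topW P D) (f := Prod.snd)
      fun _ hu _ hv => h.topW_col_injective hD hu hv]
    exact Finset.card_le_card (Finset.image_subset_image topW_subset)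
  · rw [card_topW hD, ← Finset.card_image_of_injOn (s := topF P D) (f := Prod.fst)
      fun _ hu _ hv => h.topF_row_injective hD hu hv]
    exact Finset.card_le_card (Finset.image_subset_image topF_subset)

theorem Reduced.image_snd_topW (h : Reduced P D) (hD : D ⊆ P.vertices) :
    (topW P D).image Prod.snd = D.image Prod.snd := by
  refine Finset.eq_of_subset_of_card_le (Finset.image_subset_image topW_subset) ?_
  rw [Finset.card_image_of_injOn fun _ hu _ hv => h.topW_col_injective hD hu hv,
    h.card_topW_eq hD, card_topF hD]

theorem Reduced.image_fst_topF (h : Reduced P D) (hD : D ⊆ P.vertices) :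
    (topF P D).image Prod.fst = D.image Prod.fst := by
  refine Finset.eq_of_subset_of_card_le (Finset.image_subset_image topF_subset) ?_
  rw [Finset.card_image_of_injOn fun _ hu _ hv => h.topF_row_injective hD hu hv,
    ← h.card_topW_eq hD, card_topW hD, rows]

theorem Reduced.exists_topF_row (h : Reduced P D) (hD : D ⊆ P.vertices) (hx : x ∈ D) :
    ∃ v ∈ topF P D, v.1 = x.1 := by
  have := Finset.mem_image_of_mem Prod.fst hx
  rw [← h.image_fst_topF hD] at this
  exact Finset.mem_image.1 this

theorem Reduced.topW_eq_topF (h : Reduced P D) (hD : D ⊆ P.vertices)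
    (hs : topW P D ⊆ topF P D) : topW P D = topF P D :=
  Finset.eq_of_subset_of_card_le hs (h.card_topW_eq hD).ge

/-- The best vertex of each row is also its worst, so it is alone there. -/
theorem Reduced.eq_topW (h : Reduced P D) (hD : D ⊆ P.vertices) (he : topW P D = topF P D) :
    D = topW P D := by
  refine subset_antisymm (fun x hx => ?_) topW_subset
  obtain ⟨v, hv, e⟩ := exists_mem_topW_row (P := P) hx
  by_cases hxv : x = v
  · exact hxv ▸ hv
  · exact absurd (h.arcW_of_topF hD (he ▸ hv) hx e.symm hxv) ((mem_topW.1 hv).2 x hx)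

/-- `M` meets every non-empty row: if a worker were unmatched, the vertex of `topF` in that row
would block, because its firm has nothing better inside `D`. -/
theorem IsStable.card_eq (hM : IsStable P M) (h : Reduced P D) (hD : D ⊆ P.vertices)
    (hMD : M ⊆ D) : M.card = (topW P D).card := by
  obtain ⟨⟨hV, hW, hF⟩, hb⟩ := hM
  rw [card_topW hD, rows, ← Finset.card_image_of_injOn (s := M) (f := Prod.fst)
      fun u hu v hv => hW u hu v hv]
  refine congrArg _ (subset_antisymm (Finset.image_subset_image hMD) fun w hw => ?_)
  obtain ⟨x, hx, rfl⟩ := Finset.mem_image.1 hw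
  obtain ⟨v, hv, e⟩ := h.exists_topF_row hD hx
  rw [← e]
  by_contra hn
  have hn' : ∀ f, (v.1, f) ∉ M := fun f hf => hn (Finset.mem_image.2 ⟨_, hf, rfl⟩)
  rw [mem_topF] at hv
  refine hb v.1 v.2 ⟨hD hv.1, hn' _, fun f hf => absurd hf (hn' f), fun w' hw' => ?_⟩
  have hne : v ≠ (w', v.2) := fun h' => hn' v.2 (h' ▸ hw')
  rcases arcF_total (hD hv.1) (hV hw') rfl hne with a | a
  · exact absurd a (hv.2 _ (hMD hw'))
  · exact a.2

/-! ## Removing extreme vertices -/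

/-- The digraph is closed under deletion, and every missing vertex is worse than the whole rest of
its column or than the whole rest of its row. -/
structure Sound (P : Market m n) (D : Finset (Fin m × Fin n)) : Prop where
  subset : D ⊆ P.vertices
  reduced : Reduced P D
  worse : ∀ u ∈ P.vertices, u ∉ D →
    (∀ v ∈ D, v.2 = u.2 → ArcF P u v) ∨ (∀ v ∈ D, v.1 = u.1 → ArcW P u v)

/-- The dominator is already the worst of the line it shares with `u`, so `u` is worse than the
whole line. That the line is non-empty is recorded because the comparison alone would hold vacuously
on an empty line. -/
theorem Reduced.worse (h : Reduced P D) (hD : D ⊆ P.vertices) (hu : Dominated P D u) :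
    ((∃ v ∈ D, v.2 = u.2) ∧ ∀ v ∈ D, v.2 = u.2 → ArcF P u v) ∨
      ((∃ v ∈ D, v.1 = u.1) ∧ ∀ v ∈ D, v.1 = u.1 → ArcW P u v) := by
  obtain ⟨v, hv, ⟨hd, ha⟩ | ⟨hd, ha⟩⟩ := hu
  · refine .inr ⟨⟨v, hv, ha.1.symm⟩, fun x hx e => ?_⟩
    by_cases hxv : x = v
    · exact hxv ▸ ha
    · exact ha.trans (h.arcW_of_topF hD (Finset.mem_filter.2 ⟨hv, hd⟩) hx (e.trans ha.1) hxv)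
  · refine .inl ⟨⟨v, hv, ha.1.symm⟩, fun x hx e => ?_⟩
    by_cases hxv : x = v
    · exact hxv ▸ ha
    · exact ha.trans (h.arcF_of_topW hD (Finset.mem_filter.2 ⟨hv, hd⟩) hx (e.trans ha.1) hxv)

theorem sound_idua_vertices : Sound P (idua P P.vertices) where
  subset := idua_subset
  reduced := reduced_idua
  worse u hu hu' := by
    rcases reduced_idua.worse idua_subset (dominated_idua hu hu') with h | h
    · exact .inl h.2
    · exact .inr h.2

/-- A vertex extreme for one side is the worst of its line on the other side, so even an arbitrary
removal of such a vertex leaves only better ones in that line. -/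
theorem Sound.idua_erase (h : Sound P D) (hv : v ∈ D) (hd : degW P D v = 0 ∨ degF P D v = 0) :
    Sound P (idua P (D.erase v)) := by
  have hsub : idua P (D.erase v) ⊆ D := idua_subset.trans (Finset.erase_subset _ _)
  refine ⟨hsub.trans h.subset, reduced_idua, fun u hu hu' => ?_⟩
  by_cases huD : u ∈ D
  · by_cases huv : u = v
    · subst huv
      rcases hd with hd | hd
      · left
        intro x hx e
        exact h.reduced.arcF_of_topW h.subset (Finset.mem_filter.2 ⟨hv, hd⟩) (hsub hx) e
          (fun e' => hu' (e' ▸ hx))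
      · right
        intro x hx e
        exact h.reduced.arcW_of_topF h.subset (Finset.mem_filter.2 ⟨hv, hd⟩) (hsub hx) e
          (fun e' => hu' (e' ▸ hx))
    · rcases reduced_idua.worse (hsub.trans h.subset)
        (dominated_idua (Finset.mem_erase.2 ⟨huv, huD⟩) hu') with h | h
      · exact .inl h.2
      · exact .inr h.2
  · rcases h.worse u hu huD with h | h
    · exact .inl fun x hx => h x (hsub hx)
    · exact .inr fun x hx => h x (hsub hx)

/-- A missing pair is worse than the rest of some line. If that line is still non-empty, `M` matches
its participant within the line, to somebody better. The count of rows guarantees that no line has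
become empty since the initial IDUA. -/
theorem Sound.not_blocks (h : Sound P D) (hD : D ⊆ idua P P.vertices)
    (hr : rows (idua P P.vertices) ≤ (topW P D).card) (hM : M ⊆ D)
    (hW : M.image Prod.fst = D.image Prod.fst) (hF : M.image Prod.snd = D.image Prod.snd)
    (hu : u ∉ D) : ¬ Blocks P M u.1 u.2 := by
  rintro ⟨huV, -, b1, b2⟩
  have hrow : D.image Prod.fst = (idua P P.vertices).image Prod.fst := by
    refine Finset.eq_of_subset_of_card_le (Finset.image_subset_image hD) ?_
    rw [card_topW h.subset] at hr
    exact hr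
  have hcol : D.image Prod.snd = (idua P P.vertices).image Prod.snd := by
    refine Finset.eq_of_subset_of_card_le (Finset.image_subset_image hD) ?_
    rw [← card_topF h.subset, ← h.reduced.card_topW_eq h.subset, ← card_topF idua_subset,
      ← reduced_idua.card_topW_eq idua_subset, card_topW idua_subset]
    exact hr
  -- For `u` deleted by the initial IDUA, `Sound` might only offer a line that was empty from the
  -- start; the dominator of `u` provides a non-empty one.
  have key : ((∃ v ∈ idua P P.vertices, v.2 = u.2) ∧ ∀ v ∈ D, v.2 = u.2 → ArcF P u v) ∨
      ((∃ v ∈ idua P P.vertices, v.1 = u.1) ∧ ∀ v ∈ D, v.1 = u.1 → ArcW P u v) := by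
    by_cases hu0 : u ∈ idua P P.vertices
    · rcases h.worse u huV hu with h | h
      · exact .inl ⟨⟨u, hu0, rfl⟩, h⟩
      · exact .inr ⟨⟨u, hu0, rfl⟩, h⟩
    · rcases reduced_idua.worse idua_subset (dominated_idua huV hu0) with h | h
      · exact .inl ⟨h.1, fun v hv => h.2 v (hD hv)⟩
      · exact .inr ⟨h.1, fun v hv => h.2 v (hD hv)⟩
  rcases key with ⟨⟨v, hv, e⟩, hall⟩ | ⟨⟨v, hv, e⟩, hall⟩
  · have := Finset.mem_image_of_mem Prod.snd hv
    rw [← hcol, ← hF] at this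
    obtain ⟨y, hy, e'⟩ := Finset.mem_image.1 this
    have hyu : y.2 = u.2 := e'.trans e
    refine (hall y (hM hy) hyu).asymm ⟨hyu, ?_⟩
    rw [hyu]
    exact b2 y.1 (by rw [← hyu]; exact hy)
  · have := Finset.mem_image_of_mem Prod.fst hv
    rw [← hrow, ← hW] at this
    obtain ⟨y, hy, e'⟩ := Finset.mem_image.1 this
    have hyu : y.1 = u.1 := e'.trans e
    refine (hall y (hM hy) hyu).asymm ⟨hyu, ?_⟩
    rw [hyu]
    exact b1 y.2 (by rw [← hyu]; exact hy)

theorem Sound.isStable_topW (h : Sound P D) (hD : D ⊆ idua P P.vertices)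
    (hr : rows (idua P P.vertices) ≤ (topW P D).card) : IsStable P (topW P D) := by
  refine ⟨h.reduced.isMatching_topW h.subset, fun w f hb => ?_⟩
  by_cases hu : (w, f) ∈ D
  · obtain ⟨v, hv, e⟩ := exists_mem_topW_row (P := P) hu
    have e : v.1 = w := e
    refine (mem_topW.1 hv).2 _ hu ⟨e, ?_⟩
    rw [e]
    exact hb.2.2.1 v.2 (e ▸ hv)
  · exact h.not_blocks hD hr topW_subset image_fst_topW (h.reduced.image_snd_topW h.subset) hu hb

theorem Sound.isStable_topF (h : Sound P D) (hD : D ⊆ idua P P.vertices)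
    (hr : rows (idua P P.vertices) ≤ (topW P D).card) : IsStable P (topF P D) := by
  refine ⟨h.reduced.isMatching_topF h.subset, fun w f hb => ?_⟩
  by_cases hu : (w, f) ∈ D
  · obtain ⟨v, hv, e⟩ := exists_mem_topF_col (P := P) hu
    have e : v.2 = f := e
    refine (mem_topF.1 hv).2 _ hu ⟨e, ?_⟩
    rw [e]
    exact hb.2.2.2 v.1 (e ▸ hv)
  · exact h.not_blocks hD hr topF_subset (h.reduced.image_fst_topF h.subset) image_snd_topF hu hb

/-! ### Invariants and termination of the removal loop. -/

theorem Purge.sound (h : Purge P Vout D D') (hD : Sound P D) : Sound P D' := by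
  induction h with
  | done D h => exact hD
  | again D D' v h _ ih => exact ih (hD.idua_erase h.1 h.2.2)

theorem Purge.subset (h : Purge P Vout D D') : D' ⊆ D := by
  induction h with
  | done D h => exact subset_rfl
  | again D D' v h _ ih => exact ih.trans (idua_subset.trans (Finset.erase_subset _ _))

theorem Purge.not_removable (h : Purge P Vout D D') : ∀ v, ¬ Removable P Vout D' v := by
  induction h with
  | done D h => exact h
  | again D D' v h _ ih => exact ih

theorem Purge.subset_of_isStable (h : Purge P Vout D D') (hM : IsStable P M) (hMD : M ⊆ D)
    (hd : Disjoint Vout M) : M ⊆ D' := by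
  induction h with
  | done D h => exact hMD
  | again D D' v h _ ih =>
    refine ih (hM.subset_idua fun u hu => Finset.mem_erase.2 ⟨?_, hMD hu⟩)
    rintro rfl
    exact Finset.disjoint_left.1 hd h.2.1 hu

theorem exists_purge (P : Market m n) (Vout D : Finset (Fin m × Fin n)) :
    ∃ D', Purge P Vout D D' := by
  induction hk : D.card using Nat.strong_induction_on generalizing D with
  | _ k ih =>
    by_cases h : ∃ v, Removable P Vout D v
    · obtain ⟨v, hv⟩ := h
      have hlt : (idua P (D.erase v)).card < k :=
        (Finset.card_le_card idua_subset).trans_lt (hk ▸ Finset.card_erase_lt_of_mem hv.1)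
      obtain ⟨D', h'⟩ := ih _ hlt _ rfl
      exact ⟨D', .again D D' v hv h'⟩
    · exact ⟨D, .done D (not_exists.1 h)⟩

/-! ## Correctness of the enumeration -/

/-- Step 2.1 forbids only pairs that share a participant with a prescribed pair, and no matching
through `Vin` uses these. -/
theorem IsMatching.disjoint_forbid (hM : IsMatching P M) (hin : Vin ⊆ M) :
    Disjoint (forbid Vin Vout) M ↔ Disjoint Vout M := by
  rw [forbid, Finset.disjoint_union_left, and_iff_left]
  rw [Finset.disjoint_left]
  intro u hu huM
  simp only [Finset.mem_filter, Finset.mem_univ, true_and] at hu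
  obtain ⟨v, hv, hne, e | e⟩ := hu
  · exact hne (hM.2.1 u huM v (hin hv) e)
  · exact hne (hM.2.2 u huM v (hin hv) e)

theorem disjoint_topW (h : ∀ v, ¬ Removable P Vout D v) : Disjoint Vout (topW P D) := by
  rw [Finset.disjoint_left]
  intro u hu hu'
  exact h u ⟨topW_subset hu', hu, .inl (Finset.mem_filter.1 hu').2⟩

theorem disjoint_topF (h : ∀ v, ¬ Removable P Vout D v) : Disjoint Vout (topF P D) := by
  rw [Finset.disjoint_left]
  intro u hu hu'
  exact h u ⟨topF_subset hu', hu, .inr (Finset.mem_filter.1 hu').2⟩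

/-- If the best vertex of the row of some `u ∈ Vin` were not `u`, it would be forbidden by `u` and
extreme, hence removable. -/
theorem subset_topW (h : ∀ v, ¬ Removable P (forbid Vin Vout) D v) (hin : Vin ⊆ D) :
    Vin ⊆ topW P D := by
  intro u hu
  obtain ⟨v, hv, e⟩ := exists_mem_topW_row (P := P) (hin hu)
  by_cases huv : v = u
  · exact huv ▸ hv
  · refine absurd hv (Finset.disjoint_left.1 (disjoint_topW h) ?_)
    exact Finset.mem_union_right _ (by simpa using ⟨u.1, u.2, hu, huv, .inl e⟩)

theorem subset_topF (h : ∀ v, ¬ Removable P (forbid Vin Vout) D v) (hin : Vin ⊆ D) :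
    Vin ⊆ topF P D := by
  intro u hu
  obtain ⟨v, hv, e⟩ := exists_mem_topF_col (P := P) (hin hu)
  by_cases huv : v = u
  · exact huv ▸ hv
  · refine absurd hv (Finset.disjoint_left.1 (disjoint_topF h) ?_)
    exact Finset.mem_union_right _ (by simpa using ⟨u.1, u.2, hu, huv, .inr e⟩)

/-- `M` is a stable matching in `D` that contains `Vin` and avoids `Vout`. -/
def Solves (P : Market m n) (D Vin Vout M : Finset (Fin m × Fin n)) : Prop :=
  IsStable P M ∧ M ⊆ D ∧ Vin ⊆ M ∧ Disjoint Vout M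

theorem Reaches5.solves_topW {r : ℕ} (h : Reaches5 P r D Vin Vout D') (hD : Sound P D)
    (h0 : D ⊆ idua P P.vertices) (hr : r = rows (idua P P.vertices)) :
    Solves P D' Vin (forbid Vin Vout) (topW P D') := by
  obtain ⟨-, hp, hc, hin⟩ := h
  exact ⟨(hp.sound hD).isStable_topW (hp.subset.trans h0) (hr ▸ hc), topW_subset,
    subset_topW hp.not_removable hin, disjoint_topW hp.not_removable⟩

theorem Reaches5.solves_topF {r : ℕ} (h : Reaches5 P r D Vin Vout D') (hD : Sound P D)
    (h0 : D ⊆ idua P P.vertices) (hr : r = rows (idua P P.vertices)) :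
    Solves P D' Vin (forbid Vin Vout) (topF P D') := by
  obtain ⟨-, hp, hc, hin⟩ := h
  exact ⟨(hp.sound hD).isStable_topF (hp.subset.trans h0) (hr ▸ hc), topF_subset,
    subset_topF hp.not_removable hin, disjoint_topF hp.not_removable⟩

theorem Purge.solves_iff (h : Purge P (forbid Vin Vout) D D') :
    Solves P D Vin Vout M ↔ Solves P D' Vin (forbid Vin Vout) M := by
  constructor
  · rintro ⟨hM, hMD, hin, hd⟩
    have hd' := (hM.1.disjoint_forbid hin).2 hd
    exact ⟨hM, h.subset_of_isStable hM hMD hd', hin, hd'⟩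
  · rintro ⟨hM, hMD, hin, hd⟩
    exact ⟨hM, hMD.trans h.subset, hin, (hM.1.disjoint_forbid hin).1 hd⟩

/-- Feasible calls pass Step 2.4: a solution is a stable matching both in the current and in the
initial reduced digraph, so its size counts the non-empty rows of each. -/
theorem Purge.reaches5 {r : ℕ} (h : Purge P (forbid Vin Vout) D D') (hD : Sound P D)
    (hr : r = rows (idua P P.vertices)) (hM : Solves P D Vin Vout M) :
    r ≤ (topW P D').card ∧ Vin ⊆ D' := by
  obtain ⟨hM, hMD, hin, -⟩ := h.solves_iff.1 hM
  refine ⟨?_, hin.trans hMD⟩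
  rw [← hM.card_eq (h.sound hD).reduced (h.sound hD).subset hMD, hr,
    hM.card_eq reduced_idua idua_subset (hM.subset_idua hM.1.1), card_topW idua_subset]

/-- Each return without output certifies infeasibility, and a branching divides the solutions
according to whether they contain the pivot; this also excludes repetitions. -/
theorem Algorithm2.spec {r : ℕ} {L : List (Finset (Fin m × Fin n))}
    (h : Algorithm2 P r D Vin Vout L) (hD : Sound P D) (h0 : D ⊆ idua P P.vertices)
    (hr : r = rows (idua P P.vertices)) :
    L.Nodup ∧ ∀ M, M ∈ L ↔ Solves P D Vin Vout M := by
  induction h with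
  | return1 D Vin Vout h =>
    simp only [List.nodup_nil, List.not_mem_nil, false_iff, true_and]
    exact fun M hM => h (hM.2.2.1.trans hM.2.1)
  | return4 D Vin Vout D' h₁ h₂ h₄ =>
    simp only [List.nodup_nil, List.not_mem_nil, false_iff, true_and]
    intro M hM
    have := h₂.reaches5 hD hr hM
    rcases h₄ with h | h
    · omega
    · exact h this.2
  | return5 D Vin Vout D' h h₅ =>
    refine ⟨List.nodup_singleton _, fun M => ?_⟩
    rw [h.2.1.solves_iff, List.mem_singleton]
    constructor
    · rintro rfl
      exact h.solves_topW hD h0 hr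
    · rintro ⟨hM, hMD, -⟩
      have hS := h.2.1.sound hD
      -- Here the digraph equals `topW`, so a solution is a subset of it, and of equal size.
      refine Finset.eq_of_subset_of_card_le ?_ (hM.card_eq hS.reduced hS.subset hMD).ge
      rw [← hS.reduced.eq_topW hS.subset h₅]
      exact hMD
  | branch6 D Vin Vout D' v La Lb h h₆ _ _ iha ihb =>
    have hS := h.2.1.sound hD
    have h0' := h.2.1.subset.trans h0
    obtain ⟨na, ma⟩ := iha hS h0'
    obtain ⟨nb, mb⟩ := ihb hS h0'
    constructor
    · rw [List.nodup_append]
      refine ⟨na, nb, ?_⟩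
      rintro M ha _ hb rfl
      exact Finset.disjoint_left.1 ((mb M).1 hb).2.2.2 (Finset.mem_insert_self _ _)
        (((ma M).1 ha).2.2.1 (Finset.mem_insert_self _ _))
    · intro M
      rw [List.mem_append, ma, mb, h.2.1.solves_iff]
      simp only [Solves, Finset.insert_subset_iff, Finset.disjoint_insert_left]
      tauto

/-! ### Termination and existence of a run. -/

theorem Reaches5.pivot_notMem {r : ℕ} (h : Reaches5 P r D Vin Vout D')
    (hv : v ∈ topW P D' \ topF P D') : v ∉ Vin ∧ v ∉ forbid Vin Vout := by
  rw [Finset.mem_sdiff] at hv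
  exact ⟨fun h' => hv.2 (subset_topF h.2.1.not_removable h.2.2.2 h'),
    fun h' => Finset.disjoint_left.1 (disjoint_topW h.2.1.not_removable) h' hv.1⟩

theorem card_lt_left {Vo : Finset (Fin m × Fin n)} (hv : v ∉ Vin) (h : Vout ⊆ Vo) :
    (insert v Vin)ᶜ.card + Voᶜ.card < Vinᶜ.card + Voutᶜ.card := by
  have h1 : (insert v Vin)ᶜ.card < Vinᶜ.card :=
    Finset.card_lt_card (compl_lt_compl_iff_lt.2 (Finset.ssubset_insert hv))
  have h2 : Voᶜ.card ≤ Voutᶜ.card := Finset.card_le_card (compl_le_compl_iff_le.2 h)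
  omega

theorem card_lt_right {Vo : Finset (Fin m × Fin n)} (hv : v ∉ Vo) (h : Vout ⊆ Vo) :
    Vinᶜ.card + (insert v Vo)ᶜ.card < Vinᶜ.card + Voutᶜ.card := by
  have h1 : (insert v Vo)ᶜ.card < Voᶜ.card :=
    Finset.card_lt_card (compl_lt_compl_iff_lt.2 (Finset.ssubset_insert hv))
  have h2 : Voᶜ.card ≤ Voutᶜ.card := Finset.card_le_card (compl_le_compl_iff_le.2 h)
  omega

theorem subset_forbid : Vout ⊆ forbid Vin Vout := Finset.subset_union_left

/-- The pivot is neither in `Vin` nor in the enlarged `Vout`, so each branch makes one of the two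
sets strictly larger and neither smaller. -/
theorem algorithm2Halts (P : Market m n) (r : ℕ) (D Vin Vout : Finset (Fin m × Fin n)) :
    Algorithm2Halts P r D Vin Vout := by
  induction hk : Vinᶜ.card + Voutᶜ.card using Nat.strong_induction_on
    generalizing D Vin Vout with
  | _ k ih =>
    subst hk
    exact .intro _ _ _
      (fun D' v h hv => ih _ (card_lt_left (h.pivot_notMem hv).1 subset_forbid) _ _ _ rfl)
      (fun D' v h hv => ih _ (card_lt_right (h.pivot_notMem hv).2 subset_forbid) _ _ _ rfl)

/-- Soundness is needed so that the algorithm cannot get stuck: if no pivot exists then `topW` is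
contained in `topF`, and equality follows from their equal sizes. -/
theorem Algorithm2Halts.exists_algorithm2 {r : ℕ} (h : Algorithm2Halts P r D Vin Vout)
    (hD : Sound P D) : ∃ L, Algorithm2 P r D Vin Vout L := by
  induction h with
  | intro D Vin Vout _ _ iha ihb =>
    by_cases h1 : Vin ⊆ D
    · obtain ⟨D', hp⟩ := exists_purge P (forbid Vin Vout) D
      by_cases h4 : (topW P D').card < r ∨ ¬ Vin ⊆ D'
      · exact ⟨_, .return4 _ _ _ _ h1 hp h4⟩
      · rw [not_or, not_lt, not_not] at h4
        have h5 : Reaches5 P r D Vin Vout D' := ⟨h1, hp, h4⟩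
        have hS := hp.sound hD
        by_cases he : topW P D' ⊆ topF P D'
        · exact ⟨_, .return5 _ _ _ _ h5 (hS.reduced.topW_eq_topF hS.subset he)⟩
        · obtain ⟨v, hv, hv'⟩ := Finset.not_subset.1 he
          have h6 := Finset.mem_sdiff.2 ⟨hv, hv'⟩
          obtain ⟨La, ha⟩ := iha D' v h5 h6 hS
          obtain ⟨Lb, hb⟩ := ihb D' v h5 h6 hS
          exact ⟨_, .branch6 _ _ _ _ _ _ _ h5 h6 ha hb⟩
    · exact ⟨_, .return1 _ _ _ h1⟩

theorem Algorithm1.spec {L : List (Finset (Fin m × Fin n))} (h : Algorithm1 P Vin Vout L) :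
    L.Nodup ∧ ∀ M, M ∈ L ↔ IsStable P M ∧ Vin ⊆ M ∧ Disjoint Vout M := by
  obtain ⟨h1, h2⟩ := Algorithm2.spec h sound_idua_vertices subset_rfl rfl
  refine ⟨h1, fun M => (h2 M).trans ⟨fun h => ⟨h.1, h.2.2⟩, fun h => ⟨h.1, ?_, h.2⟩⟩⟩
  exact h.1.subset_idua h.1.1.1

end

section
/-! ## Big-step semantics of commands without calls and output -/

/-- `Big c s s' t`: the command `c`, which neither calls nor prints, leads from `s` to `s'` in
time `t`. -/
inductive Big : Cmd → Store → Store → ℕ → Prop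
  | skip (s : Store) : Big .skip s s 1
  | set (x : Reg) (e : Exp) (s : Store) : Big (.set x e) s (s.setReg x (e.eval s)) (1 + e.cost)
  | put (a : Arr) (d e : Exp) (s : Store) :
      Big (.put a d e) s (s.setArr a (d.eval s) (e.eval s)) (1 + d.cost + e.cost)
  | seq {c d : Cmd} {s s' s'' : Store} {t t' : ℕ} (h : Big c s s' t) (h' : Big d s' s'' t') :
      Big (.seq c d) s s'' (1 + t + t')
  | ite_false {e : Exp} {c d : Cmd} {s s' : Store} {t : ℕ} (he : e.eval s = 0)
      (h : Big d s s' t) : Big (.ite e c d) s s' (1 + e.cost + t)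
  | ite_true {e : Exp} {c d : Cmd} {s s' : Store} {t : ℕ} (he : e.eval s ≠ 0)
      (h : Big c s s' t) : Big (.ite e c d) s s' (1 + e.cost + t)
  | loop_false {e : Exp} {c : Cmd} {s : Store} (he : e.eval s = 0) :
      Big (.loop e c) s s (1 + e.cost)
  | loop_true {e : Exp} {c : Cmd} {s s' s'' : Store} {t u : ℕ} (he : e.eval s ≠ 0)
      (h : Big c s s' t) (h' : Big (.loop e c) s' s'' u) :
      Big (.loop e c) s s'' (1 + e.cost + t + u)

/-- The machine gets from one configuration to another. -/
def Run (body : Cmd) (c d : Config) : Prop := ∃ k : ℕ, (step body)^[k] c = d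

theorem Run.trans {body : Cmd} {c d e : Config} (h : Run body c d) (h' : Run body d e) :
    Run body c e := by
  obtain ⟨k, rfl⟩ := h
  obtain ⟨l, rfl⟩ := h'
  exact ⟨l + k, Function.iterate_add_apply _ _ _ _⟩

theorem Run.single {body : Cmd} {c d : Config} (h : step body c = d) : Run body c d := ⟨1, h⟩

/-- The continuation `K`, the clock and the tape are arbitrary, so that verified fragments can be
embedded into the run of the recursive procedure. -/
theorem Big.run {c : Cmd} {s s' : Store} {t : ℕ} (h : Big c s s' t) (body : Cmd)
    (K : List Cmd) (t₀ : ℕ) (o : List (ℕ × List ℕ)) :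
    Run body ⟨c :: K, s, t₀, o⟩ ⟨K, s', t₀ + t, o⟩ := by
  induction h generalizing K t₀ with
  | skip s => exact .single rfl
  | set x e s => exact .single rfl
  | put a d e s => exact .single rfl
  | seq _ _ ih ih' =>
    refine (Run.single rfl).trans ((ih _ _).trans ?_)
    convert ih' K _ using 2
    omega
  | ite_false he _ ih =>
    refine (Run.single rfl).trans ?_
    simp only [step, if_pos he]
    convert ih K _ using 2
    omega
  | ite_true he _ ih =>
    refine (Run.single rfl).trans ?_
    simp only [step, if_neg he]
    convert ih K _ using 2
    omega
  | loop_false he =>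
    refine .single ?_
    simp only [step, if_pos he]
  | loop_true he _ _ ih ih' =>
    refine (Run.single rfl).trans ?_
    simp only [step, if_neg he]
    refine (ih _ _).trans ?_
    convert ih' K _ using 2
    omega

/-! ## What a command leaves unchanged -/

/-- The command may write the register. -/
def Cmd.writesReg : Cmd → Reg → Bool
  | .set y _, x => decide (y = x)
  | .seq c d, x => c.writesReg x || d.writesReg x
  | .ite _ c d, x => c.writesReg x || d.writesReg x
  | .loop _ c, x => c.writesReg x
  | _, _ => false

/-- The command may write the array. -/
def Cmd.writesArr : Cmd → Arr → Bool
  | .put b _ _, a => decide (b = a)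
  | .seq c d, a => c.writesArr a || d.writesArr a
  | .ite _ c d, a => c.writesArr a || d.writesArr a
  | .loop _ c, a => c.writesArr a
  | _, _ => false

/-- `s'` agrees with `s` on everything that `c` does not write. -/
structure Frame (c : Cmd) (s s' : Store) : Prop where
  reg : ∀ x, c.writesReg x = false → s'.reg x = s.reg x
  arr : ∀ a, c.writesArr a = false → s'.arr a = s.arr a

theorem Frame.refl (c : Cmd) (s : Store) : Frame c s s := ⟨fun _ _ => rfl, fun _ _ => rfl⟩

theorem Frame.trans {c : Cmd} {s s' s'' : Store} (h : Frame c s s') (h' : Frame c s' s'') :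
    Frame c s s'' :=
  ⟨fun x hx => (h'.reg x hx).trans (h.reg x hx), fun a ha => (h'.arr a ha).trans (h.arr a ha)⟩

theorem Frame.mono {c d : Cmd} {s s' : Store} (h : Frame c s s')
    (hr : ∀ x, d.writesReg x = false → c.writesReg x = false)
    (ha : ∀ a, d.writesArr a = false → c.writesArr a = false) : Frame d s s' :=
  ⟨fun x hx => h.reg x (hr x hx), fun a h' => h.arr a (ha a h')⟩

/-- `print` and `call` count as writing nothing, which is harmless because `Big` has no rule for
them. -/
theorem Big.frame {c : Cmd} {s s' : Store} {t : ℕ} (h : Big c s s' t) : Frame c s s' := by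
  induction h with
  | skip s => exact .refl _ _
  | set x e s =>
    refine ⟨fun y hy => ?_, fun _ _ => rfl⟩
    simp only [Cmd.writesReg, decide_eq_false_iff_not] at hy
    simp [Store.setReg, Function.update_of_ne (Ne.symm hy)]
  | put a d e s =>
    refine ⟨fun _ _ => rfl, fun b hb => ?_⟩
    simp only [Cmd.writesArr, decide_eq_false_iff_not] at hb
    simp [Store.setArr, Function.update_of_ne (Ne.symm hb)]
  | seq _ _ ih ih' =>
    refine (ih.mono ?_ ?_).trans (ih'.mono ?_ ?_) <;>
      simp only [Cmd.writesReg, Cmd.writesArr, Bool.or_eq_false_iff] <;> tauto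
  | ite_false _ _ ih =>
    refine ih.mono ?_ ?_ <;>
      simp only [Cmd.writesReg, Cmd.writesArr, Bool.or_eq_false_iff] <;> tauto
  | ite_true _ _ ih =>
    refine ih.mono ?_ ?_ <;>
      simp only [Cmd.writesReg, Cmd.writesArr, Bool.or_eq_false_iff] <;> tauto
  | loop_false => exact .refl _ _
  | loop_true _ _ _ ih ih' => exact Frame.trans ⟨ih.reg, ih.arr⟩ ih'

/-! ## Weakest preconditions -/

/-- Started on `s`, the command `c` ends, and the final memory and the elapsed time satisfy `Q`. -/
def WP (c : Cmd) (s : Store) (Q : Store → ℕ → Prop) : Prop := ∃ s' t, Big c s s' t ∧ Q s' t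

theorem WP.mono {c : Cmd} {s : Store} {Q R : Store → ℕ → Prop} (h : WP c s Q)
    (hQ : ∀ s' t, Q s' t → R s' t) : WP c s R := by
  obtain ⟨s', t, hb, hq⟩ := h
  exact ⟨s', t, hb, hQ _ _ hq⟩

theorem WP.frame {c : Cmd} {s : Store} {Q : Store → ℕ → Prop} (h : WP c s Q) :
    WP c s fun s' t => Frame c s s' ∧ Q s' t := by
  obtain ⟨s', t, hb, hq⟩ := h
  exact ⟨s', t, hb, hb.frame, hq⟩

/-- The rules for loop-free code are equivalences so that simplification can execute such code
symbolically, including its cost. -/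
theorem wp_skip {s : Store} {Q : Store → ℕ → Prop} : WP .skip s Q ↔ Q s 1 := by
  refine ⟨?_, fun h => ⟨_, _, .skip s, h⟩⟩
  rintro ⟨_, _, ⟨⟩, h⟩
  exact h

theorem wp_set {x : Reg} {e : Exp} {s : Store} {Q : Store → ℕ → Prop} :
    WP (.set x e) s Q ↔ Q (s.setReg x (e.eval s)) (1 + e.cost) := by
  refine ⟨?_, fun h => ⟨_, _, .set x e s, h⟩⟩
  rintro ⟨_, _, ⟨⟩, h⟩
  exact h

theorem wp_put {a : Arr} {d e : Exp} {s : Store} {Q : Store → ℕ → Prop} :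
    WP (.put a d e) s Q ↔ Q (s.setArr a (d.eval s) (e.eval s)) (1 + d.cost + e.cost) := by
  refine ⟨?_, fun h => ⟨_, _, .put a d e s, h⟩⟩
  rintro ⟨_, _, ⟨⟩, h⟩
  exact h

theorem wp_seq {c d : Cmd} {s : Store} {Q : Store → ℕ → Prop} :
    WP (.seq c d) s Q ↔ WP c s fun s' t => WP d s' fun s'' t' => Q s'' (1 + t + t') := by
  constructor
  · rintro ⟨_, _, h, hq⟩
    cases h with
    | seq h h' => exact ⟨_, _, h, _, _, h', hq⟩
  · rintro ⟨_, _, h, _, _, h', hq⟩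
    exact ⟨_, _, .seq h h', hq⟩

theorem wp_ite {e : Exp} {c d : Cmd} {s : Store} {Q : Store → ℕ → Prop} :
    WP (.ite e c d) s Q ↔
      if e.eval s = 0 then WP d s fun s' t => Q s' (1 + e.cost + t)
      else WP c s fun s' t => Q s' (1 + e.cost + t) := by
  split_ifs with he
  · constructor
    · rintro ⟨_, _, h, hq⟩
      cases h with
      | ite_false _ h => exact ⟨_, _, h, hq⟩
      | ite_true h' => exact absurd he h'
    · rintro ⟨_, _, h, hq⟩
      exact ⟨_, _, .ite_false he h, hq⟩
  · constructor
    · rintro ⟨_, _, h, hq⟩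
      cases h with
      | ite_false h' => exact absurd h' he
      | ite_true _ h => exact ⟨_, _, h, hq⟩
    · rintro ⟨_, _, h, hq⟩
      exact ⟨_, _, .ite_true he h, hq⟩

theorem wp_when {e : Exp} {c : Cmd} {s : Store} {Q : Store → ℕ → Prop} :
    WP (when e c) s Q ↔
      if e.eval s = 0 then Q s (2 + e.cost) else WP c s fun s' t => Q s' (1 + e.cost + t) := by
  rw [when, wp_ite]
  simp only [wp_skip, show 1 + e.cost + 1 = 2 + e.cost by omega]

theorem wp_unless {e : Exp} {c : Cmd} {s : Store} {Q : Store → ℕ → Prop} :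
    WP (unless' e c) s Q ↔
      if e.eval s = 0 then WP c s fun s' t => Q s' (1 + e.cost + t) else Q s (2 + e.cost) := by
  rw [unless', wp_ite]
  simp only [wp_skip, show 1 + e.cost + 1 = 2 + e.cost by omega]

theorem wp_loop_false {e : Exp} {c : Cmd} {s : Store} {Q : Store → ℕ → Prop}
    (he : e.eval s = 0) (h : Q s (1 + e.cost)) : WP (.loop e c) s Q :=
  ⟨_, _, .loop_false he, h⟩

theorem wp_loop_true {e : Exp} {c : Cmd} {s : Store} {Q : Store → ℕ → Prop}
    (he : e.eval s ≠ 0)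
    (h : WP c s fun s' t => WP (.loop e c) s' fun s'' t' => Q s'' (1 + e.cost + t + t')) :
    WP (.loop e c) s Q := by
  obtain ⟨s', t, hb, s'', t', hb', hq⟩ := h
  exact ⟨_, _, .loop_true he hb hb', hq⟩

/-- The rule for counting loops, with a bound `B i` for the time of round `i`. -/
theorem wp_forUpTo_sum {x : Reg} {e : Exp} {c : Cmd} {s : Store} {N : ℕ}
    (I : ℕ → Store → Prop) (B : ℕ → ℕ) (hx : c.writesReg x = false)
    (he : ∀ s', Frame (forUpTo x e c) s s' → e.eval s' = N)
    (h0 : I 0 (s.setReg x 0))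
    (hI : ∀ i < N, ∀ s', Frame (forUpTo x e c) s s' → s'.reg x = i → I i s' →
      WP c s' fun s'' t => t ≤ B i ∧ I (i + 1) (s''.setReg x (i + 1))) :
    WP (forUpTo x e c) s fun s' t =>
      t ≤ 6 + e.cost + N * (8 + e.cost) + ∑ i ∈ Finset.range N, B i ∧ s'.reg x = N ∧ I N s' := by
  -- Induction on the number `k` of rounds left. A round costs `3 + e.cost` for the test, 4 for the
  -- increment and 1 for the sequencing, besides the body; the last, failing test gives the summand
  -- `3 + e.cost`, to which the initialisation adds 3.
  have key : ∀ k i s', k + i = N → Frame (forUpTo x e c) s s' → s'.reg x = i → I i s' →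
      WP (.loop (.lt (.reg x) e) (c ;; x ≔ .add (.reg x) (.lit 1))) s' fun s'' t =>
        t ≤ 3 + e.cost + k * (8 + e.cost) + ∑ j ∈ Finset.Ico i N, B j ∧ s''.reg x = N ∧ I N s'' := by
    intro k
    induction k with
    | zero =>
      intro i s' hk hf hr hi
      obtain rfl : i = N := by omega
      refine wp_loop_false (by simp [Exp.eval, he s' hf, hr]) ⟨?_, hr, hi⟩
      simp [Exp.cost]
      omega
    | succ k ih =>
      intro i s' hk hf hr hi
      refine wp_loop_true (by simp [Exp.eval, he s' hf, hr]; omega) ?_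
      rw [wp_seq]
      refine (hI i (by omega) s' hf hr hi).frame.mono fun s'' t ⟨hf', ht, hi'⟩ => ?_
      rw [wp_set]
      have hr' : s''.reg x = i := (hf'.reg x hx).trans hr
      have hev : (Exp.add (.reg x) (.lit 1)).eval s'' = i + 1 := by simp [Exp.eval, hr']
      rw [hev]
      refine (ih (i + 1) _ (by omega) (hf.trans ?_) (by simp [Store.setReg]) hi').mono ?_
      · refine (hf'.mono ?_ ?_).trans ((Big.set x (.add (.reg x) (.lit 1)) s'').frame.mono ?_ ?_ |>
          fun h => hev ▸ h) <;>
          simp [forUpTo, Cmd.writesReg, Cmd.writesArr] <;> tauto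
      · rintro s₃ t' ⟨ht', hr₃, hI₃⟩
        refine ⟨?_, hr₃, hI₃⟩
        rw [Finset.sum_eq_sum_Ico_succ_bot (by omega)]
        simp only [Exp.cost, Nat.succ_mul] at ht' ⊢
        omega
  rw [forUpTo, wp_seq, wp_set]
  refine (key N 0 _ (by omega) ?_ (by simp [Store.setReg]) h0).mono ?_
  · refine (Big.set x (.lit 0) s).frame.mono ?_ ?_ <;>
      simp [forUpTo, Cmd.writesReg, Cmd.writesArr]
  · rintro s' t ⟨ht, hr, hi⟩
    refine ⟨?_, hr, hi⟩
    rw [← Finset.range_eq_Ico] at ht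
    simp only [Exp.cost]
    omega

/-- The rule for counting loops, with a bound `B` for the time of each round. -/
theorem wp_forUpTo {x : Reg} {e : Exp} {c : Cmd} {s : Store} {N : ℕ}
    (I : ℕ → Store → Prop) (B : ℕ) (hx : c.writesReg x = false)
    (he : ∀ s', Frame (forUpTo x e c) s s' → e.eval s' = N)
    (h0 : I 0 (s.setReg x 0))
    (hI : ∀ i < N, ∀ s', Frame (forUpTo x e c) s s' → s'.reg x = i → I i s' →
      WP c s' fun s'' t => t ≤ B ∧ I (i + 1) (s''.setReg x (i + 1))) :
    WP (forUpTo x e c) s fun s' t =>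
      t ≤ 6 + e.cost + N * (8 + e.cost + B) ∧ s'.reg x = N ∧ I N s' := by
  refine (wp_forUpTo_sum I (fun _ => B) hx he h0 hI).mono fun s' t ⟨ht, h⟩ => ⟨?_, h⟩
  rw [Finset.sum_const, Finset.card_range, smul_eq_mul, add_assoc, ← mul_add] at ht
  exact ht

end

section
variable {m n : ℕ} {P : Market m n} {D E Vin Vout : Finset (Fin m × Fin n)} {s s' : Store} {N : ℕ}

/-! ## Best and worst partners -/

/-- The first entry of a list, or `k` if there is none. -/
def headVal {k : ℕ} (l : List (Fin k)) : ℕ := (l.head?.map Fin.val).getD k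

/-- The last entry of a list, or `k` if there is none. -/
def lastVal {k : ℕ} (l : List (Fin k)) : ℕ := (l.getLast?.map Fin.val).getD k

/-- The refresh loop in functional form: the sentinel `k` is no entry of the list, so comparison
with it tells whether a first hit has been stored. The last hit is simply overwritten. -/
theorem headVal_append_singleton {k : ℕ} (l : List (Fin k)) (a : Fin k) :
    headVal (l ++ [a]) = if headVal l = k then a.val else headVal l := by
  cases l with
  | nil => simp [headVal]
  | cons b l => simp [headVal, b.isLt.ne]

theorem lastVal_append_singleton {k : ℕ} (l : List (Fin k)) (a : Fin k) :
    lastVal (l ++ [a]) = a.val := by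
  simp [lastVal]

theorem filter_take_succ {α : Type} (l : List α) (p : α → Bool) {i : ℕ} (hi : i < l.length) :
    (l.take (i + 1)).filter p = (l.take i).filter p ++ if p l[i] then [l[i]] else [] := by
  rw [List.take_succ_eq_append_getElem hi, List.filter_append]
  congr 1
  split_ifs with h <;> simp [h]

theorem pairwise_precedes {α : Type} [DecidableEq α] {l : List α} (h : l.Nodup) :
    l.Pairwise (Precedes l) := by
  rw [List.pairwise_iff_getElem]
  intro i j hi hj hij
  refine ⟨List.getElem_mem hi, List.getElem_mem hj, ?_⟩
  rwa [h.idxOf_getElem, h.idxOf_getElem]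

theorem headVal_filter {k : ℕ} {l : List (Fin k)} (h : l.Nodup) (p : Fin k → Bool) :
    (headVal (l.filter p) = k ∧ ∀ a ∈ l, p a = false) ∨
      ∃ a ∈ l, headVal (l.filter p) = a.val ∧ p a = true ∧
        ∀ b, p b = true → ¬ Precedes l b a := by
  have hp := (pairwise_precedes h).filter p
  rcases hl : l.filter p with - | ⟨a, l'⟩
  · left
    refine ⟨by simp [headVal], fun a ha => ?_⟩
    simpa using List.filter_eq_nil_iff.1 hl a ha
  · right
    have ha : a ∈ l.filter p := by simp [hl]
    rw [List.mem_filter] at ha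
    refine ⟨a, ha.1, by simp [headVal], ha.2, fun b hb hba => ?_⟩
    have hb' : b ∈ l.filter p := List.mem_filter.2 ⟨hba.1, hb⟩
    rw [hl] at hb' hp
    rcases List.mem_cons.1 hb' with rfl | hb'
    · exact hba.asymm hba
    · exact hba.asymm ((List.pairwise_cons.1 hp).1 b hb')

theorem lastVal_filter {k : ℕ} {l : List (Fin k)} (h : l.Nodup) (p : Fin k → Bool)
    {c : Fin k} (hc : c ∈ l) (hpc : p c = true) :
    ∃ a ∈ l, lastVal (l.filter p) = a.val ∧ p a = true ∧ ∀ b, p b = true → ¬ Precedes l a b := by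
  have hp := (pairwise_precedes h).filter p
  rcases List.eq_nil_or_concat (l.filter p) with hl | ⟨l', a, hl⟩
  · exact absurd hpc (List.filter_eq_nil_iff.1 hl c hc)
  · rw [List.concat_eq_append] at hl
    have ha : a ∈ l.filter p := by simp [hl]
    rw [List.mem_filter] at ha
    refine ⟨a, ha.1, by rw [hl]; exact lastVal_append_singleton _ _, ha.2, fun b hb hba => ?_⟩
    have hb' : b ∈ l.filter p := List.mem_filter.2 ⟨hba.2.1, hb⟩
    rw [hl] at hb' hp
    rw [List.mem_append, List.mem_singleton] at hb'
    rcases hb' with hb' | rfl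
    · exact hba.asymm ((List.pairwise_append.1 hp).2.2 b hb' a (by simp))
    · exact hba.asymm hba

/-- The best remaining firm of worker `w`, or `n`. -/
def bestRow (P : Market m n) (D : Finset (Fin m × Fin n)) (w : Fin m) : ℕ :=
  headVal ((P.workerPref w).filter fun f => decide ((w, f) ∈ D))

/-- The worst remaining firm of worker `w`, or `n`. -/
def worstRow (P : Market m n) (D : Finset (Fin m × Fin n)) (w : Fin m) : ℕ :=
  lastVal ((P.workerPref w).filter fun f => decide ((w, f) ∈ D))

/-- The best remaining worker of firm `f`, or `m`. -/
def bestCol (P : Market m n) (D : Finset (Fin m × Fin n)) (f : Fin n) : ℕ :=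
  headVal ((P.firmPref f).filter fun w => decide ((w, f) ∈ D))

/-- The worst remaining worker of firm `f`, or `m`. -/
def worstCol (P : Market m n) (D : Finset (Fin m × Fin n)) (f : Fin n) : ℕ :=
  lastVal ((P.firmPref f).filter fun w => decide ((w, f) ∈ D))

/-- The link between the stored arrays and the theory: the first remaining entry of a list is the
vertex of `topW` in that row. -/
theorem bestRow_cases (hD : D ⊆ P.vertices) (w : Fin m) :
    (bestRow P D w = n ∧ ∀ f, (w, f) ∉ D) ∨ ∃ f, bestRow P D w = f.val ∧ (w, f) ∈ topW P D := by
  rcases headVal_filter (P.workerPref_nodup w) (fun f => decide ((w, f) ∈ D)) with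
    ⟨h, h'⟩ | ⟨f, -, h, hf, h'⟩
  · refine .inl ⟨h, fun f hf => ?_⟩
    have := h' f (mem_vertices.1 (hD hf))
    simp [hf] at this
  · refine .inr ⟨f, h, mem_topW.2 ⟨by simpa using hf, fun u hu a => ?_⟩⟩
    obtain ⟨w', f'⟩ := u
    obtain ⟨rfl, a⟩ := a
    exact h' f' (by simpa using hu) a

theorem bestCol_cases (hD : D ⊆ P.vertices) (f : Fin n) :
    (bestCol P D f = m ∧ ∀ w, (w, f) ∉ D) ∨ ∃ w, bestCol P D f = w.val ∧ (w, f) ∈ topF P D := by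
  rcases headVal_filter (P.firmPref_nodup f) (fun w => decide ((w, f) ∈ D)) with
    ⟨h, h'⟩ | ⟨w, -, h, hw, h'⟩
  · refine .inl ⟨h, fun w hw => ?_⟩
    have := h' w (mem_vertices'.1 (hD hw))
    simp [hw] at this
  · refine .inr ⟨w, h, mem_topF.2 ⟨by simpa using hw, fun u hu a => ?_⟩⟩
    obtain ⟨w', f'⟩ := u
    obtain ⟨rfl, a⟩ := a
    exact h' w' (by simpa using hu) a

/-- Justifies the test of IDUA on the machine: comparing `f` with the worst entry decides whether
anything in the row is worse than `(w, f)`, and a negative answer comes with an example. -/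
theorem worstRow_spec (hD : D ⊆ P.vertices) {w : Fin m} {f : Fin n} (h : (w, f) ∈ D) :
    ∃ g, worstRow P D w = g.val ∧ (w, g) ∈ D ∧ (g = f → ∀ u ∈ D, ¬ ArcW P u (w, f)) ∧
      (g ≠ f → ArcW P (w, g) (w, f)) := by
  obtain ⟨g, -, hg, hgD, h'⟩ := lastVal_filter (P.workerPref_nodup w)
    (fun f => decide ((w, f) ∈ D)) (mem_vertices.1 (hD h)) (by simpa using h)
  simp only [decide_eq_true_eq] at hgD h'
  refine ⟨g, hg, hgD, ?_, fun hne => ?_⟩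
  · rintro rfl ⟨w', f'⟩ hu ⟨e, a⟩
    obtain rfl : w' = w := e
    exact h' _ hu a
  · rcases arcW_total (hD hgD) (hD h) rfl (by simpa using hne) with a | a
    · exact a
    · exact (h' _ h a.2).elim

theorem worstCol_spec (hD : D ⊆ P.vertices) {w : Fin m} {f : Fin n} (h : (w, f) ∈ D) :
    ∃ g, worstCol P D f = g.val ∧ (g, f) ∈ D ∧ (g = w → ∀ u ∈ D, ¬ ArcF P u (w, f)) ∧
      (g ≠ w → ArcF P (g, f) (w, f)) := by
  obtain ⟨g, -, hg, hgD, h'⟩ := lastVal_filter (P.firmPref_nodup f)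
    (fun w => decide ((w, f) ∈ D)) (mem_vertices'.1 (hD h)) (by simpa using h)
  simp only [decide_eq_true_eq] at hgD h'
  refine ⟨g, hg, hgD, ?_, fun hne => ?_⟩
  · rintro rfl ⟨w', f'⟩ hu ⟨e, a⟩
    obtain rfl : f' = f := e
    exact h' _ hu a
  · rcases arcF_total (hD hgD) (hD h) rfl (by simpa using hne) with a | a
    · exact a
    · exact (h' _ h a.2).elim

/-! ## The memory -/

/-- `a` is the `0`-`1` matrix of `D`. -/
def Holds (a : ℕ → ℕ) (D : Finset (Fin m × Fin n)) : Prop :=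
  ∀ (w : Fin m) (f : Fin n), a (w.val * n + f.val) = if (w, f) ∈ D then 1 else 0

/-- Division by `n` with remainder; `n` is positive since `Fin n` is inhabited. -/
theorem cell_inj {w w' : Fin m} {f f' : Fin n} (h : w.val * n + f.val = w'.val * n + f'.val) :
    w = w' ∧ f = f' := by
  have h1 := congrArg (· / n) h
  have h2 := congrArg (· % n) h
  have hn : 0 < n := f.pos
  simp only [Nat.mod_eq_of_lt f.isLt,
    Nat.mod_eq_of_lt f'.isLt, mul_comm _ n, Nat.mul_add_div hn, Nat.div_eq_of_lt f.isLt,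
    Nat.div_eq_of_lt f'.isLt, Nat.mul_add_mod] at h1 h2
  exact ⟨Fin.ext (by simpa using h1), Fin.ext h2⟩

theorem Holds.insert {a : ℕ → ℕ} (h : Holds a D) (u : Fin m × Fin n) :
    Holds (Function.update a (u.1.val * n + u.2.val) 1) (insert u D) := by
  intro w f
  by_cases e : w.val * n + f.val = u.1.val * n + u.2.val
  · obtain ⟨h1, h2⟩ := cell_inj e
    subst h1 h2
    simp
  · rw [Function.update_of_ne e, h w f]
    have : (w, f) ≠ u := by
      rintro rfl
      exact e rfl
    simp [this]

theorem Holds.erase {a : ℕ → ℕ} (h : Holds a D) (u : Fin m × Fin n) :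
    Holds (Function.update a (u.1.val * n + u.2.val) 0) (D.erase u) := by
  intro w f
  by_cases e : w.val * n + f.val = u.1.val * n + u.2.val
  · obtain ⟨h1, h2⟩ := cell_inj e
    subst h1 h2
    simp
  · rw [Function.update_of_ne e, h w f]
    have : (w, f) ≠ u := by
      rintro rfl
      exact e rfl
    simp [this]

/-- The input is in place. -/
structure Static (P : Market m n) (s : Store) : Prop where
  reg_m : s.reg .m = m
  reg_n : s.reg .n = n
  lenW : ∀ w : Fin m, s.arr .lenW w = (P.workerPref w).length
  lenF : ∀ f : Fin n, s.arr .lenF f = (P.firmPref f).length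
  prefW : ∀ (w : Fin m) (i : ℕ) (h : i < (P.workerPref w).length),
    s.arr .prefW (w.val * n + i) = ((P.workerPref w)[i]).val
  prefF : ∀ (f : Fin n) (i : ℕ) (h : i < (P.firmPref f).length),
    s.arr .prefF (f.val * m + i) = ((P.firmPref f)[i]).val

/-- The input, the digraph `D`, and the best and worst remaining partners are in place. -/
structure State (P : Market m n) (D : Finset (Fin m × Fin n)) (s : Store) : Prop
    extends Static P s where
  holds : Holds (s.arr .D) D
  bestW : ∀ w : Fin m, s.arr .bestW w = bestRow P D w
  worstW : ∀ w : Fin m, s.arr .worstW w = worstRow P D w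
  bestF : ∀ f : Fin n, s.arr .bestF f = bestCol P D f
  worstF : ∀ f : Fin n, s.arr .worstF f = worstCol P D f

/-- The command does not write the given registers and arrays. -/
def Cmd.avoids (c : Cmd) (rs : List Reg) (as : List Arr) : Bool :=
  rs.all (fun x => !c.writesReg x) && as.all fun a => !c.writesArr a

/-- The side condition is a boolean computation on the syntax of the command; for concrete code it
is settled by `rfl`. -/
theorem Frame.reg_of_avoids {c : Cmd} {rs : List Reg} {as : List Arr} (h : Frame c s s')
    (hc : c.avoids rs as = true) : ∀ x ∈ rs, s'.reg x = s.reg x := by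
  simp only [Cmd.avoids, Bool.and_eq_true, List.all_eq_true, Bool.not_eq_true'] at hc
  exact fun x hx => h.reg x (hc.1 x hx)

theorem Frame.arr_of_avoids {c : Cmd} {rs : List Reg} {as : List Arr} (h : Frame c s s')
    (hc : c.avoids rs as = true) : ∀ a ∈ as, s'.arr a = s.arr a := by
  simp only [Cmd.avoids, Bool.and_eq_true, List.all_eq_true, Bool.not_eq_true'] at hc
  exact fun x hx => h.arr x (hc.2 x hx)

theorem Static.congr (h : Static P s) (hr : ∀ x ∈ [Reg.m, .n], s'.reg x = s.reg x)
    (ha : ∀ a ∈ [Arr.prefW, .lenW, .prefF, .lenF], s'.arr a = s.arr a) : Static P s' := by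
  simp only [List.forall_mem_cons, List.not_mem_nil, false_imp_iff, implies_true, and_true] at hr ha
  obtain ⟨r1, r2⟩ := hr
  obtain ⟨a1, a2, a3, a4⟩ := ha
  exact ⟨r1.trans h.reg_m, r2.trans h.reg_n, a2 ▸ h.lenW, a4 ▸ h.lenF, a1 ▸ h.prefW, a3 ▸ h.prefF⟩

theorem Static.frame {c : Cmd} (h : Static P s) (hf : Frame c s s')
    (hc : c.avoids [.m, .n] [.prefW, .lenW, .prefF, .lenF] = true) : Static P s' :=
  h.congr (hf.reg_of_avoids hc) (hf.arr_of_avoids hc)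

theorem State.congr (h : State P D s) (hr : ∀ x ∈ [Reg.m, .n], s'.reg x = s.reg x)
    (ha : ∀ a ∈ [Arr.prefW, .lenW, .prefF, .lenF, .D, .bestW, .worstW, .bestF, .worstF],
      s'.arr a = s.arr a) : State P D s' := by
  have hs : Static P s' := h.toStatic.congr hr fun a h => ha a (by simp at h ⊢; tauto)
  simp only [List.forall_mem_cons, List.not_mem_nil, false_imp_iff, implies_true, and_true] at ha
  obtain ⟨-, -, -, -, a1, a2, a3, a4, a5⟩ := ha
  exact ⟨hs, a1 ▸ h.holds, a2 ▸ h.bestW, a3 ▸ h.worstW, a4 ▸ h.bestF, a5 ▸ h.worstF⟩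

theorem State.frame {c : Cmd} (h : State P D s) (hf : Frame c s s')
    (hc : c.avoids [.m, .n]
      [.prefW, .lenW, .prefF, .lenF, .D, .bestW, .worstW, .bestF, .worstF] = true) :
    State P D s' :=
  h.congr (hf.reg_of_avoids hc) (hf.arr_of_avoids hc)

theorem length_workerPref_le (P : Market m n) (w : Fin m) : (P.workerPref w).length ≤ n := by
  simpa using (P.workerPref_nodup w).length_le_card

theorem length_firmPref_le (P : Market m n) (f : Fin n) : (P.firmPref f).length ≤ m := by
  simpa using (P.firmPref_nodup f).length_le_card

/-! ## Updating the best and worst partners -/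

/-- Invariant: after `i` rounds the two entries describe the first `i` members of the preference
list. The loop uses `i` and `g` itself, hence the restrictions on `x`. -/
theorem wp_refreshRow {x : Reg} (hi : x ≠ .i) (hg : x ≠ .g) (hs : Static P s)
    (hD : Holds (s.arr .D) D) {w : Fin m} (hw : s.reg x = w) (hn : n ≤ N) (hN : 1 ≤ N) :
    WP (refreshRow x) s fun s' t => t ≤ 100 * N ∧
      s'.arr .bestW = Function.update (s.arr .bestW) w (bestRow P D w) ∧
      s'.arr .worstW = Function.update (s.arr .worstW) w (worstRow P D w) := by
  simp only [refreshRow, wp_seq, wp_put]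
  refine (wp_forUpTo (N := (P.workerPref w).length) (fun i s' =>
    s'.arr .bestW = Function.update (s.arr .bestW) w
      (headVal (((P.workerPref w).take i).filter fun f => decide ((w, f) ∈ D))) ∧
    s'.arr .worstW = Function.update (s.arr .worstW) w
      (lastVal (((P.workerPref w).take i).filter fun f => decide ((w, f) ∈ D))))
    60 ?_ ?_ ?_ ?_).mono ?_
  · cases x <;> rfl
  · intro s' hf
    have h1 : s'.reg x = w := by
      rw [hf.reg x (by cases x <;> first | rfl | exact absurd rfl hi | exact absurd rfl hg)]
      exact hw
    have h2 : s'.arr .lenW = s.arr .lenW := by rw [hf.arr .lenW (by cases x <;> rfl)]; rfl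
    simp [Exp.eval, h1, h2, hs.lenW]
  · simp [Store.setReg, Store.setArr, Exp.eval, hw, hs.reg_n, headVal, lastVal]
  · rintro i hi' s' hf hi'' ⟨hb, hwo⟩
    have h1 : s'.reg x = w := by
      rw [hf.reg x (by cases x <;> first | rfl | exact absurd rfl hi | exact absurd rfl hg)]
      exact hw
    have h2 : s'.arr .prefW = s.arr .prefW := by rw [hf.arr .prefW (by cases x <;> rfl)]; rfl
    have h3 : s'.arr .D = s.arr .D := by rw [hf.arr .D (by cases x <;> rfl)]; rfl
    have h4 : s'.reg .n = n := by rw [hf.reg .n (by cases x <;> rfl), ← hs.reg_n]; rfl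
    have hp : s.arr .prefW (w.val * n + i) = ((P.workerPref w)[i]).val := hs.prefW w i hi'
    have hDg := hD w (P.workerPref w)[i]
    rw [filter_take_succ _ _ hi']
    by_cases hmem : (w, (P.workerPref w)[i]) ∈ D
    · rw [if_pos hmem] at hDg
      by_cases hb' : headVal (((P.workerPref w).take i).filter fun f => decide ((w, f) ∈ D)) = n
      · simp [wp_set, wp_put, wp_seq, wp_when, Exp.eval, Exp.cost, cell, Store.setReg,
          Store.setArr, hi'', h1, h2, h3, h4, hp, hDg, hg, hb, hwo, hmem,
          headVal_append_singleton, lastVal_append_singleton, hb']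
      · simp [wp_set, wp_put, wp_seq, wp_when, Exp.eval, Exp.cost, cell, Store.setReg,
          Store.setArr, hi'', h1, h2, h3, h4, hp, hDg, hg, hb, hwo, hmem,
          headVal_append_singleton, lastVal_append_singleton, hb']
    · rw [if_neg hmem] at hDg
      simp [wp_set, wp_put, wp_seq, wp_when, Exp.eval, Exp.cost, cell, Store.setReg,
        Store.setArr, hi'', h1, h2, h3, h4, hp, hDg, hg, hb, hwo, hmem]
  · rintro s' t ⟨ht, -, hb, hwo⟩
    rw [List.take_length] at hb hwo
    refine ⟨?_, hb, hwo⟩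
    have := Nat.mul_le_mul_right 70 ((length_workerPref_le P w).trans hn)
    simp [Exp.cost] at ht ⊢
    omega

theorem wp_refreshCol {x : Reg} (hi : x ≠ .i) (hg : x ≠ .g) (hs : Static P s)
    (hD : Holds (s.arr .D) D) {f : Fin n} (hw : s.reg x = f) (hm : m ≤ N) (hN : 1 ≤ N) :
    WP (refreshCol x) s fun s' t => t ≤ 100 * N ∧
      s'.arr .bestF = Function.update (s.arr .bestF) f (bestCol P D f) ∧
      s'.arr .worstF = Function.update (s.arr .worstF) f (worstCol P D f) := by
  simp only [refreshCol, wp_seq, wp_put]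
  refine (wp_forUpTo (N := (P.firmPref f).length) (fun i s' =>
    s'.arr .bestF = Function.update (s.arr .bestF) f
      (headVal (((P.firmPref f).take i).filter fun w => decide ((w, f) ∈ D))) ∧
    s'.arr .worstF = Function.update (s.arr .worstF) f
      (lastVal (((P.firmPref f).take i).filter fun w => decide ((w, f) ∈ D))))
    60 ?_ ?_ ?_ ?_).mono ?_
  · cases x <;> rfl
  · intro s' hf
    have h1 : s'.reg x = f := by
      rw [hf.reg x (by cases x <;> first | rfl | exact absurd rfl hi | exact absurd rfl hg)]
      exact hw
    have h2 : s'.arr .lenF = s.arr .lenF := by rw [hf.arr .lenF (by cases x <;> rfl)]; rfl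
    simp [Exp.eval, h1, h2, hs.lenF]
  · simp [Store.setReg, Store.setArr, Exp.eval, hw, hs.reg_m, headVal, lastVal]
  · rintro i hi' s' hf hi'' ⟨hb, hwo⟩
    have h1 : s'.reg x = f := by
      rw [hf.reg x (by cases x <;> first | rfl | exact absurd rfl hi | exact absurd rfl hg)]
      exact hw
    have h2 : s'.arr .prefF = s.arr .prefF := by rw [hf.arr .prefF (by cases x <;> rfl)]; rfl
    have h3 : s'.arr .D = s.arr .D := by rw [hf.arr .D (by cases x <;> rfl)]; rfl
    have h4 : s'.reg .n = n := by rw [hf.reg .n (by cases x <;> rfl), ← hs.reg_n]; rfl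
    have h5 : s'.reg .m = m := by rw [hf.reg .m (by cases x <;> rfl), ← hs.reg_m]; rfl
    have hp : s.arr .prefF (f.val * m + i) = ((P.firmPref f)[i]).val := hs.prefF f i hi'
    have hDg := hD (P.firmPref f)[i] f
    rw [filter_take_succ _ _ hi']
    by_cases hmem : ((P.firmPref f)[i], f) ∈ D
    · rw [if_pos hmem] at hDg
      by_cases hb' : headVal (((P.firmPref f).take i).filter fun w => decide ((w, f) ∈ D)) = m
      · simp [wp_set, wp_put, wp_seq, wp_when, Exp.eval, Exp.cost, cell, Store.setReg,
          Store.setArr, hi'', h1, h2, h3, h4, h5, hp, hDg, hg, hb, hwo, hmem,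
          headVal_append_singleton, lastVal_append_singleton, hb']
      · simp [wp_set, wp_put, wp_seq, wp_when, Exp.eval, Exp.cost, cell, Store.setReg,
          Store.setArr, hi'', h1, h2, h3, h4, h5, hp, hDg, hg, hb, hwo, hmem,
          headVal_append_singleton, lastVal_append_singleton, hb']
    · rw [if_neg hmem] at hDg
      simp [wp_set, wp_put, wp_seq, wp_when, Exp.eval, Exp.cost, cell, Store.setReg,
        Store.setArr, hi'', h1, h2, h3, h4, h5, hp, hDg, hg, hb, hwo, hmem]
  · rintro s' t ⟨ht, -, hb, hwo⟩
    rw [List.take_length] at hb hwo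
    refine ⟨?_, hb, hwo⟩
    have := Nat.mul_le_mul_right 70 ((length_firmPref_le P f).trans hm)
    simp [Exp.cost] at ht ⊢
    omega

end

section
variable {m n : ℕ} {P : Market m n} {D E Vin Vout : Finset (Fin m × Fin n)} {s s' : Store} {N : ℕ}

/-- Since `N ≥ 1`, additive constants can be absorbed into the coefficient of the leading power. -/
theorem linear_time {k c d : ℕ} (hk : k ≤ N) (hN : 1 ≤ N) : c + k * d ≤ (c + d) * N := by
  have h1 := Nat.mul_le_mul_right d hk
  have h2 := Nat.mul_le_mul_left c hN
  linarith [add_mul c d N, mul_comm N d]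

theorem quadratic_time {k c d a : ℕ} (hk : k ≤ N) (hN : 1 ≤ N) :
    c + k * (d + a * N) ≤ (c + d + a) * (N * N) := by
  have h1 := linear_time (c := c) (d := d + a * N) hk hN
  have h2 := Nat.mul_le_mul_left (c + d) (Nat.mul_le_mul_right N hN)
  linarith [add_mul c (d + a * N) N, add_mul (c + d) a (N * N), add_mul d (a * N) N,
    mul_assoc a N N, add_mul c d (N * N), mul_assoc c N N, add_mul c d N, add_mul c d (1 * N), one_mul N]

theorem wp_refreshAll (hs : Static P s) (hD : Holds (s.arr .D) D) (hm : m ≤ N) (hn : n ≤ N)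
    (hN : 1 ≤ N) : WP refreshAll s fun s' t => t ≤ 300 * (N * N) ∧ State P D s' := by
  rw [refreshAll, wp_seq]
  refine (wp_forUpTo (e := .reg .m) (N := m) (fun i s' => ∀ w : Fin m, w < i →
    s'.arr .bestW w = bestRow P D w ∧ s'.arr .worstW w = worstRow P D w) (100 * N)
    rfl (fun s' hf => (hs.frame hf rfl).reg_m) (by simp) ?_).frame.mono ?_
  · intro i hi s' hf hr hI
    refine (wp_refreshRow (w := ⟨i, hi⟩) (by decide) (by decide) (hs.frame hf rfl)
      (hf.arr .D rfl ▸ hD) hr hn hN).mono ?_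
    rintro s'' t ⟨ht, h1, h2⟩
    refine ⟨ht, fun w hw => ?_⟩
    simp only [Store.setReg, h1, h2]
    by_cases e : w = ⟨i, hi⟩
    · subst e
      simp
    · have e' : w.val ≠ i := fun h => e (Fin.ext h)
      rw [Function.update_of_ne e', Function.update_of_ne e']
      exact hI w (by omega)
  rintro s₁ t₁ ⟨hf₁, ht₁, -, hI₁⟩
  have hs₁ := hs.frame hf₁ rfl
  have hD₁ : Holds (s₁.arr .D) D := hf₁.arr .D rfl ▸ hD
  refine (wp_forUpTo (e := .reg .n) (N := n) (fun i s' => ∀ f : Fin n, f < i →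
    s'.arr .bestF f = bestCol P D f ∧ s'.arr .worstF f = worstCol P D f) (100 * N)
    rfl (fun s' hf => (hs₁.frame hf rfl).reg_n) (by simp) ?_).frame.mono ?_
  · intro i hi s' hf hr hI
    refine (wp_refreshCol (f := ⟨i, hi⟩) (by decide) (by decide) (hs₁.frame hf rfl)
      (hf.arr .D rfl ▸ hD₁) hr hm hN).mono ?_
    rintro s'' t ⟨ht, h1, h2⟩
    refine ⟨ht, fun w hw => ?_⟩
    simp only [Store.setReg, h1, h2]
    by_cases e : w = ⟨i, hi⟩
    · subst e
      simp
    · have e' : w.val ≠ i := fun h => e (Fin.ext h)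
      rw [Function.update_of_ne e', Function.update_of_ne e']
      exact hI w (by omega)
  rintro s₂ t₂ ⟨hf₂, ht₂, -, hI₂⟩
  refine ⟨?_, hs₁.frame hf₂ rfl, hf₂.arr .D rfl ▸ hD₁, fun w => ?_, fun w => ?_,
    fun f => (hI₂ f f.isLt).1, fun f => (hI₂ f f.isLt).2⟩
  · have h1 := quadratic_time (c := 7) (d := 9) (a := 100) hm hN
    have h2 := quadratic_time (c := 7) (d := 9) (a := 100) hn hN
    have := Nat.mul_le_mul hN hN
    simp only [Exp.cost, Nat.reduceAdd] at ht₁ ht₂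
    omega
  · rw [hf₂.arr .bestW rfl]
    exact (hI₁ w w.isLt).1
  · rw [hf₂.arr .worstW rfl]
    exact (hI₁ w w.isLt).2

theorem bestRow_congr {w : Fin m} (h : ∀ f, (w, f) ∈ D ↔ (w, f) ∈ E) :
    bestRow P D w = bestRow P E w := by simp only [bestRow, h]

theorem worstRow_congr {w : Fin m} (h : ∀ f, (w, f) ∈ D ↔ (w, f) ∈ E) :
    worstRow P D w = worstRow P E w := by simp only [worstRow, h]

theorem bestCol_congr {f : Fin n} (h : ∀ w, (w, f) ∈ D ↔ (w, f) ∈ E) :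
    bestCol P D f = bestCol P E f := by simp only [bestCol, h]

theorem worstCol_congr {f : Fin n} (h : ∀ w, (w, f) ∈ D ↔ (w, f) ∈ E) :
    worstCol P D f = worstCol P E f := by simp only [worstCol, h]

/-- Only the row and the column of `u` see the deletion, so all other stored partners stay valid and
linear time suffices. -/
theorem wp_deleteVertex (hs : State P D s) {u : Fin m × Fin n} (hw : s.reg .dw = u.1)
    (hf : s.reg .df = u.2) (hm : m ≤ N) (hn : n ≤ N) (hN : 1 ≤ N) :
    WP deleteVertex s fun s' t => t ≤ 220 * N ∧ State P (D.erase u) s' := by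
  rw [deleteVertex, wp_seq, wp_put, wp_seq]
  have hev : (cell (.reg .dw) (.reg .df)).eval s = u.1.val * n + u.2.val := by
    simp [cell, Exp.eval, hw, hf, hs.reg_n]
  rw [hev]
  have hs₁ : Static P (s.setArr .D (u.1.val * n + u.2.val) 0) := hs.toStatic.congr
    (by simp [Store.setArr]) (by simp [Store.setArr])
  have hD₁ : Holds ((s.setArr .D (u.1.val * n + u.2.val) 0).arr .D) (D.erase u) := by
    simpa [Store.setArr] using hs.holds.erase u
  refine (wp_refreshRow (w := u.1) (by decide) (by decide) hs₁ hD₁ hw hn hN).frame.mono ?_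
  rintro s₂ t₂ ⟨hf₂, ht₂, h1, h2⟩
  have hs₂ := hs₁.frame hf₂ rfl
  have hD₂ : Holds (s₂.arr .D) (D.erase u) := hf₂.arr .D rfl ▸ hD₁
  refine (wp_refreshCol (f := u.2) (by decide) (by decide) hs₂ hD₂
    ((hf₂.reg .df rfl).trans hf) hm hN).frame.mono ?_
  rintro s₃ t₃ ⟨hf₃, ht₃, h3, h4⟩
  refine ⟨?_, hs₂.frame hf₃ rfl, hf₃.arr .D rfl ▸ hD₂, fun w => ?_, fun w => ?_, fun f => ?_,
    fun f => ?_⟩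
  · simp only [Exp.cost, cell]
    omega
  · rw [hf₃.arr .bestW rfl, h1]
    by_cases e : w = u.1
    · subst e
      simp
    · have e' : w.val ≠ u.1.val := fun h => e (Fin.ext h)
      rw [Function.update_of_ne e']
      refine (hs.bestW w).trans (bestRow_congr fun f => ?_)
      have : (w, f) ≠ u := fun h => e (h ▸ rfl)
      simp [this]
  · rw [hf₃.arr .worstW rfl, h2]
    by_cases e : w = u.1
    · subst e
      simp
    · have e' : w.val ≠ u.1.val := fun h => e (Fin.ext h)
      rw [Function.update_of_ne e']
      refine (hs.worstW w).trans (worstRow_congr fun f => ?_)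
      have : (w, f) ≠ u := fun h => e (h ▸ rfl)
      simp [this]
  · rw [h3]
    by_cases e : f = u.2
    · subst e
      simp
    · have e' : f.val ≠ u.2.val := fun h => e (Fin.ext h)
      rw [Function.update_of_ne e', hf₂.arr .bestF rfl]
      refine (hs.bestF f).trans (bestCol_congr fun w => ?_)
      have : (w, f) ≠ u := fun h => e (h ▸ rfl)
      simp [this]
  · rw [h4]
    by_cases e : f = u.2
    · subst e
      simp
    · have e' : f.val ≠ u.2.val := fun h => e (Fin.ext h)
      rw [Function.update_of_ne e', hf₂.arr .worstF rfl]
      refine (hs.worstF f).trans (worstCol_congr fun w => ?_)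
      have : (w, f) ≠ u := fun h => e (h ▸ rfl)
      simp [this]

/-! ## Iterated deletion on the machine -/

/-- The registers `dw` and `df` hold the coordinates of a vertex with property `p`. -/
def Selected (p : Fin m × Fin n → Prop) (s : Store) : Prop :=
  ∃ u, p u ∧ s.reg .dw = u.1 ∧ s.reg .df = u.2

/-- The scan of the best firms in `runIdua`. -/
def scanRows : Cmd :=
  forUpTo .w (.reg .m)
    (.f ≔ .get .bestW (.reg .w) ;;
     unless' (.eq (.reg .f) (.reg .n))
       (unless' (.eq (.get .worstF (.reg .f)) (.reg .w))
         (.dw ≔ .get .worstF (.reg .f) ;; .df ≔ .reg .f ;; .go ≔ .lit 1)))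

/-- The scan of the best workers in `runIdua`. -/
def scanCols : Cmd :=
  forUpTo .f (.reg .n)
    (.w ≔ .get .bestF (.reg .f) ;;
     unless' (.eq (.reg .w) (.reg .m))
       (unless' (.eq (.get .worstW (.reg .w)) (.reg .f))
         (.dw ≔ .reg .w ;; .df ≔ .get .worstW (.reg .w) ;; .go ≔ .lit 1)))

/-- For each vertex of `topW` the worst entry of its column is inspected; if that is another vertex,
it is dominated. A later hit may overwrite an earlier one, so the invariant only asserts that some
dominated vertex is selected. -/
theorem wp_scanRows (hs : State P D s) (hD : D ⊆ P.vertices) (hgo : s.reg .go = 0)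
    (hm : m ≤ N) (hN : 1 ≤ N) :
    WP scanRows s fun s' t => t ≤ 100 * N ∧
      ((s'.reg .go = 1 ∧ Selected (fun u => u ∈ D ∧ Dominated P D u) s') ∨
        (s'.reg .go = 0 ∧ ∀ v ∈ topW P D, ∀ u ∈ D, ¬ ArcF P u v)) := by
  refine (wp_forUpTo (e := .reg .m) (N := m) (fun i s' =>
    (s'.reg .go = 1 ∧ Selected (fun u => u ∈ D ∧ Dominated P D u) s') ∨
      (s'.reg .go = 0 ∧ ∀ v ∈ topW P D, v.1 < i → ∀ u ∈ D, ¬ ArcF P u v)) 50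
    rfl (fun s' hf => (hs.frame hf rfl).reg_m) ?_ ?_).mono ?_
  · right
    simp [Store.setReg, hgo]
  · intro i hi s' hf hr hI
    have hs' := hs.frame hf rfl
    have hb := hs'.bestW ⟨i, hi⟩
    have hrn := hs'.reg_n
    rcases bestRow_cases hD ⟨i, hi⟩ with ⟨hbn, hemp⟩ | ⟨f, hbf, hf'⟩
    · rw [hbn] at hb
      simp only [wp_seq, wp_set, wp_unless, Exp.eval, Exp.cost, Store.setReg, hr,
        Function.update_self, ne_eq, reduceCtorEq, not_false_eq_true, Function.update_of_ne,
        hb, hrn, if_true, one_ne_zero, if_false]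
      refine ⟨by omega, ?_⟩
      rcases hI with ⟨h1, h2⟩ | ⟨h1, h2⟩
      · exact .inl ⟨by simpa using h1, by simpa [Selected] using h2⟩
      · refine .inr ⟨by simpa using h1, fun v hv hvi => ?_⟩
        rcases Nat.lt_succ_iff_lt_or_eq.1 hvi with h | h
        · exact h2 v hv h
        · have : (⟨i, hi⟩, v.2) = v := Prod.ext (Fin.ext h.symm) rfl
          exact absurd (topW_subset hv) (this ▸ hemp v.2)
    · rw [hbf] at hb
      obtain ⟨g, hg, hgD, hg1, hg2⟩ := worstCol_spec hD (topW_subset hf')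
      have hwo := hs'.worstF f
      rw [hg] at hwo
      by_cases e : g.val = i
      · simp only [wp_seq, wp_set, wp_unless, Exp.eval, Exp.cost, Store.setReg, hr,
          Function.update_self, ne_eq, reduceCtorEq, not_false_eq_true, Function.update_of_ne,
          hb, hrn, if_true, one_ne_zero, if_false, f.isLt.ne, hwo, e]
        refine ⟨by omega, ?_⟩
        rcases hI with ⟨h1, h2⟩ | ⟨h1, h2⟩
        · exact .inl ⟨by simpa using h1, by simpa [Selected] using h2⟩
        · refine .inr ⟨by simpa using h1, fun v hv hvi => ?_⟩
          rcases Nat.lt_succ_iff_lt_or_eq.1 hvi with h | h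
          · exact h2 v hv h
          · obtain rfl := topW_row_injective hD hv hf' (Fin.ext h)
            exact hg1 (Fin.ext e)
      · simp only [wp_seq, wp_set, wp_unless, Exp.eval, Exp.cost, Store.setReg, hr,
          Function.update_self, ne_eq, reduceCtorEq, not_false_eq_true, Function.update_of_ne,
          hb, hrn, if_true, if_false, f.isLt.ne, hwo, e]
        refine ⟨by omega, .inl ⟨trivial, (g, f), ⟨hgD, (⟨i, hi⟩, f), topW_subset hf', .inr
          ⟨(Finset.mem_filter.1 hf').2, hg2 fun h => e (h ▸ rfl)⟩⟩, rfl, rfl⟩⟩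
  · rintro s' t ⟨ht, -, hI⟩
    refine ⟨?_, hI.imp_right fun h => ⟨h.1, fun v hv => h.2 v hv v.1.isLt⟩⟩
    have := linear_time (c := 7) (d := 59) hm hN
    simp only [Exp.cost] at ht
    omega

/-- Every dominator lies in `topW` or in `topF`, so two unsuccessful scans prove the digraph
reduced. -/
theorem wp_scanCols (hs : State P D s) (hD : D ⊆ P.vertices) (hn : n ≤ N) (hN : 1 ≤ N)
    (hgo : (s.reg .go = 1 ∧ Selected (fun u => u ∈ D ∧ Dominated P D u) s) ∨
        (s.reg .go = 0 ∧ ∀ v ∈ topW P D, ∀ u ∈ D, ¬ ArcF P u v)) :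
    WP scanCols s fun s' t => t ≤ 100 * N ∧
      ((s'.reg .go = 1 ∧ Selected (fun u => u ∈ D ∧ Dominated P D u) s') ∨
        (s'.reg .go = 0 ∧ Reduced P D)) := by
  refine (wp_forUpTo (e := .reg .n) (N := n) (fun i s' =>
    (s'.reg .go = 1 ∧ Selected (fun u => u ∈ D ∧ Dominated P D u) s') ∨
      (s'.reg .go = 0 ∧ (∀ v ∈ topW P D, ∀ u ∈ D, ¬ ArcF P u v) ∧
        ∀ v ∈ topF P D, v.2 < i → ∀ u ∈ D, ¬ ArcW P u v)) 50
    rfl (fun s' hf => (hs.frame hf rfl).reg_n) ?_ ?_).mono ?_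
  · refine hgo.imp (fun h => ?_) (fun h => ⟨by simpa [Store.setReg] using h.1, h.2, by simp⟩)
    simpa [Store.setReg, Selected] using h
  · intro i hi s' hf hr hI
    have hs' := hs.frame hf rfl
    have hb := hs'.bestF ⟨i, hi⟩
    have hrn := hs'.reg_m
    rcases bestCol_cases hD ⟨i, hi⟩ with ⟨hbn, hemp⟩ | ⟨f, hbf, hf'⟩
    · rw [hbn] at hb
      simp only [wp_seq, wp_set, wp_unless, Exp.eval, Exp.cost, Store.setReg, hr,
        Function.update_self, ne_eq, reduceCtorEq, not_false_eq_true, Function.update_of_ne,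
        hb, hrn, if_true, one_ne_zero, if_false]
      refine ⟨by omega, ?_⟩
      rcases hI with ⟨h1, h2⟩ | ⟨h1, h2, h3⟩
      · exact .inl ⟨by simpa using h1, by simpa [Selected] using h2⟩
      · refine .inr ⟨by simpa using h1, h2, fun v hv hvi => ?_⟩
        rcases Nat.lt_succ_iff_lt_or_eq.1 hvi with h | h
        · exact h3 v hv h
        · have : (v.1, ⟨i, hi⟩) = v := Prod.ext rfl (Fin.ext h.symm)
          exact absurd (topF_subset hv) (this ▸ hemp v.1)
    · rw [hbf] at hb
      obtain ⟨g, hg, hgD, hg1, hg2⟩ := worstRow_spec hD (topF_subset hf')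
      have hwo := hs'.worstW f
      rw [hg] at hwo
      by_cases e : g.val = i
      · simp only [wp_seq, wp_set, wp_unless, Exp.eval, Exp.cost, Store.setReg, hr,
          Function.update_self, ne_eq, reduceCtorEq, not_false_eq_true, Function.update_of_ne,
          hb, hrn, if_true, one_ne_zero, if_false, f.isLt.ne, hwo, e]
        refine ⟨by omega, ?_⟩
        rcases hI with ⟨h1, h2⟩ | ⟨h1, h2, h3⟩
        · exact .inl ⟨by simpa using h1, by simpa [Selected] using h2⟩
        · refine .inr ⟨by simpa using h1, h2, fun v hv hvi => ?_⟩
          rcases Nat.lt_succ_iff_lt_or_eq.1 hvi with h | h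
          · exact h3 v hv h
          · obtain rfl := topF_col_injective hD hv hf' (Fin.ext h)
            exact hg1 (Fin.ext e)
      · simp only [wp_seq, wp_set, wp_unless, Exp.eval, Exp.cost, Store.setReg, hr,
          Function.update_self, ne_eq, reduceCtorEq, not_false_eq_true, Function.update_of_ne,
          hb, hrn, if_true, if_false, f.isLt.ne, hwo, e]
        refine ⟨by omega, .inl ⟨trivial, (f, g), ⟨hgD, (f, ⟨i, hi⟩), topF_subset hf', .inl
          ⟨(Finset.mem_filter.1 hf').2, hg2 fun h => e (h ▸ rfl)⟩⟩, rfl, rfl⟩⟩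
  · rintro s' t ⟨ht, -, hI⟩
    refine ⟨?_, hI.imp_right fun h => ⟨h.1, ?_⟩⟩
    · have := linear_time (c := 7) (d := 59) hn hN
      simp only [Exp.cost] at ht
      omega
    · rintro u hu ⟨v, hv, ⟨hd, ha⟩ | ⟨hd, ha⟩⟩
      · exact h.2.2 v (Finset.mem_filter.2 ⟨hv, hd⟩) v.2.isLt u hu ha
      · exact h.2.1 v (Finset.mem_filter.2 ⟨hv, hd⟩) u hu ha

/-- Amortisation: a successful round takes O(N) and deletes one vertex, whose share `500 * N` pays
for it; `300 * N` covers the last round. The final cardinality stands on the left so that truncated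
subtraction does not occur. By `idua_erase` each round keeps the result of IDUA. -/
theorem wp_iduaLoop (hs : State P D s) (hD : D ⊆ P.vertices) (hgo : s.reg .go = 1)
    (hm : m ≤ N) (hn : n ≤ N) (hN : 1 ≤ N) :
    WP (.loop (.reg .go) (.go ≔ .lit 0 ;; scanRows ;; scanCols ;; when (.reg .go) deleteVertex)) s
      fun s' t => t + 500 * (N * (idua P D).card) ≤ 500 * (N * D.card) + 300 * N ∧
        State P (idua P D) s' := by
  induction hk : D.card using Nat.strong_induction_on generalizing D s with
  | _ k ih =>
    subst hk
    refine wp_loop_true (by simp [Exp.eval, hgo]) ?_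
    rw [wp_seq, wp_set, wp_seq]
    have hs₀ : State P D (s.setReg .go 0) := hs.congr (by simp [Store.setReg]) (fun _ _ => rfl)
    refine (wp_scanRows hs₀ hD (by simp [Store.setReg]) hm hN).frame.mono ?_
    rintro s₁ t₁ ⟨hf₁, ht₁, hI₁⟩
    have hs₁ := hs₀.frame hf₁ rfl
    rw [wp_seq]
    refine (wp_scanCols hs₁ hD hn hN hI₁).frame.mono ?_
    rintro s₂ t₂ ⟨hf₂, ht₂, hI₂⟩
    have hs₂ := hs₁.frame hf₂ rfl
    rw [wp_when]
    rcases hI₂ with ⟨h1, u, ⟨huD, hu⟩, hw, hf⟩ | ⟨h1, hR⟩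
    · rw [if_neg (by simp [Exp.eval, h1])]
      refine (wp_deleteVertex hs₂ hw hf hm hn hN).frame.mono ?_
      rintro s₃ t₃ ⟨hf₃, ht₃, hs₃⟩
      have hcard := Finset.card_erase_add_one huD
      refine (ih _ (by omega) hs₃ ((Finset.erase_subset _ _).trans hD)
        ((hf₃.reg .go rfl).trans h1) rfl).mono ?_
      rintro s₄ t₄ ⟨ht₄, hs₄⟩
      rw [idua_erase hu] at ht₄ hs₄
      refine ⟨?_, hs₄⟩
      have : N * D.card = N * (D.erase u).card + N := by rw [← hcard, mul_add, mul_one]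
      simp only [Exp.cost]
      omega
    · rw [if_pos (by simp [Exp.eval, h1])]
      refine wp_loop_false (by simp [Exp.eval, h1]) ?_
      rw [hR.idua_eq]
      refine ⟨?_, hs₂⟩
      simp only [Exp.cost]
      omega

theorem wp_runIdua (hs : State P D s) (hD : D ⊆ P.vertices) (hm : m ≤ N) (hn : n ≤ N)
    (hN : 1 ≤ N) :
    WP runIdua s fun s' t => t + 500 * (N * (idua P D).card) ≤ 500 * (N * D.card) + 310 * N ∧
        State P (idua P D) s' := by
  rw [runIdua, wp_seq, wp_set]
  refine (wp_iduaLoop (s := s.setReg .go 1) (hs.congr (by simp [Store.setReg]) (fun _ _ => rfl)) hD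
    (by simp [Store.setReg]) hm hn hN).mono ?_
  rintro s' t ⟨ht, hs'⟩
  refine ⟨?_, hs'⟩
  simp only [Exp.cost]
  omega

/-! ## Removing the forbidden extreme vertices on the machine -/

/-- The scan of the best firms in `purgeCmd`. -/
def purgeRows : Cmd :=
  forUpTo .w (.reg .m)
    (.f ≔ .get .bestW (.reg .w) ;;
     unless' (.eq (.reg .f) (.reg .n))
       (when (.get .vout (cell (.reg .w) (.reg .f)))
         (.dw ≔ .reg .w ;; .df ≔ .reg .f ;; .found ≔ .lit 1)))

/-- The scan of the best workers in `purgeCmd`. -/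
def purgeCols : Cmd :=
  forUpTo .f (.reg .n)
    (.w ≔ .get .bestF (.reg .f) ;;
     unless' (.eq (.reg .w) (.reg .m))
       (when (.get .vout (cell (.reg .w) (.reg .f)))
         (.dw ≔ .reg .w ;; .df ≔ .reg .f ;; .found ≔ .lit 1)))

theorem wp_purgeRows (hs : State P D s) (hD : D ⊆ P.vertices) (hv : Holds (s.arr .vout) Vout)
    (hfd : s.reg .found = 0) (hm : m ≤ N) (hN : 1 ≤ N) :
    WP purgeRows s fun s' t => t ≤ 100 * N ∧
      ((s'.reg .found = 1 ∧ Selected (Removable P Vout D) s') ∨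
        (s'.reg .found = 0 ∧ ∀ v ∈ topW P D, v ∉ Vout)) := by
  refine (wp_forUpTo (e := .reg .m) (N := m) (fun i s' =>
    (s'.reg .found = 1 ∧ Selected (Removable P Vout D) s') ∨
      (s'.reg .found = 0 ∧ ∀ v ∈ topW P D, v.1 < i → v ∉ Vout)) 50
    rfl (fun s' hf => (hs.frame hf rfl).reg_m) ?_ ?_).mono ?_
  · right
    simp [Store.setReg, hfd]
  · intro i hi s' hf hr hI
    have hs' := hs.frame hf rfl
    have hb := hs'.bestW ⟨i, hi⟩
    have hrn := hs'.reg_n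
    have hv' : Holds (s'.arr .vout) Vout := hf.arr .vout rfl ▸ hv
    rcases bestRow_cases hD ⟨i, hi⟩ with ⟨hbn, hemp⟩ | ⟨f, hbf, hf'⟩
    · rw [hbn] at hb
      simp only [wp_seq, wp_set, wp_unless, Exp.eval, Exp.cost, Store.setReg, hr,
        Function.update_self, ne_eq, reduceCtorEq, not_false_eq_true, Function.update_of_ne,
        hb, hrn, if_true, one_ne_zero, if_false]
      refine ⟨by omega, ?_⟩
      rcases hI with ⟨h1, h2⟩ | ⟨h1, h2⟩
      · exact .inl ⟨by simpa using h1, by simpa [Selected] using h2⟩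
      · refine .inr ⟨by simpa using h1, fun v hv hvi => ?_⟩
        rcases Nat.lt_succ_iff_lt_or_eq.1 hvi with h | h
        · exact h2 v hv h
        · have : (⟨i, hi⟩, v.2) = v := Prod.ext (Fin.ext h.symm) rfl
          exact absurd (topW_subset hv) (this ▸ hemp v.2)
    · rw [hbf] at hb
      have hcell := hv' ⟨i, hi⟩ f
      by_cases e : (⟨i, hi⟩, f) ∈ Vout
      · rw [if_pos e] at hcell
        simp only [wp_seq, wp_set, wp_unless, wp_when, cell, Exp.eval, Exp.cost, Store.setReg, hr,
          Function.update_self, ne_eq, reduceCtorEq, not_false_eq_true, Function.update_of_ne,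
          hb, hrn, if_true, one_ne_zero, if_false, f.isLt.ne, hcell]
        refine ⟨by omega, .inl ⟨trivial, (⟨i, hi⟩, f), ⟨topW_subset hf', e, .inl
          (Finset.mem_filter.1 hf').2⟩, rfl, rfl⟩⟩
      · rw [if_neg e] at hcell
        simp only [wp_seq, wp_set, wp_unless, wp_when, cell, Exp.eval, Exp.cost, Store.setReg, hr,
          Function.update_self, ne_eq, reduceCtorEq, not_false_eq_true, Function.update_of_ne,
          hb, hrn, if_true, if_false, f.isLt.ne, hcell]
        refine ⟨by omega, ?_⟩
        rcases hI with ⟨h1, h2⟩ | ⟨h1, h2⟩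
        · exact .inl ⟨by simpa using h1, by simpa [Selected] using h2⟩
        · refine .inr ⟨by simpa using h1, fun v hv hvi => ?_⟩
          rcases Nat.lt_succ_iff_lt_or_eq.1 hvi with h | h
          · exact h2 v hv h
          · obtain rfl := topW_row_injective hD hv hf' (Fin.ext h)
            exact e
  · rintro s' t ⟨ht, -, hI⟩
    refine ⟨?_, hI.imp_right fun h => ⟨h.1, fun v hv => h.2 v hv v.1.isLt⟩⟩
    have := linear_time (c := 7) (d := 59) hm hN
    simp only [Exp.cost] at ht
    omega

theorem wp_purgeCols (hs : State P D s) (hD : D ⊆ P.vertices) (hv : Holds (s.arr .vout) Vout)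
    (hn : n ≤ N) (hN : 1 ≤ N)
    (hfd : (s.reg .found = 1 ∧ Selected (Removable P Vout D) s) ∨
        (s.reg .found = 0 ∧ ∀ v ∈ topW P D, v ∉ Vout)) :
    WP purgeCols s fun s' t => t ≤ 100 * N ∧
      ((s'.reg .found = 1 ∧ Selected (Removable P Vout D) s') ∨
        (s'.reg .found = 0 ∧ ∀ v, ¬ Removable P Vout D v)) := by
  refine (wp_forUpTo (e := .reg .n) (N := n) (fun i s' =>
    (s'.reg .found = 1 ∧ Selected (Removable P Vout D) s') ∨
      (s'.reg .found = 0 ∧ (∀ v ∈ topW P D, v ∉ Vout) ∧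
        ∀ v ∈ topF P D, v.2 < i → v ∉ Vout)) 50
    rfl (fun s' hf => (hs.frame hf rfl).reg_n) ?_ ?_).mono ?_
  · refine hfd.imp (fun h => ?_) (fun h => ⟨by simpa [Store.setReg] using h.1, h.2, by simp⟩)
    simpa [Store.setReg, Selected] using h
  · intro i hi s' hf hr hI
    have hs' := hs.frame hf rfl
    have hb := hs'.bestF ⟨i, hi⟩
    have hrm := hs'.reg_m
    have hrn := hs'.reg_n
    have hv' : Holds (s'.arr .vout) Vout := hf.arr .vout rfl ▸ hv
    rcases bestCol_cases hD ⟨i, hi⟩ with ⟨hbn, hemp⟩ | ⟨f, hbf, hf'⟩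
    · rw [hbn] at hb
      simp only [wp_seq, wp_set, wp_unless, Exp.eval, Exp.cost, Store.setReg, hr,
        Function.update_self, ne_eq, reduceCtorEq, not_false_eq_true, Function.update_of_ne,
        hb, hrm, if_true, one_ne_zero, if_false]
      refine ⟨by omega, ?_⟩
      rcases hI with ⟨h1, h2⟩ | ⟨h1, h2, h3⟩
      · exact .inl ⟨by simpa using h1, by simpa [Selected] using h2⟩
      · refine .inr ⟨by simpa using h1, h2, fun v hv hvi => ?_⟩
        rcases Nat.lt_succ_iff_lt_or_eq.1 hvi with h | h
        · exact h3 v hv h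
        · have : (v.1, ⟨i, hi⟩) = v := Prod.ext rfl (Fin.ext h.symm)
          exact absurd (topF_subset hv) (this ▸ hemp v.1)
    · rw [hbf] at hb
      have hcell := hv' f ⟨i, hi⟩
      by_cases e : (f, ⟨i, hi⟩) ∈ Vout
      · rw [if_pos e] at hcell
        simp only [wp_seq, wp_set, wp_unless, wp_when, cell, Exp.eval, Exp.cost, Store.setReg, hr,
          Function.update_self, ne_eq, reduceCtorEq, not_false_eq_true, Function.update_of_ne,
          hb, hrm, hrn, if_true, one_ne_zero, if_false, f.isLt.ne, hcell]
        refine ⟨by omega, .inl ⟨trivial, (f, ⟨i, hi⟩), ⟨topF_subset hf', e, .inr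
          (Finset.mem_filter.1 hf').2⟩, rfl, rfl⟩⟩
      · rw [if_neg e] at hcell
        simp only [wp_seq, wp_set, wp_unless, wp_when, cell, Exp.eval, Exp.cost, Store.setReg, hr,
          Function.update_self, ne_eq, reduceCtorEq, not_false_eq_true, Function.update_of_ne,
          hb, hrm, hrn, if_true, if_false, f.isLt.ne, hcell]
        refine ⟨by omega, ?_⟩
        rcases hI with ⟨h1, h2⟩ | ⟨h1, h2, h3⟩
        · exact .inl ⟨by simpa using h1, by simpa [Selected] using h2⟩
        · refine .inr ⟨by simpa using h1, h2, fun v hv hvi => ?_⟩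
          rcases Nat.lt_succ_iff_lt_or_eq.1 hvi with h | h
          · exact h3 v hv h
          · obtain rfl := topF_col_injective hD hv hf' (Fin.ext h)
            exact e
  · rintro s' t ⟨ht, -, hI⟩
    refine ⟨?_, hI.imp_right fun h => ⟨h.1, ?_⟩⟩
    · have := linear_time (c := 7) (d := 59) hn hN
      simp only [Exp.cost] at ht
      omega
    · rintro v ⟨hv, hvo, hd | hd⟩
      · exact h.2.1 v (Finset.mem_filter.2 ⟨hv, hd⟩) hvo
      · exact h.2.2 v (Finset.mem_filter.2 ⟨hv, hd⟩) v.2.isLt hvo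

/-- The vertex removed in a round pays for the scans, the refresh and the fixed cost of the IDUA
call; vertices deleted by that call pay for themselves. So the total remains O(N) per lost vertex,
although IDUA is run many times. -/
theorem wp_purgeLoop (hs : State P D s) (hD : D ⊆ P.vertices) (hv : Holds (s.arr .vout) Vout)
    (hfd : s.reg .found = 1) (hm : m ≤ N) (hn : n ≤ N) (hN : 1 ≤ N) :
    WP (.loop (.reg .found) (.found ≔ .lit 0 ;; purgeRows ;; purgeCols ;;
      when (.reg .found) (deleteVertex ;; runIdua))) s
      fun s' t => ∃ D', Purge P Vout D D' ∧ State P D' s' ∧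
        t + 1000 * (N * D'.card) ≤ 1000 * (N * D.card) + 300 * N := by
  induction hk : D.card using Nat.strong_induction_on generalizing D s with
  | _ k ih =>
    subst hk
    refine wp_loop_true (by simp [Exp.eval, hfd]) ?_
    rw [wp_seq, wp_set, wp_seq]
    have hs₀ : State P D (s.setReg .found 0) := hs.congr (by simp [Store.setReg]) (fun _ _ => rfl)
    refine (wp_purgeRows hs₀ hD hv (by simp [Store.setReg]) hm hN).frame.mono ?_
    rintro s₁ t₁ ⟨hf₁, ht₁, hI₁⟩
    have hs₁ := hs₀.frame hf₁ rfl
    have hv₁ : Holds (s₁.arr .vout) Vout := hf₁.arr .vout rfl ▸ hv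
    rw [wp_seq]
    refine (wp_purgeCols hs₁ hD hv₁ hn hN hI₁).frame.mono ?_
    rintro s₂ t₂ ⟨hf₂, ht₂, hI₂⟩
    have hs₂ := hs₁.frame hf₂ rfl
    have hv₂ : Holds (s₂.arr .vout) Vout := hf₂.arr .vout rfl ▸ hv₁
    rw [wp_when]
    rcases hI₂ with ⟨h1, u, hu, hw, hf⟩ | ⟨h1, hR⟩
    · rw [if_neg (by simp [Exp.eval, h1]), wp_seq]
      refine (wp_deleteVertex hs₂ hw hf hm hn hN).frame.mono ?_
      rintro s₃ t₃ ⟨hf₃, ht₃, hs₃⟩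
      have hv₃ : Holds (s₃.arr .vout) Vout := hf₃.arr .vout rfl ▸ hv₂
      have hsub := (Finset.erase_subset u D).trans hD
      refine (wp_runIdua hs₃ hsub hm hn hN).frame.mono ?_
      rintro s₄ t₄ ⟨hf₄, ht₄, hs₄⟩
      have hv₄ : Holds (s₄.arr .vout) Vout := hf₄.arr .vout rfl ▸ hv₃
      have hcard := Finset.card_erase_add_one hu.1
      have hle : (idua P (D.erase u)).card ≤ (D.erase u).card := Finset.card_le_card idua_subset
      refine (ih _ (by omega) hs₄ (idua_subset.trans hsub) hv₄
        ((hf₄.reg .found rfl).trans ((hf₃.reg .found rfl).trans h1)) rfl).mono ?_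
      rintro s₅ t₅ ⟨D', hp, hs₅, ht₅⟩
      refine ⟨D', .again _ _ u hu hp, hs₅, ?_⟩
      have e1 : N * D.card = N * (D.erase u).card + N := by rw [← hcard, mul_add, mul_one]
      have e2 := Nat.mul_le_mul_left N hle
      simp only [Exp.cost]
      omega
    · rw [if_pos (by simp [Exp.eval, h1])]
      refine wp_loop_false (by simp [Exp.eval, h1]) ?_
      refine ⟨D, .done D hR, hs₂, ?_⟩
      simp only [Exp.cost]
      omega

theorem wp_purgeCmd (hs : State P D s) (hD : D ⊆ P.vertices) (hv : Holds (s.arr .vout) Vout)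
    (hm : m ≤ N) (hn : n ≤ N) (hN : 1 ≤ N) :
    WP purgeCmd s fun s' t => ∃ D', Purge P Vout D D' ∧ State P D' s' ∧
        t + 1000 * (N * D'.card) ≤ 1000 * (N * D.card) + 310 * N := by
  rw [purgeCmd, wp_seq, wp_set]
  refine (wp_purgeLoop (s := s.setReg .found 1) (hs.congr (by simp [Store.setReg])
    (fun _ _ => rfl)) hD hv (by simp [Store.setReg]) hm hn hN).mono ?_
  rintro s' t ⟨D', hp, hs', ht⟩
  refine ⟨D', hp, hs', ?_⟩
  simp only [Exp.cost]
  omega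

end

section
variable {m n : ℕ} {P : Market m n} {D E Vin Vout : Finset (Fin m × Fin n)} {s s' : Store} {N : ℕ}

/-! ## The remaining steps on the machine -/

/-- The counter equals the number of non-empty rows below the loop index; a row is empty exactly if
its best entry is the sentinel `n`. -/
theorem wp_countRows {x : Reg} (hx : x ∉ [Reg.w, .m, .n]) (hs : State P D s)
    (hD : D ⊆ P.vertices) (hm : m ≤ N) (hN : 1 ≤ N) :
    WP (countRows x) s fun s' t => t ≤ 100 * N ∧ s'.reg x = rows D := by
  simp only [List.mem_cons, List.not_mem_nil, or_false, not_or] at hx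
  obtain ⟨hxw, hxm, hxn⟩ := hx
  rw [countRows, wp_seq, wp_set]
  refine (wp_forUpTo (e := .reg .m) (N := m)
    (fun i s' => s'.reg x = ((D.image Prod.fst).filter fun w => w.val < i).card) 30
    ?_ ?_ ?_ ?_).mono ?_
  · cases x <;> first | rfl | exact absurd rfl hxw
  · intro s' hf
    refine (hf.reg .m ?_).trans ?_
    · cases x <;> first | rfl | exact absurd rfl hxm
    · simp [Store.setReg, Ne.symm hxm, hs.reg_m]
  · simp [Store.setReg, hxw, Exp.eval]
  · intro i hi s' hf hr hI
    have hb : s'.arr .bestW i = bestRow P D ⟨i, hi⟩ := by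
      rw [hf.arr .bestW (by cases x <;> rfl)]
      exact hs.bestW ⟨i, hi⟩
    have hrn : s'.reg .n = n := by
      refine (hf.reg .n ?_).trans ?_
      · cases x <;> first | rfl | exact absurd rfl hxn
      · simp [Store.setReg, Ne.symm hxn, hs.reg_n]
    rcases bestRow_cases hD ⟨i, hi⟩ with ⟨hbn, hemp⟩ | ⟨f, hbf, hf'⟩
    · rw [hbn] at hb
      have : ((D.image Prod.fst).filter fun w => w.val < i + 1) =
          (D.image Prod.fst).filter fun w => w.val < i := by
        refine Finset.filter_congr fun w hw => ?_
        obtain ⟨v, hv, rfl⟩ := Finset.mem_image.1 hw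
        have : v.1.val ≠ i := fun h => hemp v.2 ((Prod.ext (Fin.ext h.symm) rfl :
          ((⟨i, hi⟩ : Fin m), v.2) = v) ▸ hv)
        omega
      rw [this]
      simp [wp_unless, Exp.eval, Exp.cost, hr, hb, hrn, Store.setReg, hxw, hI]
    · rw [hbf] at hb
      have : ((D.image Prod.fst).filter fun w => w.val < i + 1) =
          insert ⟨i, hi⟩ ((D.image Prod.fst).filter fun w => w.val < i) := by
        ext w
        simp only [Finset.mem_filter, Finset.mem_insert, Nat.lt_succ_iff_lt_or_eq]
        constructor
        · rintro ⟨h, h' | h'⟩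
          · exact .inr ⟨h, h'⟩
          · exact .inl (Fin.ext h')
        · rintro (rfl | ⟨h, h'⟩)
          · exact ⟨Finset.mem_image.2 ⟨_, topW_subset hf', rfl⟩, .inr rfl⟩
          · exact ⟨h, .inl h'⟩
      rw [this, Finset.card_insert_of_notMem (by simp)]
      simp [wp_unless, wp_set, Exp.eval, Exp.cost, hr, hb, hrn, Store.setReg, hxw, hI, f.isLt.ne]
  · rintro s' t ⟨ht, -, hI⟩
    have := linear_time (c := 7) (d := 39) hm hN
    simp only [Exp.cost] at ht ⊢
    refine ⟨by omega, hI.trans ?_⟩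
    rw [rows, Finset.filter_true_of_mem fun w _ => w.isLt]

theorem wp_checkIn (hs : Static P s) (hD : Holds (s.arr .D) D) (hV : Holds (s.arr .vin) Vin)
    (hm : m ≤ N) (hn : n ≤ N) (hN : 1 ≤ N) :
    WP checkIn s fun s' t => t ≤ 200 * (N * N) ∧
      ((s'.reg .ok = 1 ∧ Vin ⊆ D) ∨ (s'.reg .ok = 0 ∧ ¬ Vin ⊆ D)) := by
  rw [checkIn, wp_seq, wp_set]
  refine (wp_forUpTo (e := .reg .m) (N := m) (fun i s' =>
    (s'.reg .ok = 1 ∧ ∀ v ∈ Vin, v.1 < i → v ∈ D) ∨ (s'.reg .ok = 0 ∧ ¬ Vin ⊆ D)) (100 * N)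
    rfl ?_ ?_ ?_).mono ?_
  · exact fun s' hf => (hf.reg .m rfl).trans hs.reg_m
  · exact .inl ⟨by simp [Store.setReg, Exp.eval], by simp⟩
  · intro i hi s₁ hf₁ hr₁ hI₁
    have hm₁ : s₁.reg .m = m := (hf₁.reg .m rfl).trans hs.reg_m
    have hn₁ : s₁.reg .n = n := (hf₁.reg .n rfl).trans hs.reg_n
    refine (wp_forUpTo (e := .reg .n) (N := n) (fun j s' =>
      (s'.reg .ok = 1 ∧ ∀ v ∈ Vin, v.1 < i ∨ (v.1 = i ∧ v.2 < j) → v ∈ D) ∨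
        (s'.reg .ok = 0 ∧ ¬ Vin ⊆ D)) 50 rfl (fun s' hf => (hf.reg .n rfl).trans hn₁) ?_ ?_).mono ?_
    · simpa [Store.setReg] using hI₁
    · intro j hj s₂ hf₂ hr₂ hI₂
      have hr₂' : s₂.reg .w = i := (hf₂.reg .w rfl).trans hr₁
      have hn₂ : s₂.reg .n = n := (hf₂.reg .n rfl).trans hn₁
      have h1 : s₂.arr .vin (i * n + j) = if (⟨i, hi⟩, ⟨j, hj⟩) ∈ Vin then 1 else 0 := by
        rw [hf₂.arr .vin rfl, hf₁.arr .vin rfl]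
        exact hV ⟨i, hi⟩ ⟨j, hj⟩
      have h2 : s₂.arr .D (i * n + j) = if (⟨i, hi⟩, ⟨j, hj⟩) ∈ D then 1 else 0 := by
        rw [hf₂.arr .D rfl, hf₁.arr .D rfl]
        exact hD ⟨i, hi⟩ ⟨j, hj⟩
      -- The pairs are visited in lexicographic order, so one round of the inner loop adds exactly
      -- one pair.
      have key : ∀ v : Fin m × Fin n, (v.1 < i ∨ v.1 = i ∧ v.2 < j + 1) →
          (v.1 < i ∨ v.1 = i ∧ v.2 < j) ∨ v = (⟨i, hi⟩, ⟨j, hj⟩) := by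
        rintro v (h | ⟨h, h'⟩)
        · exact .inl (.inl h)
        · rcases Nat.lt_succ_iff_lt_or_eq.1 h' with h' | h'
          · exact .inl (.inr ⟨h, h'⟩)
          · exact .inr (Prod.ext (Fin.ext h) (Fin.ext h'))
      by_cases hvin : (⟨i, hi⟩, ⟨j, hj⟩) ∈ Vin
      · rw [if_pos hvin] at h1
        by_cases hvD : (⟨i, hi⟩, ⟨j, hj⟩) ∈ D
        · rw [if_pos hvD] at h2
          simp only [wp_when, wp_unless, cell, Exp.eval, Exp.cost, hr₂, hr₂', hn₂, h1, h2,
            one_ne_zero, if_false, Store.setReg, Function.update_of_ne, ne_eq, reduceCtorEq,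
            not_false_eq_true]
          refine ⟨by omega, hI₂.imp_left fun h => ⟨h.1, fun v hv hlt => ?_⟩⟩
          rcases key v hlt with h' | rfl
          · exact h.2 v hv h'
          · exact hvD
        · rw [if_neg hvD] at h2
          simp only [wp_when, wp_unless, wp_set, cell, Exp.eval, Exp.cost, hr₂, hr₂', hn₂, h1, h2,
            one_ne_zero, if_false, if_true, Store.setReg, Function.update_of_ne, ne_eq,
            reduceCtorEq, not_false_eq_true, Function.update_self]
          exact ⟨by omega, .inr ⟨trivial, fun h => hvD (h hvin)⟩⟩
      · rw [if_neg hvin] at h1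
        simp only [wp_when, wp_unless, cell, Exp.eval, Exp.cost, hr₂, hr₂', hn₂, h1,
          if_true, Store.setReg, Function.update_of_ne, ne_eq, reduceCtorEq, not_false_eq_true]
        refine ⟨by omega, hI₂.imp_left fun h => ⟨h.1, fun v hv hlt => ?_⟩⟩
        rcases key v hlt with h' | rfl
        · exact h.2 v hv h'
        · exact absurd hv hvin
    · rintro s' t ⟨ht, -, hI⟩
      constructor
      · have := linear_time (c := 7) (d := 59) hn hN
        simp only [Exp.cost] at ht
        omega
      · refine hI.imp_left fun h => ⟨by simpa [Store.setReg] using h.1, fun v hv hlt => ?_⟩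
        refine h.2 v hv ?_
        have := v.2.isLt
        omega
  · rintro s' t ⟨ht, -, hI⟩
    constructor
    · have := quadratic_time (c := 7) (d := 9) (a := 100) hm hN
      have := Nat.mul_le_mul hN hN
      simp only [Exp.cost, Nat.reduceAdd] at ht ⊢
      omega
    · exact hI.imp_left fun h => ⟨h.1, fun v hv => h.2 v hv v.1.isLt⟩

/-! ### Forbidding the rows and columns of prescribed pairs. -/

theorem forbid_empty : forbid ∅ Vout = Vout := by simp [forbid]

/-- The vertices other than `v` of the row of `v` whose firm comes before `i`. -/
def rowPart (v : Fin m × Fin n) (i : ℕ) : Finset (Fin m × Fin n) :=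
  Finset.univ.filter fun u => u.1 = v.1 ∧ u.2 ≠ v.2 ∧ u.2.val < i

/-- The vertices other than `v` of the column of `v` whose worker comes before `i`. -/
def colPart (v : Fin m × Fin n) (i : ℕ) : Finset (Fin m × Fin n) :=
  Finset.univ.filter fun u => u.2 = v.2 ∧ u.1 ≠ v.1 ∧ u.1.val < i

/-- Each prescribed pair contributes the rest of its row and of its column independently of the
others, so the set can be built up while scanning `Vin`. -/
theorem forbid_insert (v : Fin m × Fin n) :
    forbid (insert v Vin) Vout = forbid Vin Vout ∪ rowPart v n ∪ colPart v m := by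
  ext u
  simp only [forbid, rowPart, colPart, Finset.mem_union, Finset.mem_filter, Finset.mem_univ,
    true_and, Finset.mem_insert, Fin.is_lt, and_true, exists_eq_or_imp]
  have : (u ≠ v ∧ (u.1 = v.1 ∨ u.2 = v.2)) ↔ (u.1 = v.1 ∧ u.2 ≠ v.2) ∨ (u.2 = v.2 ∧ u.1 ≠ v.1) := by
    rw [ne_eq, Prod.ext_iff]
    tauto
  rw [this]
  clear this
  generalize (∃ a ∈ Vin, u ≠ a ∧ (u.1 = a.1 ∨ u.2 = a.2)) = p
  tauto

theorem rowPart_succ (v : Fin m × Fin n) {i : ℕ} (hi : i < n) :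
    rowPart v (i + 1) = if i = v.2.val then rowPart v i else insert (v.1, ⟨i, hi⟩) (rowPart v i) := by
  ext u
  split_ifs with h <;>
    simp only [rowPart, Finset.mem_filter, Finset.mem_univ, true_and, Finset.mem_insert,
      Prod.ext_iff, Fin.ext_iff, ne_eq, Nat.lt_succ_iff_lt_or_eq] <;> grind

theorem colPart_succ (v : Fin m × Fin n) {i : ℕ} (hi : i < m) :
    colPart v (i + 1) = if i = v.1.val then colPart v i else insert (⟨i, hi⟩, v.2) (colPart v i) := by
  ext u
  split_ifs with h <;>
    simp only [colPart, Finset.mem_filter, Finset.mem_univ, true_and, Finset.mem_insert,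
      Prod.ext_iff, Fin.ext_iff, ne_eq, Nat.lt_succ_iff_lt_or_eq] <;> grind

theorem rowPart_zero (v : Fin m × Fin n) : rowPart v 0 = ∅ := by simp [rowPart]

theorem colPart_zero (v : Fin m × Fin n) : colPart v 0 = ∅ := by simp [colPart]

/-- Forbid the other vertices of the row and of the column of `(w, f)`. -/
def forbidAt : Cmd :=
  forUpTo .i (.reg .n)
    (unless' (.eq (.reg .i) (.reg .f)) (.put .vout (cell (.reg .w) (.reg .i)) (.lit 1))) ;;
  forUpTo .i (.reg .m)
    (unless' (.eq (.reg .i) (.reg .w)) (.put .vout (cell (.reg .i) (.reg .f)) (.lit 1)))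

theorem wp_forbidAt (hs : Static P s) (hV : Holds (s.arr .vout) Vout) {v : Fin m × Fin n}
    (hw : s.reg .w = v.1) (hf : s.reg .f = v.2) (hm : m ≤ N) (hn : n ≤ N) (hN : 1 ≤ N) :
    WP forbidAt s fun s' t => t ≤ 200 * N ∧
      Holds (s'.arr .vout) (Vout ∪ rowPart v n ∪ colPart v m) := by
  rw [forbidAt, wp_seq]
  refine (wp_forUpTo (e := .reg .n) (N := n) (fun i s' => Holds (s'.arr .vout) (Vout ∪ rowPart v i))
    50 rfl (fun s' hf => (hs.frame hf rfl).reg_n) ?_ ?_).frame.mono ?_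
  · simpa [Store.setReg, rowPart_zero] using hV
  · intro i hi s' hf' hr hI
    have hw' : s'.reg .w = v.1 := (hf'.reg .w rfl).trans hw
    have hf'' : s'.reg .f = v.2 := (hf'.reg .f rfl).trans hf
    have hn' := (hs.frame hf' rfl).reg_n
    rw [rowPart_succ v hi]
    by_cases e : i = v.2.val
    · rw [if_pos e]
      simp only [wp_unless, Exp.eval, Exp.cost, hr, hf'', if_pos e, one_ne_zero, if_false,
        Store.setReg]
      exact ⟨by omega, hI⟩
    · rw [if_neg e, Finset.union_insert]
      simp only [wp_unless, wp_put, cell, Exp.eval, Exp.cost, hr, hf'', hw', hn', if_neg e,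
        if_true, Store.setReg, Store.setArr, Function.update_self]
      exact ⟨by omega, hI.insert (v.1, ⟨i, hi⟩)⟩
  rintro s₁ t₁ ⟨hf₁, ht₁, -, hI₁⟩
  have hs₁ := hs.frame hf₁ rfl
  refine (wp_forUpTo (e := .reg .m) (N := m)
    (fun i s' => Holds (s'.arr .vout) (Vout ∪ rowPart v n ∪ colPart v i))
    50 rfl (fun s' hf => (hs₁.frame hf rfl).reg_m) ?_ ?_).mono ?_
  · simpa [Store.setReg, colPart_zero] using hI₁
  · intro i hi s' hf' hr hI
    have hw' : s'.reg .w = v.1 := (hf'.reg .w rfl).trans ((hf₁.reg .w rfl).trans hw)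
    have hf'' : s'.reg .f = v.2 := (hf'.reg .f rfl).trans ((hf₁.reg .f rfl).trans hf)
    have hn' := (hs₁.frame hf' rfl).reg_n
    rw [colPart_succ v hi]
    by_cases e : i = v.1.val
    · rw [if_pos e]
      simp only [wp_unless, Exp.eval, Exp.cost, hr, hw', if_pos e, one_ne_zero, if_false,
        Store.setReg]
      exact ⟨by omega, hI⟩
    · rw [if_neg e, Finset.union_insert]
      simp only [wp_unless, wp_put, cell, Exp.eval, Exp.cost, hr, hf'', hw', hn', if_neg e,
        if_true, Store.setReg, Store.setArr, Function.update_self]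
      exact ⟨by omega, hI.insert (⟨i, hi⟩, v.2)⟩
  · rintro s' t ⟨ht, -, hI⟩
    refine ⟨?_, hI⟩
    have := linear_time (c := 7) (d := 59) hm hN
    have := linear_time (c := 7) (d := 59) hn hN
    simp only [Exp.cost] at ht ht₁
    omega

/-- Turns a sum of loop costs weighted by the flags of a set into a multiple of its cardinality. -/
theorem Holds.sum_eq_card {a : ℕ → ℕ} (h : Holds a D) :
    ∑ i ∈ Finset.range m, ∑ j ∈ Finset.range n, a (i * n + j) = D.card := by
  simp only [Finset.sum_range]
  rw [← Fintype.sum_prod_type' (f := fun (i : Fin m) (j : Fin n) => a (i * n + j))]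
  simp only [h _ _, Prod.mk.eta, Finset.sum_ite_mem, Finset.univ_inter, Finset.sum_const, smul_eq_mul, mul_one]

/-- Only cells of `Vin` trigger linear work. A uniform bound per cell would give O(N^3) for a single
call, and O(N^4) along a path of first branches; hence the round bounds that depend on the flag. -/
theorem wp_forbidCmd (hs : Static P s) (hI : Holds (s.arr .vin) Vin)
    (hO : Holds (s.arr .vout) Vout) (hm : m ≤ N) (hn : n ≤ N) (hN : 1 ≤ N) :
    WP forbidCmd s fun s' t => t ≤ 100 * (N * N) + 200 * (N * Vin.card) ∧
      Holds (s'.arr .vout) (forbid Vin Vout) := by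
  rw [forbidCmd]
  refine (wp_forUpTo_sum (e := .reg .m) (N := m) (fun i s' =>
      Holds (s'.arr .vout) (forbid (Vin.filter fun v => v.1 < i) Vout))
    (fun i => 50 * N + (∑ j ∈ Finset.range n, s.arr .vin (i * n + j)) * (200 * N)) rfl
    (fun s' hf => (hf.reg .m rfl).trans hs.reg_m) ?_ ?_).mono ?_
  · simpa [Store.setReg, forbid_empty] using hO
  · intro i hi s₁ hf₁ hr₁ hI₁
    have hs₁ := hs.frame hf₁ rfl
    refine (wp_forUpTo_sum (e := .reg .n) (N := n) (fun j s' =>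
      Holds (s'.arr .vout) (forbid (Vin.filter fun v => v.1 < i ∨ (v.1 = i ∧ v.2 < j)) Vout))
      (fun j => 20 + s.arr .vin (i * n + j) * (200 * N)) rfl
      (fun s' hf => (hf.reg .n rfl).trans hs₁.reg_n) ?_ ?_).mono ?_
    · simpa [Store.setReg] using hI₁
    · intro j hj s₂ hf₂ hr₂ hI₂
      have hs₂ := hs₁.frame hf₂ rfl
      have hr₂' : s₂.reg .w = i := (hf₂.reg .w rfl).trans hr₁
      have h1 : s.arr .vin (i * n + j) = if (⟨i, hi⟩, ⟨j, hj⟩) ∈ Vin then 1 else 0 :=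
        hI ⟨i, hi⟩ ⟨j, hj⟩
      have h2 : s₂.arr .vin (i * n + j) = s.arr .vin (i * n + j) := by
        rw [hf₂.arr .vin rfl, hf₁.arr .vin rfl]
      have hn₂ := hs₂.reg_n
      rw [wp_when]
      by_cases hv : (⟨i, hi⟩, ⟨j, hj⟩) ∈ Vin
      · have key : (Vin.filter fun v => v.1 < i ∨ (v.1 = i ∧ v.2 < j + 1)) =
            insert (⟨i, hi⟩, ⟨j, hj⟩) (Vin.filter fun v => v.1 < i ∨ (v.1 = i ∧ v.2 < j)) := by
          ext u
          simp only [Finset.mem_filter, Finset.mem_insert, Prod.ext_iff, Fin.ext_iff,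
            Nat.lt_succ_iff_lt_or_eq]
          constructor
          · tauto
          · rintro (⟨e1, e2⟩ | h)
            · have : u = (⟨i, hi⟩, ⟨j, hj⟩) := Prod.ext (Fin.ext e1) (Fin.ext e2)
              exact ⟨this ▸ hv, .inr ⟨e1, .inr e2⟩⟩
            · tauto
        rw [if_pos hv] at h1
        rw [if_neg (by simp [cell, Exp.eval, hr₂, hr₂', hn₂, h2, h1])]
        refine (wp_forbidAt hs₂ hI₂ (v := (⟨i, hi⟩, ⟨j, hj⟩)) hr₂' hr₂ hm hn hN).mono ?_
        rintro s₃ t₃ ⟨ht₃, h₃⟩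
        rw [← forbid_insert, ← key] at h₃
        refine ⟨?_, h₃⟩
        simp only [Exp.cost, cell, h1]
        omega
      · have key : (Vin.filter fun v => v.1 < i ∨ (v.1 = i ∧ v.2 < j + 1)) =
            Vin.filter fun v => v.1 < i ∨ (v.1 = i ∧ v.2 < j) := by
          refine Finset.filter_congr fun u hu => ?_
          have : ¬ (u.1.val = i ∧ u.2.val = j) := fun h =>
            hv ((Prod.ext (Fin.ext h.1) (Fin.ext h.2) : u = (⟨i, hi⟩, ⟨j, hj⟩)) ▸ hu)
          omega
        rw [if_neg hv] at h1
        rw [if_pos (by simp [cell, Exp.eval, hr₂, hr₂', hn₂, h2, h1]), key]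
        refine ⟨?_, hI₂⟩
        simp only [Exp.cost, cell]
        omega
    · rintro s' t ⟨ht, -, hI'⟩
      constructor
      · have := linear_time (c := 7) (d := 29) hn hN
        simp only [Exp.cost, Finset.sum_add_distrib, Finset.sum_const, Finset.card_range,
          smul_eq_mul, ← Finset.sum_mul] at ht
        omega
      · have key : (Vin.filter fun v => v.1 < i + 1) =
            Vin.filter fun v => v.1 < i ∨ (v.1 = i ∧ v.2 < n) := by
          refine Finset.filter_congr fun u hu => ?_
          have := u.2.isLt
          omega
        rw [key]
        exact hI'
  · rintro s' t ⟨ht, -, hI'⟩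
    rw [Finset.filter_true_of_mem fun w _ => w.1.isLt] at hI'
    refine ⟨?_, hI'⟩
    rw [Finset.sum_add_distrib, Finset.sum_const, Finset.card_range, smul_eq_mul,
      ← Finset.sum_mul, hI.sum_eq_card] at ht
    have h1 := quadratic_time (c := 7) (d := 9) (a := 50) hm hN
    simp only [Exp.cost, Nat.reduceAdd] at ht
    have h2 : Vin.card * (200 * N) = 200 * (N * Vin.card) := by ring
    rw [mul_add] at h1
    omega

theorem wp_findPivot (hs : State P D s) (hD : D ⊆ P.vertices) (hm : m ≤ N) (hN : 1 ≤ N) :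
    WP findPivot s fun s' t => t ≤ 100 * N ∧
      ((s'.reg .found = 1 ∧ ∃ v ∈ topW P D \ topF P D, s'.reg .pw = v.1 ∧ s'.reg .pf = v.2) ∨
        (s'.reg .found = 0 ∧ topW P D ⊆ topF P D)) := by
  rw [findPivot, wp_seq, wp_set]
  refine (wp_forUpTo (e := .reg .m) (N := m) (fun i s' =>
    (s'.reg .found = 1 ∧ ∃ v ∈ topW P D \ topF P D, s'.reg .pw = v.1 ∧ s'.reg .pf = v.2) ∨
      (s'.reg .found = 0 ∧ ∀ v ∈ topW P D, v.1 < i → v ∈ topF P D)) 50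
    rfl ?_ ?_ ?_).mono ?_
  · exact fun s' hf => (hf.reg .m rfl).trans hs.reg_m
  · right
    simp [Store.setReg, Exp.eval]
  · intro i hi s' hf hr hI
    have hs₀ : State P D (s.setReg .found 0) := hs.congr (by simp [Store.setReg]) (fun _ _ => rfl)
    have hs' : State P D s' := hs₀.frame hf rfl
    have hb := hs'.bestW ⟨i, hi⟩
    have hrn := hs'.reg_n
    rcases bestRow_cases hD ⟨i, hi⟩ with ⟨hbn, hemp⟩ | ⟨f, hbf, hf'⟩
    · rw [hbn] at hb
      simp only [wp_seq, wp_set, wp_unless, Exp.eval, Exp.cost, Store.setReg, hr,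
        Function.update_self, ne_eq, reduceCtorEq, not_false_eq_true, Function.update_of_ne,
        hb, hrn, if_true, one_ne_zero, if_false]
      refine ⟨by omega, hI.imp_right fun h => ⟨h.1, fun v hv hvi => ?_⟩⟩
      rcases Nat.lt_succ_iff_lt_or_eq.1 hvi with h' | h'
      · exact h.2 v hv h'
      · have : (⟨i, hi⟩, v.2) = v := Prod.ext (Fin.ext h'.symm) rfl
        exact absurd (topW_subset hv) (this ▸ hemp v.2)
    · rw [hbf] at hb
      have hbc := hs'.bestF f
      -- The column of `f` contains the vertex of `topW` just found, so its best worker is not the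
      -- sentinel.
      obtain ⟨g, hg, hgF⟩ : ∃ g, bestCol P D f = g.val ∧ (g, f) ∈ topF P D := by
        rcases bestCol_cases hD f with h | h
        · exact absurd (topW_subset hf') (h.2 _)
        · exact h
      rw [hg] at hbc
      by_cases e : g.val = i
      · simp only [wp_seq, wp_set, wp_unless, Exp.eval, Exp.cost, Store.setReg, hr,
          Function.update_self, ne_eq, reduceCtorEq, not_false_eq_true, Function.update_of_ne,
          hb, hrn, if_true, one_ne_zero, if_false, f.isLt.ne, hbc, e]
        refine ⟨by omega, hI.imp_right fun h => ⟨h.1, fun v hv hvi => ?_⟩⟩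
        rcases Nat.lt_succ_iff_lt_or_eq.1 hvi with h' | h'
        · exact h.2 v hv h'
        · obtain rfl := topW_row_injective hD hv hf' (Fin.ext h')
          have : (g, f) = (⟨i, hi⟩, f) := Prod.ext (Fin.ext e) rfl
          exact this ▸ hgF
      · simp only [wp_seq, wp_set, wp_unless, Exp.eval, Exp.cost, Store.setReg, hr,
          Function.update_self, ne_eq, reduceCtorEq, not_false_eq_true, Function.update_of_ne,
          hb, hrn, if_true, if_false, f.isLt.ne, hbc, e]
        refine ⟨by omega, .inl ⟨trivial, (⟨i, hi⟩, f), Finset.mem_sdiff.2 ⟨hf', fun h => ?_⟩,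
          rfl, rfl⟩⟩
        have := topF_col_injective hD h hgF rfl
        exact e (congrArg (fun v => v.1.val) this).symm
  · rintro s' t ⟨ht, -, hI⟩
    refine ⟨?_, hI.imp_right fun h => ⟨h.1, fun v hv => h.2 v hv v.1.isLt⟩⟩
    have := linear_time (c := 7) (d := 59) hm hN
    simp only [Exp.cost] at ht ⊢
    omega

/-! ## Saving and restoring -/

/-- The first `len` entries of `src` from address `o` on, copied into `dst` from address `d` on. -/
def blit (dst src : ℕ → ℕ) (d o len : ℕ) : ℕ → ℕ :=
  fun k => if d ≤ k ∧ k < d + len then src (o + (k - d)) else dst k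

theorem blit_zero (dst src : ℕ → ℕ) (d o : ℕ) : blit dst src d o 0 = dst := by
  funext k
  rw [blit, if_neg (by omega)]

theorem update_blit (dst src : ℕ → ℕ) (d o i : ℕ) :
    Function.update (blit dst src d o i) (d + i) (src (o + i)) = blit dst src d o (i + 1) := by
  funext k
  by_cases h : k = d + i
  · subst h
    rw [Function.update_self, blit, if_pos (by omega)]
    congr 2
    omega
  · rw [Function.update_of_ne h, blit, blit]
    refine if_congr ?_ rfl rfl
    omega

theorem blit_of_lt (dst src : ℕ → ℕ) {d k : ℕ} (o len : ℕ) (h : k < d) :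
    blit dst src d o len k = dst k := if_neg (by omega)

theorem blit_add (dst src : ℕ → ℕ) (d o : ℕ) {len k : ℕ} (h : k < len) :
    blit dst src d o len (d + k) = src (o + k) := by
  rw [blit, if_pos (by omega), Nat.add_sub_cancel_left]

theorem cell_lt (w : Fin m) (f : Fin n) : w.val * n + f.val < m * n :=
  calc w.val * n + f.val < w.val * n + n := by omega
    _ = (w.val + 1) * n := by ring
    _ ≤ m * n := Nat.mul_le_mul_right n w.isLt

theorem wp_saveAll (hs : Static P s) {l : ℕ} (hl : s.reg .lvl = l) (hm : m ≤ N) (hn : n ≤ N)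
    (hN : 1 ≤ N) :
    WP saveAll s fun s' t => t ≤ 200 * (N * N) ∧
      s'.arr .saveD = blit (s.arr .saveD) (s.arr .D) (l * (m * n)) 0 (m * n) ∧
      s'.arr .saveIn = blit (s.arr .saveIn) (s.arr .vin) (l * (m * n)) 0 (m * n) ∧
      s'.arr .saveOut = blit (s.arr .saveOut) (s.arr .vout) (l * (m * n)) 0 (m * n) ∧
      s'.arr .saveW = Function.update (s.arr .saveW) l (s.reg .pw) ∧
      s'.arr .saveF = Function.update (s.arr .saveF) l (s.reg .pf) := by
  rw [saveAll, wp_seq]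
  refine (wp_forUpTo (e := .mul (.reg .m) (.reg .n)) (N := m * n) (fun i s' =>
      s'.arr .saveD = blit (s.arr .saveD) (s.arr .D) (l * (m * n)) 0 i ∧
      s'.arr .saveIn = blit (s.arr .saveIn) (s.arr .vin) (l * (m * n)) 0 i ∧
      s'.arr .saveOut = blit (s.arr .saveOut) (s.arr .vout) (l * (m * n)) 0 i) 60
    rfl (fun s' hf => ?_) ?_ ?_).frame.mono ?_
  · have hs' := hs.frame hf rfl
    simp [Exp.eval, hs'.reg_m, hs'.reg_n]
  · simp [Store.setReg, blit_zero]
  · rintro i hi s' hf hr ⟨h1, h2, h3⟩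
    have hs' := hs.frame hf rfl
    have hl' : s'.reg .lvl = l := (hf.reg .lvl rfl).trans hl
    have e1 := hf.arr .D rfl
    have e2 := hf.arr .vin rfl
    have e3 := hf.arr .vout rfl
    simp only [wp_seq, wp_put, saved, Exp.eval, Exp.cost, Store.setReg, Store.setArr, hr, hl',
      hs'.reg_m, hs'.reg_n, Function.update_self, Function.update_of_ne, ne_eq, reduceCtorEq,
      not_false_eq_true, h1, h2, h3, e1, e2, e3]
    refine ⟨by omega, ?_, ?_, ?_⟩ <;> rw [← update_blit, zero_add]
  · rintro s₁ t₁ ⟨hf₁, ht₁, -, h1, h2, h3⟩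
    simp only [wp_seq, wp_put, Exp.eval, Exp.cost, Store.setArr, Function.update_self,
      Function.update_of_ne, ne_eq, reduceCtorEq, not_false_eq_true, hf₁.reg .lvl rfl,
      hf₁.reg .pw rfl, hf₁.reg .pf rfl, hf₁.arr .saveW rfl, hf₁.arr .saveF rfl, hl, h1, h2, h3,
      and_self, and_true]
    have h4 := Nat.mul_le_mul hm hn
    have h5 := Nat.mul_le_mul hN hN
    simp only [Exp.cost] at ht₁
    omega

/-- Only the three matrices and the pivot are saved; the best and worst partners are recomputed from
the restored digraph, within the same O(N^2). -/
theorem wp_restoreAll (hs : Static P s) {l : ℕ} (hl : s.reg .lvl = l)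
    (hD : Holds (fun k => s.arr .saveD (l * (m * n) + k)) D)
    (hI : Holds (fun k => s.arr .saveIn (l * (m * n) + k)) Vin)
    (hO : Holds (fun k => s.arr .saveOut (l * (m * n) + k)) Vout) (hm : m ≤ N) (hn : n ≤ N)
    (hN : 1 ≤ N) :
    WP restoreAll s fun s' t => t ≤ 500 * (N * N) ∧ State P D s' ∧ Holds (s'.arr .vin) Vin ∧
      Holds (s'.arr .vout) Vout ∧ s'.reg .pw = s.arr .saveW l ∧ s'.reg .pf = s.arr .saveF l := by
  rw [restoreAll, wp_seq]
  refine (wp_forUpTo (e := .mul (.reg .m) (.reg .n)) (N := m * n) (fun i s' =>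
      s'.arr .D = blit (s.arr .D) (s.arr .saveD) 0 (l * (m * n)) i ∧
      s'.arr .vin = blit (s.arr .vin) (s.arr .saveIn) 0 (l * (m * n)) i ∧
      s'.arr .vout = blit (s.arr .vout) (s.arr .saveOut) 0 (l * (m * n)) i) 60
    rfl (fun s' hf => ?_) ?_ ?_).frame.mono ?_
  · have hs' := hs.frame hf rfl
    simp [Exp.eval, hs'.reg_m, hs'.reg_n]
  · simp [Store.setReg, blit_zero]
  · rintro i hi s' hf hr ⟨h1, h2, h3⟩
    have hs' := hs.frame hf rfl
    have hl' : s'.reg .lvl = l := (hf.reg .lvl rfl).trans hl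
    have e1 := hf.arr .saveD rfl
    have e2 := hf.arr .saveIn rfl
    have e3 := hf.arr .saveOut rfl
    simp only [wp_seq, wp_put, saved, Exp.eval, Exp.cost, Store.setReg, Store.setArr, hr, hl',
      hs'.reg_m, hs'.reg_n, Function.update_self, Function.update_of_ne, ne_eq, reduceCtorEq,
      not_false_eq_true, h1, h2, h3, e1, e2, e3]
    refine ⟨by omega, ?_, ?_, ?_⟩ <;> rw [← update_blit, zero_add]
  · rintro s₁ t₁ ⟨hf₁, ht₁, -, h1, h2, h3⟩
    have hs₁ := hs.frame hf₁ rfl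
    have holds : ∀ {a b c : ℕ → ℕ} {V : Finset (Fin m × Fin n)},
        a = blit b c 0 (l * (m * n)) (m * n) → Holds (fun k => c (l * (m * n) + k)) V →
        Holds a V := by
      rintro a b c V rfl h w f
      have := blit_add b c 0 (l * (m * n)) (cell_lt w f)
      rw [zero_add] at this
      rw [this]
      exact h w f
    simp only [wp_seq, wp_set, Exp.eval, Exp.cost]
    refine (wp_refreshAll (s := (s₁.setReg .pw (s₁.arr .saveW (s₁.reg .lvl))).setReg .pf
      (s₁.arr .saveF (s₁.reg .lvl))) (hs₁.congr (by simp [Store.setReg]) (fun _ _ => rfl))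
      (holds h1 hD) hm hn hN).frame.mono ?_
    rintro s₂ t₂ ⟨hf₂, ht₂, hs₂⟩
    refine ⟨?_, hs₂, ?_, ?_, ?_, ?_⟩
    · have h4 := Nat.mul_le_mul hm hn
      have h5 := Nat.mul_le_mul hN hN
      simp only [Exp.cost] at ht₁
      omega
    · rw [hf₂.arr .vin rfl]
      exact holds h2 hI
    · rw [hf₂.arr .vout rfl]
      exact holds h3 hO
    · rw [hf₂.reg .pw rfl]
      simp [Store.setReg, hf₁.reg .lvl rfl, hf₁.arr .saveW rfl, hl]
    · rw [hf₂.reg .pf rfl]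
      simp [Store.setReg, hf₁.reg .lvl rfl, hf₁.arr .saveF rfl, hl]

/-- The sentinel for an empty row is the value by which a record marks an unmatched worker, so the
array of best firms can be printed as it is. -/
theorem map_bestW_eq_record (hs : State P D s) (hD : D ⊆ P.vertices) :
    (List.range m).map (s.arr .bestW) = record (topW P D) := by
  rw [record, List.ofFn_eq_map, ← List.map_coe_finRange_eq_range, List.map_map]
  refine List.map_congr_left fun w _ => ?_
  rw [Function.comp, hs.bestW w]
  rcases bestRow_cases hD w with ⟨h, h'⟩ | ⟨f, h, h'⟩
  · rw [h, List.find?_eq_none.2 fun f _ => by simpa using fun hf => h' f (topW_subset hf)]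
  · rw [h]
    cases hfind : (List.finRange n).find? fun f => decide ((w, f) ∈ topW P D) with
    | none => simpa [h'] using List.find?_eq_none.1 hfind f (List.mem_finRange f)
    | some g =>
      have hg := List.find?_some hfind
      simp only [decide_eq_true_eq] at hg
      have e : f = g := congrArg Prod.snd (topW_row_injective hD h' hg rfl)
      rw [e]

end

section
variable {m n : ℕ} {P : Market m n} {D E Vin Vout D' : Finset (Fin m × Fin n)} {s s' s'' : Store}
  {N r l : ℕ}

/-! ## The recursive procedure -/

/-- Code that calls or prints lies outside `Big`; these rules follow it on the machine itself and
keep the clock in the form of the starting time plus a cost. -/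
theorem Run.seq {body c d : Cmd} {K : List Cmd} {t₀ t : ℕ} {o : List (ℕ × List ℕ)}
    (h : Big c s s' t) :
    Run body ⟨.seq c d :: K, s, t₀, o⟩ ⟨d :: K, s', t₀ + (1 + t), o⟩ := by
  rw [← add_assoc]
  exact (Run.single rfl).trans (h.run body (d :: K) (t₀ + 1) o)

theorem Run.ite_true {body c d : Cmd} {e : Exp} {K : List Cmd} {t₀ : ℕ}
    {o : List (ℕ × List ℕ)} (h : e.eval s ≠ 0) :
    Run body ⟨.ite e c d :: K, s, t₀, o⟩ ⟨c :: K, s, t₀ + (1 + e.cost), o⟩ :=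
  .single (by simp only [step, if_neg h])

theorem Run.ite_false {body c d : Cmd} {e : Exp} {K : List Cmd} {t₀ : ℕ}
    {o : List (ℕ × List ℕ)} (h : e.eval s = 0) :
    Run body ⟨.ite e c d :: K, s, t₀, o⟩ ⟨d :: K, s, t₀ + (1 + e.cost), o⟩ :=
  .single (by simp only [step, if_pos h])

theorem Run.skip {body : Cmd} {K : List Cmd} {t₀ : ℕ} {o : List (ℕ × List ℕ)} :
    Run body ⟨.skip :: K, s, t₀, o⟩ ⟨K, s, t₀ + 1, o⟩ := .single rfl

/-- What a call on level `l` leaves unchanged: the input, `r`, and the copies below level `l`. -/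
structure Kept (c l : ℕ) (s s' : Store) : Prop where
  reg : ∀ x ∈ [Reg.m, .n, .r], s'.reg x = s.reg x
  arr : ∀ a ∈ [Arr.prefW, .lenW, .prefF, .lenF], s'.arr a = s.arr a
  matrices : ∀ a ∈ [Arr.saveD, .saveIn, .saveOut], ∀ k < l * c, s'.arr a k = s.arr a k
  pivots : ∀ a ∈ [Arr.saveW, .saveF], ∀ k < l, s'.arr a k = s.arr a k

theorem Kept.trans {c : ℕ} (h : Kept c l s s') (h' : Kept c l s' s'') : Kept c l s s'' :=
  ⟨fun x hx => (h'.reg x hx).trans (h.reg x hx), fun a ha => (h'.arr a ha).trans (h.arr a ha),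
    fun a ha k hk => (h'.matrices a ha k hk).trans (h.matrices a ha k hk),
    fun a ha k hk => (h'.pivots a ha k hk).trans (h.pivots a ha k hk)⟩

theorem Kept.of_succ {c : ℕ} (h : Kept c (l + 1) s s') : Kept c l s s' :=
  ⟨h.reg, h.arr,
    fun a ha k hk => h.matrices a ha k (hk.trans_le (Nat.mul_le_mul_right c l.le_succ)),
    fun a ha k hk => h.pivots a ha k (hk.trans l.lt_succ_self)⟩

theorem Kept.of_eq {c : ℕ} (hr : ∀ x ∈ [Reg.m, .n, .r], s'.reg x = s.reg x)
    (ha : ∀ a ∈ [Arr.prefW, .lenW, .prefF, .lenF, .saveD, .saveIn, .saveOut, .saveW, .saveF],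
      s'.arr a = s.arr a) : Kept c l s s' :=
  ⟨hr, fun a h => ha a (by simp at h ⊢; tauto),
    fun a h _ _ => congrFun (ha a (by simp at h ⊢; tauto)) _,
    fun a h _ _ => congrFun (ha a (by simp at h ⊢; tauto)) _⟩

theorem Frame.kept {c : Cmd} {k : ℕ} (h : Frame c s s') (hc : c.avoids [.m, .n, .r]
    [.prefW, .lenW, .prefF, .lenF, .saveD, .saveIn, .saveOut, .saveW, .saveF] = true) :
    Kept k l s s' :=
  .of_eq (h.reg_of_avoids hc) (h.arr_of_avoids hc)

/-- The memory at a call of Algorithm 2 on `(D, Vin, Vout)` on level `l`. -/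
structure Node (P : Market m n) (r l : ℕ) (D Vin Vout : Finset (Fin m × Fin n)) (s : Store) :
    Prop where
  state : State P D s
  vin : Holds (s.arr .vin) Vin
  vout : Holds (s.arr .vout) Vout
  reg_r : s.reg .r = r
  lvl : s.reg .lvl = l

/-- The part of a call that precedes output or branching: it either returns without output, as the
abstract algorithm may, or arrives at the final test having decided whether a pivot exists. In the
latter case the cost is charged to the lost vertices, to the pairs of `Vin`, and to a fixed O(N^2).
-/
theorem run_program2_steps (hs : Node P r l D Vin Vout s) (hD : D ⊆ P.vertices) (hm : m ≤ N)
    (hn : n ≤ N) (hN : 1 ≤ N) (K : List Cmd) (t₀ : ℕ) (o : List (ℕ × List ℕ)) :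
    (∃ s' t, Run program2 ⟨program2 :: K, s, t₀, o⟩ ⟨K, s', t₀ + t, o⟩ ∧
      Algorithm2 P r D Vin Vout [] ∧
      t ≤ 1000 * (N * D.card) + 2000 * (N * N) + 200 * (N * Vin.card)) ∨
    ∃ D' s' t, Run program2 ⟨program2 :: K, s, t₀, o⟩
        ⟨.ite (.reg .found) branchCmd (.print .bestW (.reg .m)) :: K, s', t₀ + t, o⟩ ∧
      Reaches5 P r D Vin Vout D' ∧ Node P r l D' Vin (forbid Vin Vout) s' ∧
      Kept (m * n) l s s' ∧
      t + 1000 * (N * D'.card) ≤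
        1000 * (N * D.card) + 2000 * (N * N) + 200 * (N * Vin.card) ∧
      ((s'.reg .found = 1 ∧ ∃ v ∈ topW P D' \ topF P D', s'.reg .pw = v.1 ∧ s'.reg .pf = v.2) ∨
        (s'.reg .found = 0 ∧ topW P D' ⊆ topF P D')) := by
  have hNN := Nat.mul_le_mul hN hN
  have hN2 := Nat.mul_le_mul_left N hN
  obtain ⟨hst, hvin, hvout, hr, hl⟩ := hs
  rw [program2]
  obtain ⟨s₁, t₁, b₁, ht₁, h₁⟩ := wp_checkIn hst.toStatic hst.holds hvin hm hn hN
  have hf₁ := b₁.frame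
  have st₁ := hst.frame hf₁ rfl
  have vin₁ : Holds (s₁.arr .vin) Vin := hf₁.arr .vin rfl ▸ hvin
  have vout₁ : Holds (s₁.arr .vout) Vout := hf₁.arr .vout rfl ▸ hvout
  rcases h₁ with ⟨hok, hin⟩ | ⟨hok, hin⟩
  swap
  · left
    refine ⟨s₁, 1 + t₁ + (1 + (Exp.reg .ok).cost) + 1, ?_, .return1 _ _ _ hin, ?_⟩
    · refine (Run.seq b₁).trans ((Run.ite_false (by simp [Exp.eval, hok])).trans ?_)
      convert Run.skip using 2
      omega
    · simp only [Exp.cost]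
      omega
  obtain ⟨s₂, t₂, b₂, ht₂, vout₂⟩ := wp_forbidCmd st₁.toStatic vin₁ vout₁ hm hn hN
  have hf₂ := b₂.frame
  have st₂ := st₁.frame hf₂ rfl
  have vin₂ : Holds (s₂.arr .vin) Vin := hf₂.arr .vin rfl ▸ vin₁
  obtain ⟨s₃, t₃, b₃, D', hp, st₃, ht₃⟩ := wp_purgeCmd st₂ hD vout₂ hm hn hN
  have hf₃ := b₃.frame
  have vin₃ : Holds (s₃.arr .vin) Vin := hf₃.arr .vin rfl ▸ vin₂
  have vout₃ : Holds (s₃.arr .vout) (forbid Vin Vout) := hf₃.arr .vout rfl ▸ vout₂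
  have hD' := hp.subset.trans hD
  obtain ⟨s₄, t₄, b₄, ht₄, hcnt⟩ := wp_countRows (x := .cnt) (by decide) st₃ hD' hm hN
  have hf₄ := b₄.frame
  have st₄ := st₃.frame hf₄ rfl
  have vin₄ : Holds (s₄.arr .vin) Vin := hf₄.arr .vin rfl ▸ vin₃
  have vout₄ : Holds (s₄.arr .vout) (forbid Vin Vout) := hf₄.arr .vout rfl ▸ vout₃
  obtain ⟨s₅, t₅, b₅, ht₅, h₅⟩ := wp_checkIn st₄.toStatic st₄.holds vin₄ hm hn hN
  have hf₅ := b₅.frame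
  have st₅ := st₄.frame hf₅ rfl
  have vin₅ : Holds (s₅.arr .vin) Vin := hf₅.arr .vin rfl ▸ vin₄
  have vout₅ : Holds (s₅.arr .vout) (forbid Vin Vout) := hf₅.arr .vout rfl ▸ vout₄
  have k₅ : Kept (m * n) l s s₅ := (hf₁.kept rfl).trans <| (hf₂.kept rfl).trans <|
    (hf₃.kept rfl).trans <| (hf₄.kept rfl).trans (hf₅.kept rfl)
  have hcnt₅ : s₅.reg .cnt = (topW P D').card := by
    rw [hf₅.reg .cnt rfl, hcnt, card_topW hD']
  have hr₅ : s₅.reg .r = r := (k₅.reg .r (by simp)).trans hr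
  have hl₅ : s₅.reg .lvl = l := by
    rw [hf₅.reg .lvl rfl, hf₄.reg .lvl rfl, hf₃.reg .lvl rfl, hf₂.reg .lvl rfl, hf₁.reg .lvl rfl, hl]
  have run₅ := ((Run.seq b₁).trans ((Run.ite_true (by simp [Exp.eval, hok])).trans
    ((Run.seq b₂).trans ((Run.seq b₃).trans ((Run.seq b₄).trans (Run.seq b₅)))))
    : Run program2 ⟨program2 :: K, s, t₀, o⟩ _)
  by_cases hlt : (topW P D').card < r
  · left
    refine ⟨s₅, 1 + t₁ + (1 + (Exp.reg .ok).cost) + (1 + t₂) + (1 + t₃) + (1 + t₄) + (1 + t₅) +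
      (1 + (Exp.lt (.reg .cnt) (.reg .r)).cost) + 1, run₅.trans
      ((Run.ite_true (by simp [Exp.eval, hcnt₅, hr₅, hlt])).trans ?_),
      .return4 _ _ _ D' hin hp (.inl hlt), ?_⟩
    · convert Run.skip using 2
      omega
    · simp only [Exp.cost]
      omega
  have run₆ := run₅.trans (Run.ite_false (by simp [Exp.eval, hcnt₅, hr₅, hlt]))
  rcases h₅ with ⟨hok', hin'⟩ | ⟨hok', hin'⟩
  swap
  · left
    refine ⟨s₅, 1 + t₁ + (1 + (Exp.reg .ok).cost) + (1 + t₂) + (1 + t₃) + (1 + t₄) + (1 + t₅) +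
      (1 + (Exp.lt (.reg .cnt) (.reg .r)).cost) + (1 + (Exp.reg .ok).cost) + 1, run₆.trans
      ((Run.ite_false (by simp [Exp.eval, hok'])).trans ?_),
      .return4 _ _ _ D' hin hp (.inr hin'), ?_⟩
    · convert Run.skip using 2
      omega
    · simp only [Exp.cost]
      omega
  right
  obtain ⟨s₆, t₆, b₆, ht₆, h₆⟩ := wp_findPivot st₅ hD' hm hN
  have hf₆ := b₆.frame
  refine ⟨D', s₆, 1 + t₁ + (1 + (Exp.reg .ok).cost) + (1 + t₂) + (1 + t₃) + (1 + t₄) + (1 + t₅) +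
      (1 + (Exp.lt (.reg .cnt) (.reg .r)).cost) + (1 + (Exp.reg .ok).cost) + (1 + t₆), run₆.trans
      ((Run.ite_true (by simp [Exp.eval, hok'])).trans ?_), ⟨hin, hp, not_lt.1 hlt, hin'⟩,
      ⟨st₅.frame hf₆ rfl, hf₆.arr .vin rfl ▸ vin₅, hf₆.arr .vout rfl ▸ vout₅,
        (hf₆.reg .r rfl).trans hr₅, (hf₆.reg .lvl rfl).trans hl₅⟩,
      k₅.trans (hf₆.kept rfl), ?_, h₆⟩
  · convert Run.seq b₆ using 2
    omega
  · simp only [Exp.cost]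
    omega

/-- The times of the records in `o` increase by at most `G` each, from `a` to `e`. -/
def Paced (G : ℕ) : ℕ → List (ℕ × List ℕ) → ℕ → Prop
  | a, [], e => e = a
  | a, p :: o, e => p.1 ≤ a + G ∧ Paced G p.1 o e

/-- The end of the first stretch is the time of its last record, so only the gap to the next record
`p` is left to check. -/
theorem Paced.append {G : ℕ} {o o' : List (ℕ × List ℕ)} {p : ℕ × List ℕ} {a b e : ℕ}
    (h : Paced G a o b) (hp : p.1 ≤ b + G) (h' : Paced G p.1 o' e) :
    Paced G a (o ++ p :: o') e := by
  induction o generalizing a with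
  | nil =>
    obtain rfl : b = a := h
    exact ⟨hp, h'⟩
  | cons q o ih => exact ⟨h.1, ih h.2⟩

theorem Paced.le {G : ℕ} {o : List (ℕ × List ℕ)} {a e : ℕ} (h : Paced G a o e) :
    e ≤ a + G * o.length := by
  induction o generalizing a with
  | nil => exact Eq.le h
  | cons q o ih =>
    have h1 := ih h.2
    have h2 := h.1
    rw [List.length_cons, mul_add, mul_one]
    omega

theorem Paced.isChain {G : ℕ} {o : List (ℕ × List ℕ)} {p : ℕ × List ℕ} {e : ℕ}
    (h : Paced G p.1 o e) : (p :: o).IsChain fun a b => b.1 ≤ a.1 + G := by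
  induction o generalizing p with
  | nil => exact .singleton _
  | cons q o ih => exact List.isChain_cons_cons.2 ⟨h.1, ih h.2⟩

theorem card_le_mul_self (hm : m ≤ N) (hn : n ≤ N) (D : Finset (Fin m × Fin n)) :
    D.card ≤ N * N := by
  refine (Finset.card_le_univ D).trans ?_
  rw [Fintype.card_prod, Fintype.card_fin, Fintype.card_fin]
  exact Nat.mul_le_mul hm hn

theorem rows_le (D : Finset (Fin m × Fin n)) : rows D ≤ m := by
  simpa [rows] using Finset.card_le_univ (D.image Prod.fst)

/-- A call on an instance with a solution prints all solutions, ends with the last of them, and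
meets the time bounds. -/
theorem run_program2 (hm : m ≤ N) (hn : n ≤ N) (hN : 1 ≤ N)
    (hr : r = rows (idua P P.vertices)) (hs : Node P r l D Vin Vout s) (hD : Sound P D)
    (h0 : D ⊆ idua P P.vertices) (hsol : ∃ M, Solves P D Vin Vout M)
    (K : List Cmd) (t₀ : ℕ) (o : List (ℕ × List ℕ)) :
    ∃ s' e L p o', Run program2 ⟨program2 :: K, s, t₀, o⟩ ⟨K, s', e, o ++ p :: o'⟩ ∧
      Kept (m * n) l s s' ∧ s'.reg .lvl = l ∧ Algorithm2 P r D Vin Vout L ∧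
      (p :: o').map Prod.snd = L.map record ∧
      p.1 + 3000 * (N * N * Vin.card) ≤
        t₀ + 3000 * (N * N) + 3000 * (N * N * N) + 1000 * (N * D.card) ∧
      Paced (8000 * (N * N * N)) p.1 o' e := by
  induction hk : Vinᶜ.card + Voutᶜ.card using Nat.strong_induction_on
    generalizing l D Vin Vout s K t₀ o with
  | _ k ih =>
    subst hk
    have hNN := Nat.mul_le_mul hN hN
    have hN2 := Nat.mul_le_mul_left N hN
    have hN3 := Nat.mul_le_mul_left (N * N) hN
    rcases run_program2_steps hs hD.subset hm hn hN K t₀ o with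
      ⟨_, _, -, hA, -⟩ | ⟨D', s₁, t₁, run₁, h5, hs₁, k₁, ht₁, hpiv⟩
    -- An empty output would contradict the correctness of the abstract algorithm, since a solution
    -- exists.
    · obtain ⟨M, hM⟩ := hsol
      exact absurd (((hA.spec hD h0 hr).2 M).2 hM) List.not_mem_nil
    have hD' := h5.2.1.sound hD
    have h0' := h5.2.1.subset.trans h0
    -- `Vin` is part of the matching `topW`, which has at most one pair per worker; this bounds the
    -- number of nested first branches.
    have hcard : Vin.card ≤ N := by
      refine (Finset.card_le_card (h5.solves_topW hD h0 hr).2.2.1).trans ?_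
      rw [card_topW hD'.subset]
      exact (rows_le D').trans hm
    have hc1 : N * Vin.card ≤ N * N := Nat.mul_le_mul_left N hcard
    have hc2 : N * N * Vin.card ≤ N * N * N := Nat.mul_le_mul_left _ hcard
    rcases hpiv with ⟨hfd, v, hv, hpw, hpf⟩ | ⟨hfd, hsub⟩
    swap
    -- No pivot: the only record is printed by the last command of the call, so the call ends at the
    -- time of the record.
    · refine ⟨s₁, t₀ + t₁ + (1 + (Exp.reg .found).cost) + (1 + (Exp.reg .m).cost + m), [topW P D'],
        (t₀ + t₁ + (1 + (Exp.reg .found).cost) + (1 + (Exp.reg .m).cost + m), (List.range m).map (s₁.arr .bestW)), [],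
        run₁.trans ((Run.ite_false (by simp [Exp.eval, hfd])).trans
          (.single (by simp only [step, Exp.eval, hs₁.state.reg_m]))), k₁, hs₁.lvl,
        .return5 _ _ _ D' h5 (hD'.reduced.topW_eq_topF hD'.subset hsub), ?_, ?_, rfl⟩
      · simp [map_bestW_eq_record hs₁.state hD'.subset]
      · simp only [Exp.cost]
        omega
    -- the first branch
    obtain ⟨hvin, hvout⟩ := h5.pivot_notMem hv
    have hv' := Finset.mem_sdiff.1 hv
    obtain ⟨s₂, t₂, b₂, ht₂, svD, svI, svO, svW, svF⟩ :=
      wp_saveAll hs₁.state.toStatic hs₁.lvl hm hn hN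
    have hf₂ := b₂.frame
    have st₂ := hs₁.state.frame hf₂ rfl
    have k₂ : Kept (m * n) l s₁ s₂ := by
      refine ⟨hf₂.reg_of_avoids (as := []) rfl, hf₂.arr_of_avoids (rs := []) rfl, ?_, ?_⟩
      · simp only [List.forall_mem_cons, List.not_mem_nil, false_imp_iff, implies_true, and_true,
          svD, svI, svO]
        exact ⟨fun k hk => blit_of_lt _ _ _ _ hk, fun k hk => blit_of_lt _ _ _ _ hk,
          fun k hk => blit_of_lt _ _ _ _ hk⟩
      · simp only [List.forall_mem_cons, List.not_mem_nil, false_imp_iff, implies_true, and_true,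
          svW, svF]
        exact ⟨fun k hk => Function.update_of_ne hk.ne _ _,
          fun k hk => Function.update_of_ne hk.ne _ _⟩
    have lvl₂ : s₂.reg .lvl = l := (hf₂.reg .lvl rfl).trans hs₁.lvl
    have pw₂ : s₂.reg .pw = v.1 := (hf₂.reg .pw rfl).trans hpw
    have pf₂ : s₂.reg .pf = v.2 := (hf₂.reg .pf rfl).trans hpf
    obtain ⟨s₃, hs₃⟩ : ∃ s₃, s₃ = (s₂.setReg .lvl (l + 1)).setArr .vin (v.1.val * n + v.2.val) 1 :=
      ⟨_, rfl⟩
    have k₃ : Kept (m * n) l s₂ s₃ :=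
      .of_eq (by simp [hs₃, Store.setReg, Store.setArr]) (by simp [hs₃, Store.setReg, Store.setArr])
    have node₃ : Node P r (l + 1) D' (insert v Vin) (forbid Vin Vout) s₃ := by
      refine ⟨st₂.congr (by simp [hs₃, Store.setReg, Store.setArr])
        (by simp [hs₃, Store.setReg, Store.setArr]), ?_, ?_, ?_, ?_⟩
      · have := hs₁.vin.insert v
        rw [← hf₂.arr .vin rfl] at this
        simpa [hs₃, Store.setReg, Store.setArr] using this
      · have := hs₁.vout
        rw [← hf₂.arr .vout rfl] at this
        simpa [hs₃, Store.setReg, Store.setArr] using this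
      · rw [k₃.reg .r (by simp), k₂.reg .r (by simp), hs₁.reg_r]
      · simp [hs₃, Store.setReg, Store.setArr]
    -- The two known solutions witness that both branches are feasible, as the induction hypothesis
    -- requires.
    have hsolA : Solves P D' (insert v Vin) (forbid Vin Vout) (topW P D') := by
      obtain ⟨h1, h2, h3, h4⟩ := h5.solves_topW hD h0 hr
      exact ⟨h1, h2, Finset.insert_subset hv'.1 h3, h4⟩
    have hsolB : Solves P D' Vin (insert v (forbid Vin Vout)) (topF P D') := by
      obtain ⟨h1, h2, h3, h4⟩ := h5.solves_topF hD h0 hr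
      exact ⟨h1, h2, h3, Finset.disjoint_insert_left.2 ⟨hv'.2, h4⟩⟩
    obtain ⟨s₄, e₄, La, p, o₁, run₄, k₄, lvl₄, algA, recA, firstA, paceA⟩ :=
      ih _ (card_lt_left hvin subset_forbid) node₃ hD' h0' ⟨_, hsolA⟩
        ((.lvl ≔ .sub (.reg .lvl) (.lit 1) ;; restoreAll ;;
          .put .vout (cell (.reg .pw) (.reg .pf)) (.lit 1) ;; .call) :: K)
        (t₀ + t₁ + (1 + (Exp.reg .found).cost) + (1 + t₂) +
          (1 + (1 + (Exp.add (.reg .lvl) (.lit 1)).cost)) +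
          (1 + (1 + (cell (.reg .pw) (.reg .pf)).cost + (Exp.lit 1).cost)) + 1 + 1) o rfl
    -- the second branch
    obtain ⟨s₅, hs₅⟩ : ∃ s₅, s₅ = s₄.setReg .lvl l := ⟨_, rfl⟩
    have k₅ : Kept (m * n) l s₄ s₅ :=
      .of_eq (by simp [hs₅, Store.setReg]) (by simp [hs₅, Store.setReg])
    have k₁₅ : Kept (m * n) l s₁ s₅ := k₂.trans (k₃.trans (k₄.of_succ.trans k₅))
    have static₅ : Static P s₅ := hs₁.state.toStatic.congr
      (fun x hx => k₁₅.reg x (by simp at hx ⊢; tauto)) k₁₅.arr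
    have lvl₅ : s₅.reg .lvl = l := by simp [hs₅, Store.setReg]
    -- The inner call works on level `l + 1` and leaves all addresses below `(l + 1) * (m * n)`
    -- alone, in particular the block saved on level `l`.
    have copy : ∀ a ∈ [Arr.saveD, .saveIn, .saveOut], ∀ k < m * n,
        s₅.arr a (l * (m * n) + k) = s₂.arr a (l * (m * n) + k) := by
      intro a ha k hk
      have h1 : s₅.arr a = s₄.arr a := by simp [hs₅, Store.setReg]
      have h2 := k₄.matrices a ha (l * (m * n) + k) (by rw [add_mul, one_mul]; omega)
      have h3 : s₃.arr a = s₂.arr a := by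
        simp only [List.mem_cons, List.not_mem_nil, or_false] at ha
        rcases ha with rfl | rfl | rfl <;> simp [hs₃, Store.setReg, Store.setArr]
      rw [h1, h2, h3]
    have pivot : ∀ a ∈ [Arr.saveW, .saveF], s₅.arr a l = s₂.arr a l := by
      intro a ha
      have h1 : s₅.arr a = s₄.arr a := by simp [hs₅, Store.setReg]
      have h2 := k₄.pivots a ha l l.lt_succ_self
      have h3 : s₃.arr a = s₂.arr a := by
        simp only [List.mem_cons, List.not_mem_nil, or_false] at ha
        rcases ha with rfl | rfl <;> simp [hs₃, Store.setReg, Store.setArr]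
      rw [h1, h2, h3]
    have holds₅ : ∀ (a b : Arr) (V : Finset (Fin m × Fin n)), a ∈ [Arr.saveD, .saveIn, .saveOut] →
        s₂.arr a = blit (s₁.arr a) (s₁.arr b) (l * (m * n)) 0 (m * n) → Holds (s₁.arr b) V →
        Holds (fun k => s₅.arr a (l * (m * n) + k)) V := by
      intro a b V ha hab hV w f
      have hlt := cell_lt w f
      simp only
      rw [copy a ha _ hlt, hab, blit_add _ _ _ _ hlt, zero_add]
      exact hV w f
    obtain ⟨s₆, t₆, b₆, ht₆, st₆, vin₆, vout₆, pw₆, pf₆⟩ := wp_restoreAll static₅ lvl₅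
      (holds₅ .saveD .D D' (by simp) svD hs₁.state.holds)
      (holds₅ .saveIn .vin Vin (by simp) svI hs₁.vin)
      (holds₅ .saveOut .vout (forbid Vin Vout) (by simp) svO hs₁.vout) hm hn hN
    have hf₆ := b₆.frame
    have pw₆' : s₆.reg .pw = v.1 := by rw [pw₆, pivot _ (by simp), svW, Function.update_self, hpw]
    have pf₆' : s₆.reg .pf = v.2 := by rw [pf₆, pivot _ (by simp), svF, Function.update_self, hpf]
    obtain ⟨s₇, hs₇⟩ : ∃ s₇, s₇ = s₆.setArr .vout (v.1.val * n + v.2.val) 1 := ⟨_, rfl⟩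
    have k₇ : Kept (m * n) l s₁ s₇ := k₁₅.trans ((hf₆.kept rfl).trans
      (.of_eq (by simp [hs₇, Store.setArr]) (by simp [hs₇, Store.setArr])))
    have node₇ : Node P r l D' Vin (insert v (forbid Vin Vout)) s₇ := by
      refine ⟨st₆.congr (by simp [hs₇, Store.setArr]) (by simp [hs₇, Store.setArr]), ?_, ?_, ?_, ?_⟩
      · simpa [hs₇, Store.setArr] using vin₆
      · simpa [hs₇, Store.setArr] using vout₆.insert v
      · rw [k₇.reg .r (by simp), hs₁.reg_r]
      · rw [← lvl₅, ← hf₆.reg .lvl rfl, hs₇]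
        rfl
    -- The second call stays on level `l`: the copy saved there is no longer needed and may be
    -- overwritten.
    obtain ⟨s₈, e₈, Lb, q, o₂, run₈, k₈, lvl₈, algB, recB, firstB, paceB⟩ :=
      ih _ (card_lt_right hvout subset_forbid) node₇ hD' h0' ⟨_, hsolB⟩ K
        (e₄ + (1 + (1 + (Exp.sub (.reg .lvl) (.lit 1)).cost)) + (1 + t₆) +
          (1 + (1 + (cell (.reg .pw) (.reg .pf)).cost + (Exp.lit 1).cost)) + 1) (o ++ p :: o₁) rfl
    refine ⟨s₈, e₈, La ++ Lb, p, o₁ ++ q :: o₂, ?_, k₁.trans (k₇.trans k₈), lvl₈,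
      .branch6 _ _ _ D' v La Lb h5 hv algA algB, ?_, ?_, paceA.append ?_ paceB⟩
    · have ev₃ : Big (.put .vin (cell (.reg .pw) (.reg .pf)) (.lit 1)) (s₂.setReg .lvl (l + 1)) s₃
          (1 + (cell (.reg .pw) (.reg .pf)).cost + (Exp.lit 1).cost) := by
        have := Big.put .vin (cell (.reg .pw) (.reg .pf)) (.lit 1) (s₂.setReg .lvl (l + 1))
        simpa [hs₃, cell, Exp.eval, Store.setReg, pw₂, pf₂, st₂.reg_n] using this
      have ev₂ : Big (.lvl ≔ .add (.reg .lvl) (.lit 1)) s₂ (s₂.setReg .lvl (l + 1))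
          (1 + (Exp.add (.reg .lvl) (.lit 1)).cost) := by
        have := Big.set .lvl (.add (.reg .lvl) (.lit 1)) s₂
        simpa [Exp.eval, lvl₂] using this
      have ev₅ : Big (.lvl ≔ .sub (.reg .lvl) (.lit 1)) s₄ s₅
          (1 + (Exp.sub (.reg .lvl) (.lit 1)).cost) := by
        have := Big.set .lvl (.sub (.reg .lvl) (.lit 1)) s₄
        simpa [hs₅, Exp.eval, lvl₄] using this
      have ev₇ : Big (.put .vout (cell (.reg .pw) (.reg .pf)) (.lit 1)) s₆ s₇
          (1 + (cell (.reg .pw) (.reg .pf)).cost + (Exp.lit 1).cost) := by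
        have := Big.put .vout (cell (.reg .pw) (.reg .pf)) (.lit 1) s₆
        simpa [hs₇, cell, Exp.eval, pw₆', pf₆', st₆.reg_n] using this
      have call₃ : ∀ (c : Cmd) (t : ℕ), Run program2 ⟨.seq .call c :: K, s₃, t, o⟩
          ⟨program2 :: c :: K, s₃, t + 1 + 1, o⟩ := fun c t => ⟨2, rfl⟩
      have call₈ : ∀ (t : ℕ) (o : List (ℕ × List ℕ)), Run program2 ⟨.call :: K, s₇, t, o⟩
          ⟨program2 :: K, s₇, t + 1, o⟩ := fun t o => ⟨1, rfl⟩
      refine run₁.trans ((Run.ite_true (by simp [Exp.eval, hfd])).trans ((Run.seq b₂).trans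
        ((Run.seq ev₂).trans ((Run.seq ev₃).trans ((call₃ _ _).trans (run₄.trans
        ((Run.seq ev₅).trans ((Run.seq b₆).trans ((Run.seq ev₇).trans
        ((call₈ _ _).trans ?_))))))))))
      rw [List.append_assoc, List.cons_append] at run₈
      exact run₈
    · rw [← List.cons_append, List.map_append, recA, recB, List.map_append]
    -- The pair added to `Vin` releases `3000 * (N * N)` of the bound, which pays for this call up
    -- to its branching.
    · rw [Finset.card_insert_of_notMem hvin, mul_add, mul_one] at firstA
      simp only [Exp.cost, cell] at firstA
      omega
    -- The gap between the branches: restoration, at most 500 N^2, and the first-output bound of the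
    -- second call, at most 3000 N^2 + 3000 N^3 + 1000 N^3, stay below 8000 N^3 together with the
    -- constant overhead.
    · have := Nat.mul_le_mul_left N (card_le_mul_self hm hn D')
      rw [← mul_assoc] at this
      simp only [Exp.cost, cell] at firstB
      omega

end

section
variable {m n : ℕ} {P : Market m n} {D E Vin Vout D' : Finset (Fin m × Fin n)} {s s' s'' : Store}
  {N r l : ℕ}

/-! ## The main program -/

/-- A list without repetitions has at most as many entries as there are possible partners, so
quotient and remainder recover list and position. -/
theorem static_input (P : Market m n) (Vin Vout : Finset (Fin m × Fin n)) :
    Static P (input P Vin Vout) where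
  reg_m := rfl
  reg_n := rfl
  lenW w := by simp [input]
  lenF f := by simp [input]
  prefW w i h := by
    have hi : i < n := h.trans_le (length_workerPref_le P w)
    have h1 : (w.val * n + i) / n = w := by
      rw [mul_comm, Nat.mul_add_div (by omega), Nat.div_eq_of_lt hi, add_zero]
    have h2 : (w.val * n + i) % n = i := by rw [mul_comm, Nat.mul_add_mod, Nat.mod_eq_of_lt hi]
    simp [input, h1, h2, h]
  prefF f i h := by
    have hi : i < m := h.trans_le (length_firmPref_le P f)
    have h1 : (f.val * m + i) / m = f := by
      rw [mul_comm, Nat.mul_add_div (by omega), Nat.div_eq_of_lt hi, add_zero]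
    have h2 : (f.val * m + i) % m = i := by rw [mul_comm, Nat.mul_add_mod, Nat.mod_eq_of_lt hi]
    simp [input, h1, h2, h]

theorem holds_indicator (V : Finset (Fin m × Fin n)) :
    Holds (fun k => if ∃ v ∈ V, k = v.1.val * n + v.2.val then 1 else 0) V := by
  intro w f
  refine if_congr ⟨?_, fun h => ⟨_, h, rfl⟩⟩ rfl rfl
  rintro ⟨v, hv, e⟩
  obtain ⟨rfl, rfl⟩ := cell_inj e
  exact hv

/-- Mark the acceptable pairs. -/
def loadVertices : Cmd :=
  forUpTo .w (.reg .m) (forUpTo .i (.get .lenW (.reg .w))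
    (.put .D (cell (.reg .w) (.get .prefW (cell (.reg .w) (.reg .i)))) (.lit 1)))

theorem wp_loadVertices (hs : Static P s) (hD : Holds (s.arr .D) (∅ : Finset (Fin m × Fin n)))
    (hm : m ≤ N) (hn : n ≤ N) (hN : 1 ≤ N) :
    WP loadVertices s fun s' t => t ≤ 200 * (N * N) ∧ Holds (s'.arr .D) P.vertices := by
  refine (wp_forUpTo (e := .reg .m) (N := m) (fun i s' =>
    Holds (s'.arr .D) (P.vertices.filter fun v => v.1 < i)) (100 * N)
    rfl (fun s' hf => (hs.frame hf rfl).reg_m) ?_ ?_).mono ?_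
  · simpa [Store.setReg] using hD
  · intro i hi s₁ hf₁ hr₁ hI₁
    have hs₁ := hs.frame hf₁ rfl
    refine (wp_forUpTo (e := .get .lenW (.reg .w)) (N := (P.workerPref ⟨i, hi⟩).length)
      (fun j s' => Holds (s'.arr .D) ((P.vertices.filter fun v => v.1 < i) ∪
        ((P.workerPref ⟨i, hi⟩).take j).toFinset.image fun f => (⟨i, hi⟩, f))) 50
      rfl ?_ ?_ ?_).mono ?_
    · intro s' hf
      have h1 : s'.reg .w = i := (hf.reg .w rfl).trans hr₁
      have h2 := (hs₁.frame hf rfl).lenW ⟨i, hi⟩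
      simpa [Exp.eval, h1] using h2
    · simpa [Store.setReg] using hI₁
    · intro j hj s₂ hf₂ hr₂ hI₂
      have hs₂ := hs₁.frame hf₂ rfl
      have hr₂' : s₂.reg .w = i := (hf₂.reg .w rfl).trans hr₁
      have hp := hs₂.prefW ⟨i, hi⟩ j hj
      simp only at hp
      simp only [wp_put, cell, Exp.eval, Exp.cost, Store.setReg, Store.setArr, hr₂, hr₂',
        hs₂.reg_n, hp, Function.update_self]
      refine ⟨by omega, ?_⟩
      have := hI₂.insert (⟨i, hi⟩, (P.workerPref ⟨i, hi⟩)[j])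
      rw [List.take_succ_eq_append_getElem hj, List.toFinset_append, Finset.image_union,
        ← Finset.union_assoc]
      simpa [Finset.union_comm _ {_}, ← Finset.insert_eq] using this
    · rintro s' t ⟨ht, -, hI⟩
      constructor
      · have := linear_time (c := 8) (d := 60) ((length_workerPref_le P ⟨i, hi⟩).trans hn) hN
        simp only [Exp.cost] at ht
        omega
      · rw [List.take_length] at hI
        have : (P.vertices.filter fun v => v.1 < i + 1) = (P.vertices.filter fun v => v.1 < i) ∪
            (P.workerPref ⟨i, hi⟩).toFinset.image fun f => (⟨i, hi⟩, f) := by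
          ext ⟨w, f⟩
          simp only [Finset.mem_union, Finset.mem_filter, Finset.mem_image, List.mem_toFinset,
            mem_vertices, Nat.lt_succ_iff_lt_or_eq, Prod.mk.injEq, Fin.ext_iff]
          constructor
          · rintro ⟨h, h' | rfl⟩
            · exact .inl ⟨h, h'⟩
            · exact .inr ⟨f, h, rfl, rfl⟩
          · rintro (⟨h, h'⟩ | ⟨g, hg, rfl, e⟩)
            · exact ⟨h, .inl h'⟩
            · obtain rfl : g = f := Fin.ext e
              exact ⟨hg, .inr rfl⟩
        rw [this]
        exact hI
  · rintro s' t ⟨ht, -, hI⟩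
    rw [Finset.filter_true_of_mem fun v _ => v.1.isLt] at hI
    refine ⟨?_, hI⟩
    have := quadratic_time (c := 7) (d := 9) (a := 100) hm hN
    simp only [Exp.cost, Nat.reduceAdd] at ht
    omega

theorem run_program1_setup (P : Market m n) (Vin Vout : Finset (Fin m × Fin n)) (hm : m ≤ N)
    (hn : n ≤ N) (hN : 1 ≤ N) :
    ∃ s t, Run program2 ⟨[program1], input P Vin Vout, 0, []⟩ ⟨[program2], s, t, []⟩ ∧
      t ≤ 2000 * (N * N * N) ∧
      Node P (rows (idua P P.vertices)) 0 (idua P P.vertices) Vin Vout s := by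
  have hNN := Nat.mul_le_mul hN hN
  have hN2 := Nat.mul_le_mul_left N hN
  have hN3 := Nat.mul_le_mul_left (N * N) hN
  have hs := static_input P Vin Vout
  obtain ⟨s₁, t₁, b₁, ht₁, D₁⟩ := wp_loadVertices hs (fun _ _ => by simp [input]) hm hn hN
  have hf₁ := b₁.frame
  have hs₁ := hs.frame hf₁ rfl
  have hI₁ : Holds (s₁.arr .vin) Vin := by
    rw [hf₁.arr .vin rfl]
    exact holds_indicator Vin
  have hO₁ : Holds (s₁.arr .vout) Vout := by
    rw [hf₁.arr .vout rfl]
    exact holds_indicator Vout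
  obtain ⟨s₂, t₂, b₂, ht₂, st₂⟩ := wp_refreshAll hs₁ D₁ hm hn hN
  have hf₂ := b₂.frame
  obtain ⟨s₃, t₃, b₃, ht₃, st₃⟩ := wp_runIdua st₂ subset_rfl hm hn hN
  have hf₃ := b₃.frame
  obtain ⟨s₄, t₄, b₄, ht₄, hr₄⟩ := wp_countRows (x := .r) (by decide) st₃ idua_subset hm hN
  have hf₄ := b₄.frame
  have st₄ := st₃.frame hf₄ rfl
  refine ⟨s₄.setReg .lvl 0, 0 + (1 + t₁) + (1 + t₂) + (1 + t₃) + (1 + t₄) + (1 + (1 + 1)) + 1,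
    (Run.seq b₁).trans ((Run.seq b₂).trans ((Run.seq b₃).trans ((Run.seq b₄).trans
      ((Run.seq (.set .lvl (.lit 0) s₄)).trans ⟨1, rfl⟩)))), ?_,
    ⟨st₄.congr (by simp [Store.setReg]) (fun _ _ => rfl), ?_, ?_, by simpa [Store.setReg] using hr₄,
      by simp [Store.setReg]⟩⟩
  · have := Nat.mul_le_mul_left N (card_le_mul_self hm hn P.vertices)
    rw [← mul_assoc] at this
    omega
  · simpa [Store.setReg, hf₄.arr .vin rfl, hf₃.arr .vin rfl, hf₂.arr .vin rfl] using hI₁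
  · simpa [Store.setReg, hf₄.arr .vout rfl, hf₃.arr .vout rfl, hf₂.arr .vout rfl] using hO₁

/-- With a solution, the first-output bound and the pacing of `run_program2` apply to the initial
call. Without one, that call cannot arrive at Step 2.5, since `topW` would be a solution there; it
returns without branching. Initially `Vin` may have up to N^2 pairs, so forbidding alone can take
O(N^3). -/
theorem implementation_time (P : Market m n) (Vin Vout : Finset (Fin m × Fin n)) (hm : m ≤ N)
    (hn : n ≤ N) (hN : 1 ≤ N) :
    ∃ (c : Config) (L : List (Finset (Fin m × Fin n))),
      HaltsIn program1 program2 (input P Vin Vout) c ∧ Algorithm1 P Vin Vout L ∧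
      c.tape.map Prod.snd = L.map record ∧
      c.clock ≤ 10000 * (N ^ 3 + N ^ 3 * L.length) ∧
      c.tape.IsChain fun a b => b.1 ≤ a.1 + 10000 * N ^ 3 := by
  have hN3' : N ^ 3 = N * N * N := by ring
  rw [hN3']
  have hNN := Nat.mul_le_mul hN hN
  have hN2 := Nat.mul_le_mul_left N hN
  have hN3 := Nat.mul_le_mul_left (N * N) hN
  have hcard := Nat.mul_le_mul_left N (card_le_mul_self hm hn (idua P P.vertices))
  have hcard' := Nat.mul_le_mul_left N (card_le_mul_self hm hn Vin)
  rw [← mul_assoc] at hcard hcard'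
  obtain ⟨s, t, run, ht, node⟩ := run_program1_setup P Vin Vout hm hn hN
  by_cases hsol : ∃ M, Solves P (idua P P.vertices) Vin Vout M
  · obtain ⟨s', e, L, p, o, run', -, -, alg, rec, first, pace⟩ :=
      run_program2 hm hn hN rfl node sound_idua_vertices subset_rfl hsol [] t []
    refine ⟨_, L, ⟨rfl, run.trans run'⟩, alg, rec, ?_, ?_⟩
    · have hlen : L.length = o.length + 1 := by simpa using (congrArg List.length rec).symm
      have := pace.le
      rw [hlen, mul_add (N * N * N), mul_one]
      simp only
      -- The gaps after the first record cost 8000 N^3 each; the first record and the setup fit into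
      -- the share of the first solution and the summand without solutions.
      have h8 : 8000 * (N * N * N) * o.length ≤ 10000 * (N * N * N * o.length) := by
        rw [mul_assoc]
        exact Nat.mul_le_mul_right _ (by norm_num)
      omega
    · rw [List.nil_append]
      refine pace.isChain.imp fun a b h => h.trans ?_
      omega
  · rcases run_program2_steps node idua_subset hm hn hN [] t [] with
      ⟨s', t', run', alg, ht'⟩ | ⟨D', _, _, -, h5, -⟩
    · refine ⟨_, [], ⟨rfl, run.trans run'⟩, alg, rfl, ?_, .nil⟩
      simp only [List.length_nil, mul_zero, add_zero]
      omega
    · exact absurd ⟨_, h5.2.1.solves_iff.2 (h5.solves_topW sound_idua_vertices subset_rfl rfl)⟩ hsol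

end

end StableMatch

/-! ### Correctness and time bounds combined. -/

theorem theorem1 :
    ∃ C : ℕ, ∀ (m n : ℕ) (P : StableMatch.Market m n) (Vin Vout : Finset (Fin m × Fin n)),
      Disjoint Vin Vout →
      -- Algorithm 1 halts, and it outputs the feasible stable matchings, each once,
      -- whatever choices are made
      (StableMatch.Algorithm1Halts P Vin Vout ∧
        (∃ L, StableMatch.Algorithm1 P Vin Vout L) ∧
        ∀ L, StableMatch.Algorithm1 P Vin Vout L →
          L.Nodup ∧ ∀ M, M ∈ L ↔ StableMatch.IsStable P M ∧ Vin ⊆ M ∧ Disjoint Vout M) ∧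
      -- running time and delay of its implementation
      (0 < max m n →
        ∃ (c : StableMatch.Config) (L : List (Finset (Fin m × Fin n))),
          StableMatch.HaltsIn StableMatch.program1 StableMatch.program2
            (StableMatch.input P Vin Vout) c ∧
          StableMatch.Algorithm1 P Vin Vout L ∧
          c.tape.map Prod.snd = L.map StableMatch.record ∧
          c.clock ≤ C * ((max m n) ^ 3 + (max m n) ^ 3 * L.length) ∧
          c.tape.IsChain fun a b => b.1 ≤ a.1 + C * (max m n) ^ 3) := by
  refine ⟨10000, fun m n P Vin Vout _ => ⟨⟨StableMatch.algorithm2Halts _ _ _ _ _, ?_,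
    fun L hL => hL.spec⟩, fun h => ?_⟩⟩
  · exact (StableMatch.algorithm2Halts P _ _ Vin Vout).exists_algorithm2
      StableMatch.sound_idua_vertices
  · exact StableMatch.implementation_time P Vin Vout (le_max_left m n) (le_max_right m n) h
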